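/- Let $K$ be a field, $\varphi$ a ring endomorphism of $K$, and let $R=K[t;\varphi]$ be the ring of finite formal sums $\sum_i t^i a_i$ ($a_i\in K$) with termwise addition and the multiplication determined by $at=t\varphi(a)$ for $a\in K$, i.e. $(\sum_k t^k a_k)(\sum_l t^l b_l)=\sum_i t^i\sum_{k+l=i}\varphi^l(a_k)b_l$. All $R$-modules are right $R$-modules. A *$\tau$-chain* is a linear order $\Delta$ with a maximum $\infty$ and a strictly increasing map $\tau:\Delta\to\Delta$ with $\tau(\infty)=\infty$, such that for all $\gamma\neq\infty$ and $\delta<\gamma$, $\tau(\gamma)\le\gamma$ implies $\tau(\delta)<\delta$. For $\gamma\in\Delta$ write $\gamma>\theta$ if $\tau(\gamma)>\gamma$ or $\gamma=\infty$ (this does not presuppose an element $\theta$ in $\Delta$). A *valued $R$-module* $(M,v)$ is an $R$-module $M$ with a surjective map $v:M\to\Delta=v(M)$ onto a $\tau$-chain such that, for all $x,y\in M$: $v(x)=\infty\iff x=0$; $v(x\pm y)\ge\min\{v(x),v(y)\}$; $v(x.\lambda)=v(x)$ for all $\lambda\in K^\times$; $v(x.t)=\tau(v(x))$; and $x\mapsto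 x.t$ is injective. It is *henselian* if for every $r\in R$ not divisible by $t$ (i.e. not of the form $ts$) and every $x\in M$ with $v(x)>\theta$ there is $y\in M$ with $y.r=x$ and $v(y)>\theta$. It is *divisible* if for every nonzero $r\in R$ and every $x\in M$ there is $y\in M$ with $y.r=x$. The *torsion submodule* of $M$ is $M_{tor}=\{x\in M: x.r=0\text{ for some nonzero }r\in R\}$. Let $L_{Mod}(R)=\{0,+,-,(.r)_{r\in R}\}$ be the language of $R$-modules and $L_V=\{<,\tau,\infty,(R_n)_{n\in\mathbb N}\}$, where in a value set $v(M)$ the unary predicate $R_n$ is interpreted, for $\gamma\ne\infty$, by $R_n(\gamma)\iff |M_{\ge\gamma}/M_{>\gamma}|\ge n$, with $M_{\ge\gamma}=\{x\in M:v(x)\ge\gamma\}$ and $M_{>\gamma}=\{x\in M:v(x)>\gamma\}$ ($R_n(\infty)$ is false by convention). Let $L=L_{Mod}(R)\cup L_V\cup\{v\}$ be the two-sorted language with a module sort carrying $L_{Mod}(R)$, a value set sort carrying $L_V$, and a function symbol $v$ from the module sort to the value set sort. **Theorem.** Let $(F,v)$ and $(G,w)$ be two nonzero henselian divisible valued $R$-modules.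 Suppose that $F_{tor}$ and $G_{tor}$ are elementarily equivalent as $L_{Mod}(R)$-structures and that the value sets $v(F)$ and $w(G)$ are elementarily equivalent as $L_V$-structures. Then $(F,v)$ and $(G,w)$ are elementarily equivalent as two-sorted $L$-structures. -/

import Mathlib

open scoped RightActions

/-! ### The ring of twisted polynomials `K[t; φ]` -/

/-- The type underlying the ring `R = K[t; φ]`: finite formal sums `∑ tⁱ aᵢ` with `aᵢ ∈ K`
written on the right, stored as the finitely supported family `i ↦ aᵢ`. -/
def TwistedPolynomial {K : Type*} [Field K] (_φ : K →+* K) : Type _ := ℕ →₀ K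

namespace TwistedPolynomial

variable {K : Type*} [Field K] {φ : K →+* K}

noncomputable instance : AddCommGroup (TwistedPolynomial φ) :=
  inferInstanceAs (AddCommGroup (ℕ →₀ K))

/-- The formal sum `∑ tⁱ aᵢ` given by a finitely supported family `a`. -/
def ofFinsupp (φ : K →+* K) (a : ℕ →₀ K) : TwistedPolynomial φ := a

/-- The family of coefficients of a formal sum. -/
def toFinsupp (r : TwistedPolynomial φ) : ℕ →₀ K := r

/-- The coefficient `aᵢ` of `∑ tⁱ aᵢ`. -/
def coeff (r : TwistedPolynomial φ) (i : ℕ) : K := r.toFinsupp i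

/-- The monomial `tⁱ a`. -/
noncomputable def monomial (φ : K →+* K) (i : ℕ) (a : K) : TwistedPolynomial φ :=
  ofFinsupp φ (Finsupp.single i a)

/-- The inclusion of the constants `K` in `K[t; φ]`. -/
noncomputable def C (φ : K →+* K) (a : K) : TwistedPolynomial φ := monomial φ 0 a

/-- The indeterminate `t`. -/
noncomputable def T (φ : K →+* K) : TwistedPolynomial φ := monomial φ 1 1

@[ext] theorem ext' {r s : TwistedPolynomial φ} (h : ∀ i, coeff r i = coeff s i) : r = s :=
  Finsupp.ext h

@[simp] theorem coeff_add (r s : TwistedPolynomial φ) (i : ℕ) :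
    coeff (r + s) i = coeff r i + coeff s i := Finsupp.add_apply _ _ _

@[simp] theorem coeff_sub (r s : TwistedPolynomial φ) (i : ℕ) :
    coeff (r - s) i = coeff r i - coeff s i := Finsupp.sub_apply _ _ _

@[simp] theorem coeff_zero (i : ℕ) : coeff (0 : TwistedPolynomial φ) i = 0 := rfl

theorem coeff_monomial (i j : ℕ) (a : K) :
    coeff (monomial φ i a) j = if i = j then a else 0 := Finsupp.single_apply

/-- The multiplication of `K[t; φ]`: the coefficient of index `i` of `(∑ tᵏ aₖ) (∑ tˡ bₗ)` is
`∑_{k + l = i} φˡ(aₖ) bₗ`.  In particular `a t = t φ(a)` for `a ∈ K`. -/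
noncomputable instance : Mul (TwistedPolynomial φ) where
  mul r s := ofFinsupp φ <| Finsupp.onFinset
    ((r.toFinsupp.support ×ˢ s.toFinsupp.support).image fun p => p.1 + p.2)
    (fun i => ∑ p ∈ Finset.HasAntidiagonal.antidiagonal i, (φ ^ p.2) (coeff r p.1) * coeff s p.2)
    (by
      intro i hi
      obtain ⟨p, hp, hne⟩ := Finset.exists_ne_zero_of_sum_ne_zero hi
      refine Finset.mem_image.2 ⟨p, Finset.mem_product.2 ⟨?_, ?_⟩, Finset.HasAntidiagonal.mem_antidiagonal.1 hp⟩
      · refine Finsupp.mem_support_iff.2 fun h => hne ?_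
        change coeff r p.1 = 0 at h
        simp [h]
      · refine Finsupp.mem_support_iff.2 fun h => hne ?_
        change coeff s p.2 = 0 at h
        simp [h])

theorem coeff_mul (r s : TwistedPolynomial φ) (i : ℕ) :
    coeff (r * s) i =
      ∑ p ∈ Finset.HasAntidiagonal.antidiagonal i, (φ ^ p.2) (coeff r p.1) * coeff s p.2 := rfl

noncomputable instance : One (TwistedPolynomial φ) := ⟨C φ 1⟩

theorem one_def : (1 : TwistedPolynomial φ) = monomial φ 0 1 := rfl

theorem left_distrib' (a b c : TwistedPolynomial φ) : a * (b + c) = a * b + a * c := by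
  ext i
  simp [coeff_mul, mul_add, Finset.sum_add_distrib]

theorem right_distrib' (a b c : TwistedPolynomial φ) : (a + b) * c = a * c + b * c := by
  ext i
  simp [coeff_mul, add_mul, Finset.sum_add_distrib]

theorem zero_mul' (a : TwistedPolynomial φ) : 0 * a = 0 := by
  ext i
  simp [coeff_mul]

theorem mul_zero' (a : TwistedPolynomial φ) : a * 0 = 0 := by
  ext i
  simp [coeff_mul]

theorem monomial_mul_monomial (i j : ℕ) (a b : K) :
    monomial φ i a * monomial φ j b = monomial φ (i + j) ((φ ^ j) a * b) := by
  ext n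
  rw [coeff_mul, coeff_monomial]
  split_ifs with h
  · rw [Finset.sum_eq_single (i, j)]
    · simp [coeff_monomial]
    · rintro ⟨k, l⟩ - hne
      by_cases h1 : i = k
      · have h2 : j ≠ l := fun h2 => hne (by rw [h1, h2])
        simp [coeff_monomial, h2]
      · simp [coeff_monomial, h1]
    · intro hn
      exact absurd (Finset.HasAntidiagonal.mem_antidiagonal.2 h) hn
  · refine Finset.sum_eq_zero ?_
    rintro ⟨k, l⟩ hkl
    have hkl' : k + l = n := Finset.HasAntidiagonal.mem_antidiagonal.1 hkl
    by_cases h1 : i = k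
    · have h2 : j ≠ l := fun h2 => h (by rw [h1, h2, hkl'])
      simp [coeff_monomial, h2]
    · simp [coeff_monomial, h1]

theorem induction' {P : TwistedPolynomial φ → Prop} (r : TwistedPolynomial φ) (h0 : P 0)
    (hadd : ∀ a b, P a → P b → P (a + b)) (hmon : ∀ i a, P (monomial φ i a)) : P r :=
  Finsupp.induction_linear (motive := P) r h0 hadd hmon

theorem mul_assoc' (a b c : TwistedPolynomial φ) : a * b * c = a * (b * c) := by
  induction a using induction' with
  | h0 => simp only [zero_mul']
  | hadd a a' h h' => simp only [right_distrib', h, h']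
  | hmon i x =>
    induction b using induction' with
    | h0 => simp only [zero_mul', mul_zero']
    | hadd a a' h h' => simp only [right_distrib', left_distrib', h, h']
    | hmon j y =>
      induction c using induction' with
      | h0 => simp only [mul_zero']
      | hadd a a' h h' => simp only [left_distrib', h, h']
      | hmon k z =>
        simp only [monomial_mul_monomial, map_mul, add_assoc, mul_assoc, add_comm j k, pow_add]
        rfl

noncomputable instance : Ring (TwistedPolynomial φ) :=
  { (inferInstance : AddCommGroup (TwistedPolynomial φ)),
    (inferInstance : Mul (TwistedPolynomial φ)),
    (inferInstance : One (TwistedPolynomial φ)) with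
    left_distrib := left_distrib'
    right_distrib := right_distrib'
    zero_mul := zero_mul'
    mul_zero := mul_zero'
    mul_assoc := mul_assoc'
    one_mul := fun a => by
      induction a using induction' with
      | h0 => exact mul_zero' _
      | hadd a a' h h' => rw [left_distrib', h, h']
      | hmon i x => rw [one_def, monomial_mul_monomial]; simp
    mul_one := fun a => by
      induction a using induction' with
      | h0 => exact zero_mul' _
      | hadd a a' h h' => rw [right_distrib', h, h']
      | hmon i x => rw [one_def, monomial_mul_monomial]; simp
    zsmul := fun n a => n • a
    nsmul := fun n a => n • a
    zsmul_zero' := fun a => zero_zsmul a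
    zsmul_succ' := fun n a => SubNegMonoid.zsmul_succ' n a
    zsmul_neg' := fun n a => SubNegMonoid.zsmul_neg' n a
    nsmul_zero := fun a => zero_nsmul a
    nsmul_succ := fun n a => succ_nsmul a n
    neg_add_cancel := fun a => neg_add_cancel a
    sub_eq_add_neg := fun a b => sub_eq_add_neg a b }

/-- A nonzero `r` has a degree: an index `n` with nonzero coefficient, all later ones being zero. -/
theorem exists_leading {r : TwistedPolynomial φ} (hr : r ≠ 0) :
    ∃ n, coeff r n ≠ 0 ∧ ∀ i, n < i → coeff r i = 0 := by
  have hne : r.toFinsupp.support.Nonempty :=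
    Finsupp.support_nonempty_iff.2 hr
  refine ⟨r.toFinsupp.support.max' hne, ?_, fun i hi => ?_⟩
  · exact Finsupp.mem_support_iff.1 (Finset.max'_mem _ hne)
  · by_contra h
    exact absurd (Finset.le_max' _ i (Finsupp.mem_support_iff.2 h)) (not_le.2 hi)

theorem coeff_mul_top {a b : TwistedPolynomial φ} {m n : ℕ}
    (ha : ∀ i, m < i → coeff a i = 0) (hb : ∀ i, n < i → coeff b i = 0) :
    coeff (a * b) (m + n) = (φ ^ n) (coeff a m) * coeff b n := by
  rw [coeff_mul, Finset.sum_eq_single (m, n)]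
  · rintro ⟨k, l⟩ hkl hne
    have h : k + l = m + n := Finset.HasAntidiagonal.mem_antidiagonal.1 hkl
    rcases lt_trichotomy k m with h1 | h1 | h1
    · simp [hb l (by omega)]
    · exact absurd (by rw [h1, show l = n by omega]) hne
    · simp [ha k h1]
  · intro h
    exact absurd (Finset.HasAntidiagonal.mem_antidiagonal.2 (show m + n = m + n from rfl)) h

theorem coeff_mul_gt {a b : TwistedPolynomial φ} {m n : ℕ}
    (ha : ∀ i, m < i → coeff a i = 0) (hb : ∀ i, n < i → coeff b i = 0) {i : ℕ} (hi : m + n < i) :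
    coeff (a * b) i = 0 := by
  rw [coeff_mul]
  refine Finset.sum_eq_zero ?_
  rintro ⟨k, l⟩ hkl
  have h : k + l = i := Finset.HasAntidiagonal.mem_antidiagonal.1 hkl
  rcases lt_or_ge m k with h1 | h1
  · simp [ha k h1]
  · simp [hb l (by omega)]

theorem mul_ne_zero' {a b : TwistedPolynomial φ} (ha : a ≠ 0) (hb : b ≠ 0) : a * b ≠ 0 := by
  obtain ⟨m, hm, hm'⟩ := exists_leading ha
  obtain ⟨n, hn, hn'⟩ := exists_leading hb
  intro h
  have h1 := coeff_mul_top hm' hn'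
  rw [h, coeff_zero] at h1
  exact mul_ne_zero ((map_ne_zero (φ ^ n)).2 hm) hn h1.symm

/-- Right euclidean division: `a = b q + r` with `r` of degree smaller than the degree of `b`. -/
theorem exists_div {b : TwistedPolynomial φ} {n : ℕ} (hn : coeff b n ≠ 0)
    (hn' : ∀ i, n < i → coeff b i = 0) (m : ℕ) :
    ∀ a : TwistedPolynomial φ, (∀ i, m ≤ i → coeff a i = 0) →
      ∃ q r : TwistedPolynomial φ, a = b * q + r ∧ ∀ i, n ≤ i → coeff r i = 0 := by
  induction m with
  | zero =>
    intro a ha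
    exact ⟨0, a, by simp, fun i _ => ha i (Nat.zero_le i)⟩
  | succ m ih =>
    intro a ha
    rcases lt_or_ge m n with h | h
    · exact ⟨0, a, by simp, fun i hi => ha i (by omega)⟩
    · set c : K := ((φ ^ (m - n)) (coeff b n))⁻¹ * coeff a m with hc
      have hmon : ∀ i, m - n < i → coeff (monomial φ (m - n) c) i = 0 := fun i hi => by
        rw [coeff_monomial, if_neg (by omega)]
      obtain ⟨q, r, hqr, hr⟩ := ih (a - b * monomial φ (m - n) c) (by
        intro i hi
        rw [coeff_sub]
        rcases hi.eq_or_lt with rfl | hi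
        · have h1 := coeff_mul_top hn' hmon
          rw [coeff_monomial, if_pos rfl, show n + (m - n) = m by omega, hc,
            mul_inv_cancel_left₀ ((map_ne_zero (φ ^ (m - n))).2 hn)] at h1
          rw [h1, sub_self]
        · rw [ha i (by omega), coeff_mul_gt hn' hmon (by omega), sub_self])
      refine ⟨monomial φ (m - n) c + q, r, ?_, hr⟩
      rw [mul_add, add_assoc, ← hqr]
      abel

/-- The right Ore condition: two elements have a common right multiple. -/
theorem exists_common_multiple {b : TwistedPolynomial φ} (hb : b ≠ 0) (a : TwistedPolynomial φ) :
    ∃ c d : TwistedPolynomial φ, c ≠ 0 ∧ a * c = b * d := by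
  have key : ∀ (n : ℕ) (b : TwistedPolynomial φ), b ≠ 0 → (∀ i, n ≤ i → coeff b i = 0) →
      ∀ a : TwistedPolynomial φ, ∃ c d : TwistedPolynomial φ, c ≠ 0 ∧ a * c = b * d := by
    intro n
    induction n with
    | zero => exact fun b hb h _ => absurd (ext' fun i => h i (Nat.zero_le i)) hb
    | succ n ih =>
      intro b hb h a
      obtain ⟨N, hN, hN'⟩ := exists_leading hb
      have hNn : N ≤ n := by
        by_contra hlt
        exact hN (h N (by omega))
      obtain ⟨q, r, hqr, hr⟩ : ∃ q r : TwistedPolynomial φ,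
          a = b * q + r ∧ ∀ i, N ≤ i → coeff r i = 0 := by
        by_cases ha : a = 0
        · exact ⟨0, 0, by simp [ha], fun i _ => coeff_zero i⟩
        · obtain ⟨m, -, hm⟩ := exists_leading ha
          exact exists_div hN hN' (m + 1) a fun i hi => hm i hi
      by_cases hr0 : r = 0
      · refine ⟨1, q, fun h1 => hb ?_, by rw [mul_one, hqr, hr0, add_zero]⟩
        rw [← mul_one b, h1, mul_zero]
      · obtain ⟨c, d, hc, hcd⟩ := ih r hr0 (fun i hi => hr i (hNn.trans hi)) b
        refine ⟨d, q * d + c, fun hd => ?_, ?_⟩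
        · rw [hd, mul_zero] at hcd
          exact mul_ne_zero' hb hc hcd
        · rw [hqr, add_mul, ← hcd, mul_add, mul_assoc]
  obtain ⟨m, -, hm⟩ := exists_leading hb
  exact key (m + 1) b hb (fun i hi => hm i hi) a

/-- `r` is separable if `t` does not divide `r`, i.e. `r` is not of the form `t * s`. -/
def IsSeparable (r : TwistedPolynomial φ) : Prop := ¬ T φ ∣ r

end TwistedPolynomial

/-! ### Right modules over `K[t; φ]`

A right `R`-module is a `Module Rᵐᵒᵖ M`, and `x <• r` is the right action `x.r`. -/

section RightModules

variable {K : Type*} [Field K] (φ : K →+* K)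
variable (M : Type*) [AddCommGroup M] [Module (TwistedPolynomial φ)ᵐᵒᵖ M]

/-- `M` is divisible: every `x ∈ M` is of the form `y.r`, for every nonzero `r`. -/
def IsDivisibleModule : Prop :=
  ∀ r : TwistedPolynomial φ, r ≠ 0 → ∀ x : M, ∃ y : M, y <• r = x

/-- The torsion submodule `M_tor = {x | x.r = 0 for some nonzero r}`. -/
def torsionSubmodule : Submodule (TwistedPolynomial φ)ᵐᵒᵖ M where
  carrier := {x | ∃ r : TwistedPolynomial φ, r ≠ 0 ∧ x <• r = 0}
  zero_mem' := ⟨TwistedPolynomial.T φ, fun h => by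
    have h1 := congrArg (fun r => TwistedPolynomial.coeff r 1) h
    simp [TwistedPolynomial.T, TwistedPolynomial.coeff_monomial] at h1, smul_zero _⟩
  add_mem' := by
    rintro x y ⟨r, hr, hx⟩ ⟨s, hs, hy⟩
    obtain ⟨c, d, hc, hcd⟩ := TwistedPolynomial.exists_common_multiple hr s
    refine ⟨s * c, TwistedPolynomial.mul_ne_zero' hs hc, ?_⟩
    rw [smul_add]
    nth_rewrite 1 [hcd]
    rw [MulOpposite.op_mul, MulOpposite.op_mul, mul_smul, mul_smul, hx, hy, smul_zero, smul_zero,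
      add_zero]
  smul_mem' := by
    rintro a x ⟨r, hr, hx⟩
    obtain ⟨c, d, hc, hcd⟩ := TwistedPolynomial.exists_common_multiple hr a.unop
    refine ⟨c, hc, ?_⟩
    have h : MulOpposite.op c * a = MulOpposite.op (r * d) := by
      rw [← hcd, MulOpposite.op_mul, MulOpposite.op_unop]
    rw [← mul_smul, h, MulOpposite.op_mul, mul_smul, hx, smul_zero]

end RightModules

/-! ### The one-sorted languages -/

/-- The function symbols `0`, `-`, `+`, `.r` (for `r ∈ R`) of the language of right `R`-modules. -/
inductive ModuleFunc (R : Type*) : ℕ → Type _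
  | zero : ModuleFunc R 0
  | neg : ModuleFunc R 1
  | add : ModuleFunc R 2
  | act (r : R) : ModuleFunc R 1

/-- The language `L_Mod(R)` of right `R`-modules. -/
def LMod (R : Type*) : FirstOrder.Language where
  Functions := ModuleFunc R
  Relations := fun _ => Empty

/-- A right `R`-module as an `L_Mod(R)`-structure. -/
instance moduleStructure (R M : Type*) [Ring R] [AddCommGroup M] [Module Rᵐᵒᵖ M] :
    (LMod R).Structure M where
  funMap := fun {n} (f : ModuleFunc R n) =>
    match n, f with
    | _, .zero => fun _ => 0
    | _, .neg => fun x => -x 0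
    | _, .add => fun x => x 0 + x 1
    | _, .act r => fun x => x 0 <• r
  RelMap := fun f => Empty.elim f

/-- The function symbols `∞`, `τ` of the value set sort. -/
inductive ValueFunc : ℕ → Type
  | infty : ValueFunc 0
  | tau : ValueFunc 1

/-- The relation symbols `<`, `R_n` (for `n ∈ ℕ`) of the value set sort. -/
inductive ValueRel : ℕ → Type
  | lt : ValueRel 2
  | card (n : ℕ) : ValueRel 1

/-- The language `L_V = {<, τ, ∞, (R_n)_{n ∈ ℕ}}` of value sets. -/
def LV : FirstOrder.Language where
  Functions := ValueFunc
  Relations := ValueRel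

/-! ### Valued modules -/

/-- A valuation of the abelian group `M` with values in the linear order `Δ`, whose maximum `∞`
is written `⊤`. -/
structure GroupValuation (M Δ : Type*) [AddCommGroup M] [LinearOrder Δ] [OrderTop Δ] where
  v : M → Δ
  surjective : Function.Surjective v
  eq_top_iff : ∀ x, v x = ⊤ ↔ x = 0
  min_le_add : ∀ x y, min (v x) (v y) ≤ v (x + y)
  min_le_sub : ∀ x y, min (v x) (v y) ≤ v (x - y)

namespace GroupValuation

variable {M Δ : Type*} [AddCommGroup M] [LinearOrder Δ] [OrderTop Δ] (v : GroupValuation M Δ)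

theorem map_zero : v.v 0 = ⊤ := (v.eq_top_iff 0).2 rfl

theorem le_neg (x : M) : v.v x ≤ v.v (-x) := by
  have h := v.min_le_sub 0 x
  rwa [v.map_zero, zero_sub, min_eq_right le_top] at h

/-- The closed ball `M_{≥ γ}` centered at `0`. -/
def closedBall (γ : Δ) : AddSubgroup M where
  carrier := {x | γ ≤ v.v x}
  zero_mem' := by simp [v.map_zero]
  add_mem' := fun {x y} hx hy => (le_min hx hy).trans (v.min_le_add x y)
  neg_mem' := fun {x} hx => le_trans hx (v.le_neg x)

/-- The open ball `M_{> γ}` centered at `0`, for `γ ≠ ∞`. -/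
def openBall (γ : Δ) (hγ : γ ≠ ⊤) : AddSubgroup M where
  carrier := {x | γ < v.v x}
  zero_mem' := by simpa [v.map_zero] using lt_top_iff_ne_top.2 hγ
  add_mem' := fun {x y} hx hy => (lt_min hx hy).trans_le (v.min_le_add x y)
  neg_mem' := fun {x} hx => lt_of_lt_of_le hx (v.le_neg x)

/-- The interpretation of `R_n`: the quotient `M_{≥ γ} / M_{> γ}` has at least `n` elements.
It is only meaningful for `γ ≠ ∞`; by convention `R_n` fails at `∞`. -/
def HasAtLeast (n : ℕ) (γ : Δ) : Prop :=
  ∃ hγ : γ ≠ ⊤,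
    (n : ℕ∞) ≤ ENat.card (v.closedBall γ ⧸ (v.openBall γ hγ).addSubgroupOf (v.closedBall γ))

end GroupValuation

/-- `τ`-chains: linear orders with a maximum `∞` and a function `τ`. -/
structure IsTauChain {Δ : Type*} [LinearOrder Δ] [OrderTop Δ] (τ : Δ → Δ) : Prop where
  strictMono : StrictMono τ
  map_top : τ ⊤ = ⊤
  lt_of_le : ∀ γ, γ ≠ ⊤ → ∀ δ, τ γ ≤ γ → δ < γ → τ δ < δ

/-- A (`K`-trivially) valued right `K[t; φ]`-module structure on the right module `M`, with
value set `Δ = v(M)`. -/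
structure ValuedModule {K : Type*} [Field K] (φ : K →+* K) (M Δ : Type*) [AddCommGroup M]
    [Module (TwistedPolynomial φ)ᵐᵒᵖ M] [LinearOrder Δ] [OrderTop Δ]
    extends GroupValuation M Δ where
  τ : Δ → Δ
  act_T_injective : Function.Injective fun x : M => x <• TwistedPolynomial.T φ
  isTauChain : IsTauChain τ
  map_act_C : ∀ (x : M) (a : K), a ≠ 0 → v (x <• TwistedPolynomial.C φ a) = v x
  map_act_T : ∀ x : M, v (x <• TwistedPolynomial.T φ) = τ (v x)

namespace ValuedModule

variable {K : Type*} [Field K] {φ : K →+* K} {M Δ : Type*} [AddCommGroup M]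
  [Module (TwistedPolynomial φ)ᵐᵒᵖ M] [LinearOrder Δ] [OrderTop Δ]

/-- The predicate `γ > θ`, i.e. `γ ∈ Δ₊` (which makes sense whether or not `τ` has a fixed point
`θ ≠ ∞` in `Δ`). -/
def GtTheta (V : ValuedModule φ M Δ) (γ : Δ) : Prop := γ < V.τ γ ∨ γ = ⊤

/-- `(M, v)` is henselian: for every separable `r`, each `x` with `v(x) > θ` is of the form `y.r`
with `v(y) > θ`. -/
def IsHenselian (V : ValuedModule φ M Δ) : Prop :=
  ∀ r : TwistedPolynomial φ, r.IsSeparable →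
    ∀ x : M, V.GtTheta (V.v x) → ∃ y : M, x = y <• r ∧ V.GtTheta (V.v y)

/-- The value set `v(M) = Δ`, as a carrier for its `L_V`-structure (which depends on `v`). -/
def ValueSet (_V : ValuedModule φ M Δ) : Type _ := Δ

/-- The `L_V`-structure of the value set `v(M)`. -/
instance valueStructure (V : ValuedModule φ M Δ) : LV.Structure V.ValueSet where
  funMap := fun {n} (f : ValueFunc n) =>
    match n, f with
    | _, .infty => fun _ => (⊤ : Δ)
    | _, .tau => fun x => V.τ (x 0)
  RelMap := fun {n} (r : ValueRel n) =>
    match n, r with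
    | _, .lt => fun x => @LT.lt Δ _ (x 0) (x 1)
    | _, .card n => fun x => V.HasAtLeast n (x 0)

/-- The valuation, as a map from the module sort to the value set sort. -/
def toValueSet (V : ValuedModule φ M Δ) : M → V.ValueSet := V.v

end ValuedModule

/-! ### First-order logic with two sorts

For one-sorted languages `L₁`, `L₂`, we consider the two-sorted language `L₁ ∪ L₂ ∪ {v}`, where
`v` is a function symbol from the first sort to the second sort. -/

namespace TwoSorted

open FirstOrder

/-- Terms of the second sort, in `n` variables of the first sort and `m` variables of the second
sort: these are the `L₂`-terms in the `m` variables and in the expressions `v(t)`, where `t` is a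
term of the first sort, i.e. an `L₁`-term in the `n` variables. -/
abbrev Term₂ (L₁ L₂ : Language) (n m : ℕ) : Type _ := L₂.Term (Fin m ⊕ L₁.Term (Fin n))

/-- First-order formulas with free variables among `n` variables of the first sort and `m`
variables of the second sort.  Each quantifier binds the last variable of its sort. -/
inductive Formula (L₁ L₂ : Language) : ℕ → ℕ → Type _
  | falsum {n m : ℕ} : Formula L₁ L₂ n m
  | eq₁ {n m : ℕ} (s t : L₁.Term (Fin n)) : Formula L₁ L₂ n m
  | eq₂ {n m : ℕ} (s t : Term₂ L₁ L₂ n m) : Formula L₁ L₂ n m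
  | rel₁ {n m k : ℕ} (r : L₁.Relations k) (ts : Fin k → L₁.Term (Fin n)) : Formula L₁ L₂ n m
  | rel₂ {n m k : ℕ} (r : L₂.Relations k) (ts : Fin k → Term₂ L₁ L₂ n m) : Formula L₁ L₂ n m
  | imp {n m : ℕ} (f g : Formula L₁ L₂ n m) : Formula L₁ L₂ n m
  | all₁ {n m : ℕ} (f : Formula L₁ L₂ (n + 1) m) : Formula L₁ L₂ n m
  | all₂ {n m : ℕ} (f : Formula L₁ L₂ n (m + 1)) : Formula L₁ L₂ n m

section Semantics

variable {L₁ L₂ : Language} {M Δ : Type*} [L₁.Structure M] [L₂.Structure Δ] (v : M → Δ)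

/-- The value of a term of the second sort in the two-sorted structure `(M, Δ, v)`. -/
def realizeTerm₂ {n m : ℕ} (t : Term₂ L₁ L₂ n m) (x : Fin n → M) (y : Fin m → Δ) : Δ :=
  t.realize (Sum.elim y fun s => v (s.realize x))

/-- Truth of a formula in the two-sorted structure `(M, Δ, v)`, at `x` and `y`. -/
def Formula.Realize : {n m : ℕ} → Formula L₁ L₂ n m → (Fin n → M) → (Fin m → Δ) → Prop
  | _, _, .falsum, _, _ => False
  | _, _, .eq₁ s t, x, _ => s.realize x = t.realize x
  | _, _, .eq₂ s t, x, y => realizeTerm₂ v s x y = realizeTerm₂ v t x y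
  | _, _, .rel₁ r ts, x, _ => Language.Structure.RelMap r fun i => (ts i).realize x
  | _, _, .rel₂ r ts, x, y => Language.Structure.RelMap r fun i => realizeTerm₂ v (ts i) x y
  | _, _, .imp f g, x, y => f.Realize x y → g.Realize x y
  | _, _, .all₁ f, x, y => ∀ a : M, f.Realize (Fin.snoc x a) y
  | _, _, .all₂ f, x, y => ∀ b : Δ, f.Realize x (Fin.snoc y b)

end Semantics

/-- Elementary equivalence of the two-sorted structures `(M, Δ, v)` and `(N, Γ, w)`: they satisfy
the same sentences. -/
def ElementarilyEquivalent (L₁ L₂ : Language) {M Δ N Γ : Type*} [L₁.Structure M] [L₂.Structure Δ]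
    [L₁.Structure N] [L₂.Structure Γ] (v : M → Δ) (w : N → Γ) : Prop :=
  ∀ σ : Formula L₁ L₂ 0 0,
    σ.Realize v Fin.elim0 Fin.elim0 ↔ σ.Realize w Fin.elim0 Fin.elim0

end TwoSorted

/-! The ring `R` has right Euclidean division, so its right ideals are principal and divisible right
modules are injective. The elements of value `≥ θ` and those of value `> θ` form submodules
`geTheta` and `gtTheta`. The first inherits divisibility from `F`; the second is divisible because
`F` is also henselian. Both are therefore direct summands, and `F = B ⊕ C ⊕ A`, where nonzero
elements of `B`, `C`, `A` have values below, equal to and above `θ` (`exists_isSplitting`). The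
valuation is lexicographic on this sum. A nonzero `r` moves values by `τ^(order of r)` on `A` and by
`τ^(degree of r)` on `B`. Hence `A` and `B` are torsion-free, and all torsion lies in `C`, where the
valuation is trivial. `SplitModel` axiomatizes such sums.

Two split models are compared by back-and-forth (`realize_iff`). A `PartialIso` consists of an
elementary correspondence of values, value-compatible graphs on `A` and `B` closed under division,
and the graph of an injective partial map on `C`. Saturation is replaced by ultrapowers: each time
an element has to be added to the domain (`exists_extends`), the target may be enlarged to an
elementary extension.

To add `z` to `A` or `B`, where division is unique, only the values `v (p + z)` with `p` in the
domain matter (`addPiece`). If these have no maximum, each of them is already a distance between two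
elements of the domain. If they have one, a translation makes `v (p + z) = min (v p) (v z)`; the
image must then have a value of the right type and avoid certain residue classes, and the predicates
`R_n` guarantee enough classes (`exists_image_of_maximal`).

To add `z` to `C`, consider its annihilator modulo the domain, a right ideal. If it is nonzero,
factoring its generator reduces to the case of a maximal right ideal; an image is then found by
counting the solutions of `y.r = x`, that is, the elements killed by `r`, and these numbers are
known from `F_tor`. If it is zero, an image exists because a nonzero divisible module is infinite.
Whether `C` is nonzero is visible in the value set: it means that `τ` has a fixed point other than
`∞`. So the hypotheses provide a partial isomorphism defined at `0`, from which the back-and-forth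
starts. -/

/-! ### Arithmetic of `K[t; φ]`: degrees, right ideals, common multiples. -/

namespace TwistedPolynomial

variable {K : Type*} [Field K] {φ : K →+* K}

/-- The degree of a twisted polynomial (zero for the zero polynomial). -/
noncomputable def natDegree (r : TwistedPolynomial φ) : ℕ := r.toFinsupp.support.sup id

theorem coeff_eq_zero_of_natDegree_lt {r : TwistedPolynomial φ} {i : ℕ} (h : r.natDegree < i) :
    coeff r i = 0 := by
  by_contra hne
  exact absurd (Finset.le_sup (f := id) (Finsupp.mem_support_iff.2 hne)) (not_le.2 h)

theorem coeff_natDegree_ne_zero {r : TwistedPolynomial φ} (hr : r ≠ 0) :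
    coeff r r.natDegree ≠ 0 := by
  have hne : r.toFinsupp.support.Nonempty := Finsupp.support_nonempty_iff.2 hr
  obtain ⟨i, hi, h⟩ := Finset.exists_mem_eq_sup _ hne id
  rw [natDegree, h]
  exact Finsupp.mem_support_iff.1 hi

theorem natDegree_eq {r : TwistedPolynomial φ} {n : ℕ} (h : coeff r n ≠ 0)
    (h' : ∀ i, n < i → coeff r i = 0) : r.natDegree = n := by
  have hr : r ≠ 0 := by rintro rfl; exact h (coeff_zero n)
  rcases lt_trichotomy r.natDegree n with h1 | h1 | h1
  · exact absurd (coeff_eq_zero_of_natDegree_lt h1) h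
  · exact h1
  · exact absurd (h' _ h1) (coeff_natDegree_ne_zero hr)

theorem natDegree_mul {r s : TwistedPolynomial φ} (hr : r ≠ 0) (hs : s ≠ 0) :
    (r * s).natDegree = r.natDegree + s.natDegree := by
  have hr' := fun i => coeff_eq_zero_of_natDegree_lt (r := r) (i := i)
  have hs' := fun i => coeff_eq_zero_of_natDegree_lt (r := s) (i := i)
  refine natDegree_eq ?_ fun i hi => coeff_mul_gt hr' hs' hi
  rw [coeff_mul_top hr' hs']
  exact mul_ne_zero ((map_ne_zero (φ ^ _)).2 (coeff_natDegree_ne_zero hr))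
    (coeff_natDegree_ne_zero hs)

theorem C_mul_C (a b : K) : C φ a * C φ b = C φ (a * b) := by
  simp [C, monomial_mul_monomial]

theorem eq_C_of_natDegree_eq_zero {r : TwistedPolynomial φ} (h : r.natDegree = 0) :
    r = C φ (coeff r 0) := by
  ext i
  rw [C, coeff_monomial]
  split_ifs with hi
  · rw [hi]
  · exact coeff_eq_zero_of_natDegree_lt (by omega)

theorem exists_inv_of_natDegree_eq_zero {r : TwistedPolynomial φ} (hr : r ≠ 0)
    (h : r.natDegree = 0) : ∃ s, r * s = 1 ∧ s * r = 1 := by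
  have h0 : coeff r 0 ≠ 0 := by simpa [h] using coeff_natDegree_ne_zero hr
  refine ⟨C φ (coeff r 0)⁻¹, ?_, ?_⟩
  · nth_rewrite 1 [eq_C_of_natDegree_eq_zero h]
    rw [C_mul_C, mul_inv_cancel₀ h0]; rfl
  · nth_rewrite 2 [eq_C_of_natDegree_eq_zero h]
    rw [C_mul_C, inv_mul_cancel₀ h0]; rfl

instance : Nontrivial (TwistedPolynomial φ) :=
  ⟨⟨1, 0, fun h => by
    have h1 := congrArg (fun r => coeff r 0) h
    simp [one_def, coeff_monomial] at h1⟩⟩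

instance : NoZeroDivisors (TwistedPolynomial φ) where
  eq_zero_or_eq_zero_of_mul_eq_zero := by
    intro a b h
    by_contra! hab
    exact mul_ne_zero' hab.1 hab.2 h

theorem monomial_ne_zero (i : ℕ) {a : K} (ha : a ≠ 0) : monomial φ i a ≠ 0 := fun h => by
  have h1 := congrArg (fun r => coeff r i) h
  simp [coeff_monomial, ha] at h1

instance : Infinite (TwistedPolynomial φ) := by
  refine Infinite.of_injective (fun i : ℕ => monomial φ i 1) fun i j h => ?_
  by_contra hij
  have h1 := congrArg (fun r => coeff r i) h
  simp [coeff_monomial, Ne.symm hij] at h1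

/-- Right ideals are principal; the generator is an element of least degree. -/
theorem exists_generator (J : AddSubgroup (TwistedPolynomial φ)) (hJ : ∀ x ∈ J, ∀ r, x * r ∈ J)
    (hne : ∃ x ∈ J, x ≠ 0) : ∃ q ∈ J, q ≠ 0 ∧ ∀ x ∈ J, ∃ c, x = q * c := by
  classical
  have hex : ∃ n, ∃ x ∈ J, x ≠ 0 ∧ x.natDegree = n := by
    obtain ⟨x, hx, h0⟩ := hne
    exact ⟨_, x, hx, h0, rfl⟩
  obtain ⟨q, hq, hq0, hqn⟩ := Nat.find_spec hex
  refine ⟨q, hq, hq0, fun x hx => ?_⟩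
  obtain ⟨c, r, h, hr⟩ := exists_div (coeff_natDegree_ne_zero hq0)
    (fun i hi => coeff_eq_zero_of_natDegree_lt hi) (x.natDegree + 1) x
    (fun i hi => coeff_eq_zero_of_natDegree_lt hi)
  have hrJ : r ∈ J := by
    rw [show r = x - q * c by rw [h]; abel]
    exact J.sub_mem hx (hJ q hq c)
  have hr0 : r = 0 := by
    by_contra hr0
    refine Nat.find_min hex ?_ ⟨r, hrJ, hr0, rfl⟩
    rw [← hqn]
    by_contra hlt
    exact coeff_natDegree_ne_zero hr0 (hr _ (not_lt.1 hlt))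
  exact ⟨c, by rw [h, hr0, add_zero]⟩

/-- The Ore condition, iterated. It replaces finitely many multipliers by a single one, to kill
finitely many torsion elements or to treat finitely many equations at once. -/
theorem exists_common_multiple_finset {ι : Type*} (s : Finset ι) (r : ι → TwistedPolynomial φ)
    (hr : ∀ i ∈ s, r i ≠ 0) : ∃ m, m ≠ 0 ∧ ∀ i ∈ s, ∃ c, m = r i * c := by
  classical
  induction s using Finset.induction_on with
  | empty => exact ⟨1, one_ne_zero, by simp⟩
  | insert i s _ ih =>
    obtain ⟨m, hm, h⟩ := ih fun j hj => hr j (Finset.mem_insert_of_mem hj)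
    obtain ⟨c, d, hc, hcd⟩ := exists_common_multiple (hr i (Finset.mem_insert_self i s)) m
    refine ⟨m * c, mul_ne_zero hm hc, fun j hj => ?_⟩
    rcases Finset.mem_insert.1 hj with rfl | hj
    · exact ⟨d, hcd⟩
    · obtain ⟨e, he⟩ := h j hj
      exact ⟨e * c, by rw [← mul_assoc, ← he]⟩

end TwistedPolynomial

/-! ### Divisible right modules: injectivity and infinitude. -/

section RightModules

open TwistedPolynomial

variable {K : Type*} [Field K] {φ : K →+* K}
variable {M : Type*} [AddCommGroup M] [Module (TwistedPolynomial φ)ᵐᵒᵖ M]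

theorem act_mul (x : M) (r s : TwistedPolynomial φ) : x <• (r * s) = (x <• r) <• s := by
  rw [MulOpposite.op_mul, mul_smul]

theorem act_one (x : M) : x <• (1 : TwistedPolynomial φ) = x := by
  rw [MulOpposite.op_one, one_smul]

theorem act_add (x : M) (r s : TwistedPolynomial φ) : x <• (r + s) = x <• r + x <• s := by
  rw [MulOpposite.op_add, add_smul]

theorem act_sub (x : M) (r s : TwistedPolynomial φ) : x <• (r - s) = x <• r - x <• s := by
  rw [MulOpposite.op_sub, sub_smul]

/-- Divisible right modules satisfy Baer's criterion, right ideals being principal. -/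
theorem IsDivisibleModule.baer (h : IsDivisibleModule φ M) :
    Module.Baer (TwistedPolynomial φ)ᵐᵒᵖ M := by
  intro I g
  by_cases hI : ∃ x ∈ I, x ≠ 0
  · obtain ⟨x, hx, hx0⟩ := hI
    obtain ⟨q, hq, hq0, hgen⟩ := exists_generator
      (I.toAddSubgroup.comap (MulOpposite.opAddEquiv (α := TwistedPolynomial φ)).toAddMonoidHom)
      (fun y hy r => I.mul_mem_left (MulOpposite.op r) hy)
      ⟨x.unop, hx, fun h => hx0 (MulOpposite.unop_injective h)⟩
    -- The quotient of `g q` by the generator `q` is the value at `1` of the extended map.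
    obtain ⟨y, hy⟩ := h q hq0 (g ⟨MulOpposite.op q, hq⟩)
    refine ⟨LinearMap.toSpanSingleton _ _ y, fun z hz => ?_⟩
    obtain ⟨c, hc⟩ := hgen z.unop hz
    have hz' : (⟨z, hz⟩ : I) = MulOpposite.op c • ⟨MulOpposite.op q, hq⟩ := by
      ext
      exact MulOpposite.unop_injective hc
    rw [hz', map_smul, ← hy, LinearMap.toSpanSingleton_apply, ← mul_smul]
    congr 1
    exact MulOpposite.unop_injective hc
  · push Not at hI
    refine ⟨0, fun z hz => ?_⟩
    have : (⟨z, hz⟩ : I) = 0 := Subtype.ext (hI z hz)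
    rw [this, map_zero, LinearMap.zero_apply]

/-- A nonzero divisible module is infinite. -/
theorem IsDivisibleModule.infinite (h : IsDivisibleModule φ M) [Nontrivial M] : Infinite M := by
  by_contra hfin
  rw [not_infinite_iff_finite] at hfin
  have htor : ∀ x : M, ∃ r : TwistedPolynomial φ, r ≠ 0 ∧ x <• r = 0 := by
    intro x
    -- `R` is infinite, so `r ↦ x.r` cannot be injective into a finite module; every element is
    -- torsion.
    obtain ⟨r, s, hne, hrs⟩ := Finite.exists_ne_map_eq_of_infinite
      fun r : TwistedPolynomial φ => x <• r
    exact ⟨r - s, sub_ne_zero.2 hne, by rw [act_sub, sub_eq_zero]; exact hrs⟩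
  choose r hr0 hr using htor
  have := Fintype.ofFinite M
  obtain ⟨m, hm, hc⟩ := exists_common_multiple_finset Finset.univ r fun i _ => hr0 i
  obtain ⟨x, hx⟩ := exists_ne (0 : M)
  -- The common multiple `m` kills all of `M`, whereas divisibility makes it act surjectively.
  obtain ⟨y, hy⟩ := h m hm x
  obtain ⟨c, hc⟩ := hc y (Finset.mem_univ y)
  rw [hc, act_mul, hr, smul_zero] at hy
  exact hx hy.symm

end RightModules

/-! ### Elementary correspondences and pairs of definable sets. -/

section ElementaryRelations

open FirstOrder

section Elementary

variable (L : Language) {D D' : Type*} [L.Structure D] [L.Structure D']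

/-- A correspondence between two structures which preserves the truth of all formulas. -/
def ElementaryRel (ρ : Set (D × D')) : Prop :=
  ∀ (k : ℕ) (p : Fin k → D × D'), (∀ i, p i ∈ ρ) → ∀ ψ : L.Formula (Fin k),
    ψ.Realize (fun i => (p i).1) ↔ ψ.Realize fun i => (p i).2

/-- A pair of subsets defined by the same formula, with parameters which correspond by `ρ`. -/
def DefPair (ρ : Set (D × D')) (s : Set D) (s' : Set D') : Prop :=
  ∃ (k : ℕ) (p : Fin k → D × D'), (∀ i, p i ∈ ρ) ∧ ∃ ψ : L.Formula (Fin k ⊕ Unit),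
    (∀ d, d ∈ s ↔ ψ.Realize (Sum.elim (fun i => (p i).1) fun _ => d)) ∧
      ∀ d, d ∈ s' ↔ ψ.Realize (Sum.elim (fun i => (p i).2) fun _ => d)

variable {L} {ρ : Set (D × D')}

theorem DefPair.inter {s t : Set D} {s' t' : Set D'} (hs : DefPair L ρ s s')
    (ht : DefPair L ρ t t') : DefPair L ρ (s ∩ t) (s' ∩ t') := by
  obtain ⟨k, p, hp, ψ, h1, h2⟩ := hs
  obtain ⟨l, q, hq, χ, h3, h4⟩ := ht
  refine ⟨k + l, Fin.append p q, fun i => ?_,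
    ψ.relabel (Sum.map (Fin.castAdd l) id) ⊓ χ.relabel (Sum.map (Fin.natAdd k) id), ?_, ?_⟩
  · refine Fin.addCases (fun i => ?_) (fun i => ?_) i
    · rw [Fin.append_left]; exact hp i
    · rw [Fin.append_right]; exact hq i
  · intro d
    rw [Set.mem_inter_iff, h1, h3, Language.Formula.realize_inf, Language.Formula.realize_relabel,
      Language.Formula.realize_relabel, Sum.elim_comp_map, Sum.elim_comp_map]
    simp [Function.comp_def]
  · intro d
    rw [Set.mem_inter_iff, h2, h4, Language.Formula.realize_inf, Language.Formula.realize_relabel,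
      Language.Formula.realize_relabel, Sum.elim_comp_map, Sum.elim_comp_map]
    simp [Function.comp_def]

theorem DefPair.compl {s : Set D} {s' : Set D'} (hs : DefPair L ρ s s') :
    DefPair L ρ sᶜ s'ᶜ := by
  obtain ⟨k, p, hp, ψ, h1, h2⟩ := hs
  exact ⟨k, p, hp, ψ.not, fun d => not_congr (h1 d), fun d => not_congr (h2 d)⟩

theorem DefPair.univ : DefPair L ρ Set.univ Set.univ :=
  ⟨0, Fin.elim0, fun i => i.elim0, ⊤, by simp, by simp⟩

theorem DefPair.iInter {ι : Type*} (t : Finset ι) {s : ι → Set D} {s' : ι → Set D'}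
    (h : ∀ i ∈ t, DefPair L ρ (s i) (s' i)) :
    DefPair L ρ (⋂ i ∈ t, s i) (⋂ i ∈ t, s' i) := by
  classical
  induction t using Finset.induction_on with
  | empty => simpa using DefPair.univ
  | insert i t _ ih =>
    rw [Finset.set_biInter_insert, Finset.set_biInter_insert]
    exact (h i (Finset.mem_insert_self i t)).inter
      (ih fun j hj => h j (Finset.mem_insert_of_mem hj))

/-- Nonemptiness is an existential formula in the parameters. This is how finitely many conditions
on a value are carried to the other side. -/
theorem DefPair.nonempty (hρ : ElementaryRel L ρ) {s : Set D} {s' : Set D'}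
    (h : DefPair L ρ s s') (hs : s.Nonempty) : s'.Nonempty := by
  obtain ⟨k, p, hp, ψ, h1, h2⟩ := h
  obtain ⟨d, hd⟩ := hs
  have := (hρ k p hp (ψ.iExs Unit)).1
    ((Language.Formula.realize_iExs).2 ⟨fun _ => d, (h1 d).1 hd⟩)
  obtain ⟨e, he⟩ := Language.Formula.realize_iExs.1 this
  exact ⟨e (), (h2 _).2 he⟩

theorem DefPair.mem (hρ : ElementaryRel L ρ) {s : Set D} {s' : Set D'}
    (h : DefPair L ρ s s') {d : D} {d' : D'} (hd : (d, d') ∈ ρ) (hs : d ∈ s) : d' ∈ s' := by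
  obtain ⟨k, p, hp, ψ, h1, h2⟩ := h
  have key := hρ (k + 1) (Fin.snoc p (d, d')) (fun i => by
    refine Fin.lastCases ?_ (fun i => ?_) i
    · simpa using hd
    · simpa using hp i) (ψ.relabel (Sum.elim Fin.castSucc fun _ => Fin.last k))
  rw [Language.Formula.realize_relabel, Language.Formula.realize_relabel] at key
  rw [h1] at hs
  rw [h2]
  convert! key.1 (by
    convert! hs using 1
    ext i; rcases i with i | i <;> simp) using 1
  ext i; rcases i with i | i <;> simp

/-- A new pair of elements of the same type may be added to an elementary correspondence. -/
theorem ElementaryRel.insert (hne : ρ.Nonempty) {d : D} {d' : D'}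
    (h : ∀ s s', DefPair L ρ s s' → d ∈ s → d' ∈ s') : ElementaryRel L (insert (d, d') ρ) := by
  classical
  intro k p hp ψ
  obtain ⟨o, ho⟩ := hne
  -- The pair `o` only fills the places where `p` is the new pair; `g` sends the variables at those
  -- places to the extra variable instead.
  set q : Fin k → D × D' := fun i => if p i ∈ ρ then p i else o with hq
  have hqρ : ∀ i, q i ∈ ρ := fun i => by
    by_cases hi : p i ∈ ρ
    · simp [hq, hi]
    · simp [hq, hi, ho]
  set g : Fin k → Fin k ⊕ Unit := fun i => if p i ∈ ρ then Sum.inl i else Sum.inr () with hg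
  have e1 : (fun i => (p i).1) = (Sum.elim (fun i => (q i).1) fun _ => d) ∘ g := by
    ext i
    by_cases hi : p i ∈ ρ
    · simp [hq, hg, hi]
    · have : p i = (d, d') := (hp i).resolve_right hi
      simp [hg, this]
      rw [if_neg (by rw [← this]; exact hi)]; rfl
  have e2 : (fun i => (p i).2) = (Sum.elim (fun i => (q i).2) fun _ => d') ∘ g := by
    ext i
    by_cases hi : p i ∈ ρ
    · simp [hq, hg, hi]
    · have : p i = (d, d') := (hp i).resolve_right hi
      simp [hg, this]
      rw [if_neg (by rw [← this]; exact hi)]; rfl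
  have hpair : DefPair L ρ {x | (ψ.relabel g).Realize (Sum.elim (fun i => (q i).1) fun _ => x)}
      {x | (ψ.relabel g).Realize (Sum.elim (fun i => (q i).2) fun _ => x)} :=
    ⟨k, q, hqρ, ψ.relabel g, fun _ => Iff.rfl, fun _ => Iff.rfl⟩
  rw [e1, e2, ← Language.Formula.realize_relabel, ← Language.Formula.realize_relabel]
  refine ⟨fun hd => h _ _ hpair hd, fun hd => ?_⟩
  -- The hypothesis is an implication only; applied to complements it gives the converse.
  by_contra hn
  exact h _ _ hpair.compl hn hd

end Elementary

end ElementaryRelations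

/-! ### Split models and correspondences of their value sets. -/

section SplitModels

open FirstOrder TwistedPolynomial

universe u w

/-- The symbol `<` of `LV`. -/
def ltSymbol : LV.Relations 2 := ValueRel.lt

/-- The symbol `R_n` of `LV`. -/
def cardSymbol (n : ℕ) : LV.Relations 1 := ValueRel.card n

/-- The symbol `τ` of `LV`. -/
def tauSymbol : LV.Functions 1 := ValueFunc.tau

/-- The symbol `∞` of `LV`. -/
def inftySymbol : LV.Functions 0 := ValueFunc.infty

/-- A valued module presented as a direct sum `P false ⊕ C ⊕ P true` on which the valuation is
lexicographic: nonzero elements of `C` have value `θ`, while a nonzero `r` acts bijectively on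
the valued modules `P ε` and on their values through the power `h ε r` of `τ`.  The residue
`P ε` of value `γ` is controlled by `Rn` when `τ` moves `γ` in the direction given by `ε`. -/
structure SplitModel {K : Type u} [Field K] (φ : K →+* K) (h : Bool → TwistedPolynomial φ → ℕ) :
    Type (max u (w + 1)) where
  P : Bool → Type w
  [addCommGroupP : ∀ ε, AddCommGroup (P ε)]
  [moduleP : ∀ ε, Module (TwistedPolynomial φ)ᵐᵒᵖ (P ε)]
  C : Type w
  [addCommGroupC : AddCommGroup C]
  [moduleC : Module (TwistedPolynomial φ)ᵐᵒᵖ C]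
  Δ : Type w
  [linearOrder : LinearOrder Δ]
  [orderTop : OrderTop Δ]
  τ : Δ → Δ
  Rn : ℕ → Δ → Prop
  θ : Δ
  v : ∀ ε, P ε → Δ
  τ_strictMono : StrictMono τ
  τ_surjective : Function.Surjective τ
  Rn_τ : ∀ n γ, Rn n (τ γ) ↔ Rn n γ
  v_eq_top : ∀ ε x, v ε x = ⊤ ↔ x = 0
  min_le_v_sub : ∀ ε x y, min (v ε x) (v ε y) ≤ v ε (x - y)
  v_act : ∀ ε x r, r ≠ 0 → v ε (x <• r) = τ^[h ε r] (v ε x)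
  divisible : ∀ ε, IsDivisibleModule φ (P ε)
  divisibleC : IsDivisibleModule φ C
  v_dom : ∀ ε x, x ≠ 0 → bif ε then v ε x < τ (v ε x) else τ (v ε x) < v ε x
  -- Nothing ties `Rn` at a fixed point of `τ` to `C`: the back-and-forth on `C` uses annihilators
  -- instead.
  Rn_iff : ∀ ε n γ, (bif ε then γ < τ γ else τ γ < γ) →
    (Rn n γ ↔ ∃ e : Fin n → P ε, (∀ i, γ ≤ v ε (e i)) ∧ ∀ i j, i ≠ j → v ε (e i - e j) ≤ γ)

namespace SplitModel

variable {K : Type u} [Field K] {φ : K →+* K} {h : Bool → TwistedPolynomial φ → ℕ}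

attribute [instance] addCommGroupP moduleP addCommGroupC moduleC linearOrder orderTop

variable (N M : SplitModel.{u, w} φ h)

instance : LV.Structure N.Δ where
  funMap := fun {n} (f : ValueFunc n) =>
    match n, f with
    | _, .infty => fun _ => (⊤ : N.Δ)
    | _, .tau => fun x => N.τ (x 0)
  RelMap := fun {n} (r : ValueRel n) =>
    match n, r with
    | _, .lt => fun x => x 0 < x 1
    | _, .card n => fun x => N.Rn n (x 0)

/-- The underlying module. -/
abbrev Carrier : Type w := N.P false × N.C × N.P true

open scoped Classical in
/-- The lexicographic valuation. -/
noncomputable def val (x : N.Carrier) : N.Δ :=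
  if x.1 ≠ 0 then N.v false x.1 else if x.2.1 ≠ 0 then N.θ else N.v true x.2.2

variable {N M} {ε : Bool}

theorem v_zero : N.v ε 0 = ⊤ := (N.v_eq_top ε 0).2 rfl

theorem v_neg (x : N.P ε) : N.v ε (-x) = N.v ε x := by
  have key : ∀ y : N.P ε, N.v ε y ≤ N.v ε (-y) := fun y => by
    simpa [v_zero] using N.min_le_v_sub ε 0 y
  exact le_antisymm (by simpa using key (-x)) (key x)

theorem v_sub_comm (x y : N.P ε) : N.v ε (x - y) = N.v ε (y - x) := by
  rw [← v_neg, neg_sub]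

theorem min_le_v_add (x y : N.P ε) : min (N.v ε x) (N.v ε y) ≤ N.v ε (x + y) := by
  simpa [v_neg] using N.min_le_v_sub ε x (-y)

theorem v_add_eq_of_lt {x y : N.P ε} (hxy : N.v ε x < N.v ε y) :
    N.v ε (x + y) = N.v ε x := by
  refine le_antisymm ?_ ?_
  · by_contra! hlt
    have h1 := N.min_le_v_sub ε (x + y) y
    rw [add_sub_cancel_right] at h1
    exact absurd h1 (not_le.2 (lt_min hlt hxy))
  · have := min_le_v_add x y
    rwa [min_eq_left hxy.le] at this

theorem v_sub_eq_left {x y : N.P ε} (hxy : N.v ε x < N.v ε y) :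
    N.v ε (x - y) = N.v ε x := by
  rw [sub_eq_add_neg]
  exact v_add_eq_of_lt (by rwa [v_neg])

theorem val_of_ne {x : N.Carrier} (h1 : x.1 ≠ 0) : N.val x = N.v false x.1 := if_pos h1

theorem val_of_eq_of_ne {x : N.Carrier} (h1 : x.1 = 0) (h2 : x.2.1 ≠ 0) : N.val x = N.θ := by
  rw [val, if_neg (not_not.2 h1), if_pos h2]

theorem val_of_eq_of_eq {x : N.Carrier} (h1 : x.1 = 0) (h2 : x.2.1 = 0) :
    N.val x = N.v true x.2.2 := by
  rw [val, if_neg (not_not.2 h1), if_neg (not_not.2 h2)]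

theorem τ_top : N.τ ⊤ = ⊤ := by
  obtain ⟨γ, hγ⟩ := N.τ_surjective ⊤
  rcases eq_or_ne γ ⊤ with rfl | hne
  · exact hγ
  · exact absurd (N.τ_strictMono (lt_top_iff_ne_top.2 hne)) (by simp [hγ])

theorem iterate_τ_top (n : ℕ) : N.τ^[n] ⊤ = ⊤ := Function.iterate_fixed τ_top n

theorem iterate_τ_injective (n : ℕ) : Function.Injective N.τ^[n] :=
  N.τ_strictMono.injective.iterate n

/-- The iterates of `τ` are injective and fix `∞`. So `P ε` is torsion-free and, being divisible,
has unique division; `C` need not have this property. -/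
theorem act_eq_zero {x : N.P ε} {r : TwistedPolynomial φ} (hr : r ≠ 0) (hx : x <• r = 0) :
    x = 0 := by
  rw [← N.v_eq_top, N.v_act ε x r hr, ← iterate_τ_top (N := N) (h ε r)] at hx
  exact (N.v_eq_top ε x).1 (iterate_τ_injective _ hx)

theorem Rn_iterate_τ (m n : ℕ) (γ : N.Δ) : N.Rn m (N.τ^[n] γ) ↔ N.Rn m γ := by
  induction n with
  | zero => rfl
  | succ n ih => rw [Function.iterate_succ_apply', N.Rn_τ, ih]

/-- `τⁿ` as an automorphism of the value set. -/
noncomputable def iterateEquiv (N : SplitModel.{u, w} φ h) (n : ℕ) : N.Δ ≃[LV] N.Δ where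
  toEquiv := Equiv.ofBijective N.τ^[n] ⟨iterate_τ_injective n, N.τ_surjective.iterate n⟩
  map_fun' := by
    rintro k (_ | _) x
    · exact iterate_τ_top n
    · exact (Function.Commute.refl N.τ).iterate_left n (x 0)
  map_rel' := by
    rintro k (_ | m) x
    · exact (N.τ_strictMono.iterate n).lt_iff_lt
    · exact Rn_iterate_τ m n (x 0)

theorem realize_iterate_τ (N : SplitModel.{u, w} φ h) (n : ℕ) {α : Type*} (ψ : LV.Formula α)
    (x : α → N.Δ) : ψ.Realize (fun i => N.τ^[n] (x i)) ↔ ψ.Realize x :=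
  Language.StrongHomClass.realize_formula (N.iterateEquiv n) ψ

/-- The term `τⁿ(t)`. -/
def iterateTauTerm {α : Type*} (t : LV.Term α) : ℕ → LV.Term α
  | 0 => t
  | n + 1 => Language.Term.func tauSymbol fun _ => iterateTauTerm t n

theorem realize_iterateTauTerm {α : Type*} (t : LV.Term α) (n : ℕ) (x : α → N.Δ) :
    (iterateTauTerm t n).realize x = N.τ^[n] (t.realize x) := by
  induction n with
  | zero => rfl
  | succ n ih =>
    rw [Function.iterate_succ_apply', ← ih]
    rfl

theorem lt_iff_realize {α : Type*} (s t : LV.Term α) (x : α → N.Δ) :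
    (ltSymbol.formula ![s, t]).Realize x ↔ s.realize x < t.realize x := by
  rw [Language.Formula.realize_rel]
  rfl

/-! ### Correspondences between value sets -/

variable {ρ : Set (M.Δ × N.Δ)}

theorem defPair_eq {a : M.Δ} {b : N.Δ} (hab : (a, b) ∈ ρ) :
    DefPair LV ρ {x | x = a} {x | x = b} :=
  ⟨1, fun _ => (a, b), fun _ => hab,
    (Language.Term.var (Sum.inr ())).equal (Language.Term.var (Sum.inl 0)),
    by simp, by simp⟩

theorem defPair_lt {a : M.Δ} {b : N.Δ} (hab : (a, b) ∈ ρ) :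
    DefPair LV ρ {x | x < a} {x | x < b} :=
  ⟨1, fun _ => (a, b), fun _ => hab,
    ltSymbol.formula
      ![Language.Term.var (Sum.inr ()), Language.Term.var (Sum.inl 0)],
    fun d => by rw [lt_iff_realize]; rfl, fun d => by rw [lt_iff_realize]; rfl⟩

theorem defPair_gt {a : M.Δ} {b : N.Δ} (hab : (a, b) ∈ ρ) :
    DefPair LV ρ {x | a < x} {x | b < x} :=
  ⟨1, fun _ => (a, b), fun _ => hab,
    ltSymbol.formula
      ![Language.Term.var (Sum.inl 0), Language.Term.var (Sum.inr ())],
    fun d => by rw [lt_iff_realize]; rfl, fun d => by rw [lt_iff_realize]; rfl⟩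

theorem defPair_Rn (n : ℕ) : DefPair LV ρ {x | M.Rn n x} {x | N.Rn n x} :=
  ⟨0, Fin.elim0, fun i => i.elim0,
    (cardSymbol n).formula ![Language.Term.var (Sum.inr ())],
    fun d => by rw [Language.Formula.realize_rel]; rfl,
    fun d => by rw [Language.Formula.realize_rel]; rfl⟩

theorem defPair_lt_τ : DefPair LV ρ {x | x < M.τ x} {x | x < N.τ x} :=
  ⟨0, Fin.elim0, fun i => i.elim0,
    ltSymbol.formula
      ![Language.Term.var (Sum.inr ()), iterateTauTerm (Language.Term.var (Sum.inr ())) 1],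
    fun d => by rw [lt_iff_realize]; rfl, fun d => by rw [lt_iff_realize]; rfl⟩

theorem defPair_τ_lt : DefPair LV ρ {x | M.τ x < x} {x | N.τ x < x} :=
  ⟨0, Fin.elim0, fun i => i.elim0,
    ltSymbol.formula
      ![iterateTauTerm (Language.Term.var (Sum.inr ())) 1, Language.Term.var (Sum.inr ())],
    fun d => by rw [lt_iff_realize]; rfl, fun d => by rw [lt_iff_realize]; rfl⟩

theorem defPair_dom (ε : Bool) :
    DefPair LV ρ {x | bif ε then x < M.τ x else M.τ x < x}
      {x | bif ε then x < N.τ x else N.τ x < x} := by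
  cases ε
  · exact defPair_τ_lt
  · exact defPair_lt_τ

theorem defPair_eq_top : DefPair LV ρ {x | x = ⊤} {x | x = ⊤} :=
  ⟨0, Fin.elim0, fun i => i.elim0,
    (Language.Term.var (Sum.inr ())).equal
      (Language.Term.func inftySymbol Fin.elim0),
    fun d => by rw [Language.Formula.realize_equal]; rfl,
    fun d => by rw [Language.Formula.realize_equal]; rfl⟩

theorem eq_top_iff_of_mem (hρ : ElementaryRel LV ρ) {a : M.Δ} {b : N.Δ} (hab : (a, b) ∈ ρ) :
    a = ⊤ ↔ b = ⊤ := by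
  refine ⟨fun ha => DefPair.mem hρ defPair_eq_top hab ha, fun hb => ?_⟩
  by_contra ha
  exact DefPair.mem hρ defPair_eq_top.compl hab ha hb

theorem eq_iff_of_mem (hρ : ElementaryRel LV ρ) {a c : M.Δ} {b d : N.Δ} (hab : (a, b) ∈ ρ)
    (hcd : (c, d) ∈ ρ) : a = c ↔ b = d := by
  refine ⟨fun ha => DefPair.mem hρ (defPair_eq hcd) hab ha, fun hb => ?_⟩
  by_contra ha
  exact DefPair.mem hρ (defPair_eq hcd).compl hab ha hb

theorem lt_iff_of_mem (hρ : ElementaryRel LV ρ) {a c : M.Δ} {b d : N.Δ} (hab : (a, b) ∈ ρ)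
    (hcd : (c, d) ∈ ρ) : a < c ↔ b < d := by
  refine ⟨fun ha => DefPair.mem hρ (defPair_lt hcd) hab ha, fun hb => ?_⟩
  by_contra ha
  exact DefPair.mem hρ (defPair_lt hcd).compl hab ha hb

/-- The closure of a correspondence under `τ` and its inverse. -/
def tauClosure (ρ : Set (M.Δ × N.Δ)) : Set (M.Δ × N.Δ) :=
  {p | ∃ m n, ∃ q ∈ ρ, M.τ^[m] p.1 = M.τ^[n] q.1 ∧ N.τ^[m] p.2 = N.τ^[n] q.2}

theorem subset_tauClosure : ρ ⊆ tauClosure ρ := fun p hp => ⟨0, 0, p, hp, rfl, rfl⟩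

theorem tau_mem_tauClosure (a : M.Δ) (b : N.Δ) :
    (M.τ a, N.τ b) ∈ tauClosure ρ ↔ (a, b) ∈ tauClosure ρ := by
  constructor
  · rintro ⟨m, n, q, hq, h1, h2⟩
    exact ⟨m + 1, n, q, hq, by simpa using h1, by simpa using h2⟩
  · rintro ⟨m, n, q, hq, h1, h2⟩
    refine ⟨m, n + 1, q, hq, ?_, ?_⟩
    · rw [Function.iterate_succ_apply', ← h1]
      exact (Function.Commute.refl M.τ).iterate_left m a
    · rw [Function.iterate_succ_apply', ← h2]
      exact (Function.Commute.refl N.τ).iterate_left m b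

/-- The powers of `τ` are automorphisms of the value set. A large enough power clears all inverse
powers of `τ`, and the values become terms in values related by `ρ`. -/
theorem ElementaryRel.tauClosure (hρ : ElementaryRel LV ρ) :
    ElementaryRel LV (tauClosure ρ) := by
  intro k p hp ψ
  choose m n q hq h1 h2 using hp
  -- Any common upper bound of the exponents `m i` would serve.
  set s := ∑ i, m i with hs
  have hle : ∀ i, m i ≤ s := fun i => Finset.single_le_sum (f := m) (by simp) (Finset.mem_univ i)
  have e1 : (fun i => M.τ^[s] (p i).1) = fun i => M.τ^[s - m i + n i] (q i).1 := by
    ext i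
    rw [Function.iterate_add_apply, ← h1, ← Function.iterate_add_apply, Nat.sub_add_cancel (hle i)]
  have e2 : (fun i => N.τ^[s] (p i).2) = fun i => N.τ^[s - m i + n i] (q i).2 := by
    ext i
    rw [Function.iterate_add_apply, ← h2, ← Function.iterate_add_apply, Nat.sub_add_cancel (hle i)]
  have key := hρ k q hq (Language.BoundedFormula.subst ψ
    fun i => iterateTauTerm (Language.Term.var i) (s - m i + n i))
  rw [← realize_iterate_τ M s, e1, ← realize_iterate_τ N s, e2]
  simpa only [Language.Formula.Realize, Language.BoundedFormula.realize_subst,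
    realize_iterateTauTerm, Language.Term.realize_var] using key

end SplitModel

end SplitModels

/-! ### Ultrapowers of split models and Łoś's theorem. -/

section Ultrapowers

open FirstOrder TwistedPolynomial Filter

universe u w

/-- On a suitable index set there is an ultrafilter such that each family of subsets of `W` with
the finite intersection property has a point in the ultrapower of `W`. -/
theorem exists_ultrafilter_realizing (W : Type w) : ∃ (I : Type w) (U : Ultrafilter I),
    ∀ 𝓕 : Set (Set W), (∀ t : Finset (Set W), ↑t ⊆ 𝓕 → ∃ x, ∀ s ∈ t, x ∈ s) →
      ∃ f : I → W, ∀ s ∈ 𝓕, ∀ᶠ i in (U : Filter I), f i ∈ s := by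
  classical
  -- An index `t` is a finite set of conditions, and `f t` will meet those of them which belong to
  -- `𝓕`. A given condition `s` is then met at every index above `{s}`.
  refine ⟨Finset (Set W), Ultrafilter.of atTop, fun 𝓕 h => ?_⟩
  have h' : ∀ t : Finset (Set W), ∃ x, ∀ s ∈ t, s ∈ 𝓕 → x ∈ s := fun t => by
    obtain ⟨x, hx⟩ := h (t.filter (· ∈ 𝓕)) (fun s hs => (Finset.mem_filter.1 hs).2)
    exact ⟨x, fun s hs hs' => hx s (Finset.mem_filter.2 ⟨hs, hs'⟩)⟩
  choose f hf using h'
  refine ⟨f, fun s hs => Ultrafilter.of_le _ ?_⟩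
  filter_upwards [eventually_ge_atTop {s}] with t ht
  exact hf t s (ht (Finset.mem_singleton_self s)) hs

namespace SplitModel

variable {K : Type u} [Field K] {φ : K →+* K} {h : Bool → TwistedPolynomial φ → ℕ}

/-- The ultrapower of a split model. -/
noncomputable def ultrapower (N : SplitModel.{u, w} φ h) {I : Type w} (U : Ultrafilter I) :
    SplitModel.{u, w} φ h where
  P ε := Germ (U : Filter I) (N.P ε)
  C := Germ (U : Filter I) N.C
  Δ := Germ (U : Filter I) N.Δ
  τ := Germ.map N.τ
  Rn n := Germ.LiftPred (N.Rn n)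
  θ := (N.θ : Germ (U : Filter I) N.Δ)
  v ε := Germ.map (N.v ε)
  τ_strictMono := fun x y => Germ.inductionOn₂ x y fun f g hfg => by
    rw [Germ.map_coe, Germ.map_coe, Germ.coe_lt]
    exact (Germ.coe_lt.1 hfg).mono fun i hi => N.τ_strictMono hi
  τ_surjective := fun x => Germ.inductionOn x fun f => by
    choose g hg using N.τ_surjective
    exact ⟨(fun i => g (f i) : I → N.Δ), Germ.coe_eq.2 (.of_forall fun i => hg (f i))⟩
  Rn_τ := fun n x => Germ.inductionOn x fun f =>
    eventually_congr (.of_forall fun i => N.Rn_τ n (f i))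
  v_eq_top := fun ε x => Germ.inductionOn x fun f => by
    refine Germ.coe_eq.trans (Iff.trans ?_ (Germ.coe_eq (g := fun _ => (0 : N.P ε))).symm)
    exact eventually_congr (.of_forall fun i => N.v_eq_top ε (f i))
  min_le_v_sub := fun ε x y => Germ.inductionOn₂ x y fun f g => by
    rw [Germ.min_def]
    exact Germ.coe_le.2 (.of_forall fun i => N.min_le_v_sub ε (f i) (g i))
  v_act := fun ε x r hr => Germ.inductionOn x fun f => by
    have key : ∀ (n : ℕ) (d : I → N.Δ),
        (Germ.map N.τ)^[n] (d : Germ (U : Filter I) N.Δ) = ((fun i => N.τ^[n] (d i) : I → N.Δ) :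
          Germ (U : Filter I) N.Δ) := by
      intro n
      induction n with
      | zero => exact fun d => rfl
      | succ n ih => exact fun d => ih _
    rw [Germ.map_coe, key]
    exact Germ.coe_eq.2 (.of_forall fun i => N.v_act ε (f i) r hr)
  divisible := fun ε r hr x => Germ.inductionOn x fun f => by
    choose g hg using N.divisible ε r hr
    exact ⟨(fun i => g (f i) : I → N.P ε), Germ.coe_eq.2 (.of_forall fun i => hg (f i))⟩
  divisibleC := fun r hr x => Germ.inductionOn x fun f => by
    choose g hg using N.divisibleC r hr
    exact ⟨(fun i => g (f i) : I → N.C), Germ.coe_eq.2 (.of_forall fun i => hg (f i))⟩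
  v_dom := fun ε x => Germ.inductionOn x fun f hf => by
    have hf' : ∀ᶠ i in (U : Filter I), f i ≠ 0 :=
      Ultrafilter.eventually_not.2 fun h0 => hf (Germ.coe_eq.2 h0)
    cases ε
    · exact Germ.coe_lt.2 (hf'.mono fun i hi => N.v_dom false (f i) hi)
    · exact Germ.coe_lt.2 (hf'.mono fun i hi => N.v_dom true (f i) hi)
  Rn_iff := fun ε n x => Germ.inductionOn x fun f hf => by
    have hf' : ∀ᶠ i in (U : Filter I), bif ε then f i < N.τ (f i) else N.τ (f i) < f i := by
      cases ε
      · exact Germ.coe_lt.1 hf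
      · exact Germ.coe_lt.1 hf
    constructor
    · intro hR
      have hR' : ∀ᶠ i in (U : Filter I), N.Rn n (f i) := hR
      -- Stated with implications, so that a family, possibly zero, can be chosen at every index and
      -- not only at almost all.
      have hex : ∀ i, ∃ e : Fin n → N.P ε, (bif ε then f i < N.τ (f i) else N.τ (f i) < f i) →
          N.Rn n (f i) →
          (∀ j, f i ≤ N.v ε (e j)) ∧ ∀ j k, j ≠ k → N.v ε (e j - e k) ≤ f i := by
        intro i
        by_cases h1 : (bif ε then f i < N.τ (f i) else N.τ (f i) < f i)
        · by_cases h2 : N.Rn n (f i)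
          · obtain ⟨e, he⟩ := (N.Rn_iff ε n (f i) h1).1 h2
            exact ⟨e, fun _ _ => he⟩
          · exact ⟨0, fun _ h => absurd h h2⟩
        · exact ⟨0, fun h => absurd h h1⟩
      choose e he using hex
      refine ⟨fun j => ((fun i => e i j : I → N.P ε) : Germ (U : Filter I) (N.P ε)),
        fun j => Germ.coe_le.2 ?_, fun j k hjk => Germ.coe_le.2 ?_⟩
      · filter_upwards [hf', hR'] with i h1 h2 using (he i h1 h2).1 j
      · filter_upwards [hf', hR'] with i h1 h2 using (he i h1 h2).2 j k hjk
    · rintro ⟨e, he1, he2⟩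
      have hrep : ∀ j, ∃ g : I → N.P ε, (g : Germ (U : Filter I) (N.P ε)) = e j :=
        fun j => Quot.exists_rep (e j)
      choose g hg using hrep
      have h1 : ∀ᶠ i in (U : Filter I), ∀ j, f i ≤ N.v ε (g j i) :=
        eventually_all.2 fun j => Germ.coe_le.1 (by
          have := he1 j
          rw [← hg] at this
          exact this)
      have h2 : ∀ᶠ i in (U : Filter I), ∀ j k, j ≠ k → N.v ε (g j i - g k i) ≤ f i := by
        refine eventually_all.2 fun j => eventually_all.2 fun k => ?_
        by_cases hjk : j = k
        · exact .of_forall fun i hne => absurd hjk hne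
        · have := he2 j k hjk
          rw [← hg, ← hg] at this
          exact (Germ.coe_le.1 this).mono fun i hi _ => hi
      change ∀ᶠ i in (U : Filter I), N.Rn n (f i)
      filter_upwards [hf', h1, h2] with i hi h1 h2
      exact (N.Rn_iff ε n (f i) hi).2 ⟨fun j => g j i, h1, h2⟩

variable (N : SplitModel.{u, w} φ h) {I : Type w} (U : Ultrafilter I)

/-- The class of a family of values. -/
def valueGerm (f : I → N.Δ) : (N.ultrapower U).Δ := (f : Germ (U : Filter I) N.Δ)

/-- The class of a family of elements of `P ε`. -/
def pieceGerm (ε : Bool) (f : I → N.P ε) : (N.ultrapower U).P ε := (f : Germ (U : Filter I) (N.P ε))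

/-- The class of a family of elements of `C`. -/
def germC (f : I → N.C) : (N.ultrapower U).C := (f : Germ (U : Filter I) N.C)

/-- The class of a family of elements of a split model. -/
def carrierGerm (f : I → N.Carrier) : (N.ultrapower U).Carrier :=
  (N.pieceGerm U false fun i => (f i).1, N.germC U fun i => (f i).2.1,
    N.pieceGerm U true fun i => (f i).2.2)

variable {N U}

theorem valueGerm_surjective : Function.Surjective (N.valueGerm U) := Quot.exists_rep
theorem pieceGerm_surjective (ε : Bool) : Function.Surjective (N.pieceGerm U ε) := Quot.exists_rep
theorem germC_surjective : Function.Surjective (N.germC U) := Quot.exists_rep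

theorem carrierGerm_surjective : Function.Surjective (N.carrierGerm U) := by
  rintro ⟨a, b, c⟩
  obtain ⟨f, rfl⟩ := pieceGerm_surjective _ a
  obtain ⟨g, rfl⟩ := germC_surjective b
  obtain ⟨k, rfl⟩ := pieceGerm_surjective _ c
  exact ⟨fun i => (f i, g i, k i), rfl⟩

theorem valueGerm_eq {f g : I → N.Δ} :
    N.valueGerm U f = N.valueGerm U g ↔ ∀ᶠ i in (U : Filter I), f i = g i := Germ.coe_eq

theorem valueGerm_lt {f g : I → N.Δ} :
    N.valueGerm U f < N.valueGerm U g ↔ ∀ᶠ i in (U : Filter I), f i < g i := Germ.coe_lt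

theorem valueGerm_le {f g : I → N.Δ} :
    N.valueGerm U f ≤ N.valueGerm U g ↔ ∀ᶠ i in (U : Filter I), f i ≤ g i := Germ.coe_le

theorem pieceGerm_eq {ε : Bool} {f g : I → N.P ε} :
    N.pieceGerm U ε f = N.pieceGerm U ε g ↔ ∀ᶠ i in (U : Filter I), f i = g i := Germ.coe_eq

theorem germC_eq {f g : I → N.C} :
    N.germC U f = N.germC U g ↔ ∀ᶠ i in (U : Filter I), f i = g i := Germ.coe_eq

theorem pieceGerm_eq_zero {ε : Bool} {f : I → N.P ε} :
    N.pieceGerm U ε f = 0 ↔ ∀ᶠ i in (U : Filter I), f i = 0 :=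
  pieceGerm_eq (g := fun _ => 0)

theorem germC_eq_zero {f : I → N.C} :
    N.germC U f = 0 ↔ ∀ᶠ i in (U : Filter I), f i = 0 :=
  germC_eq (g := fun _ => 0)

theorem carrierGerm_eq {f g : I → N.Carrier} :
    N.carrierGerm U f = N.carrierGerm U g ↔ ∀ᶠ i in (U : Filter I), f i = g i := by
  simp only [carrierGerm, Prod.ext_iff, pieceGerm_eq, germC_eq, eventually_and]

theorem v_pieceGerm {ε : Bool} (f : I → N.P ε) :
    (N.ultrapower U).v ε (N.pieceGerm U ε f) = N.valueGerm U fun i => N.v ε (f i) := rfl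

/-- The ultrafilter decides which component is the first nonzero one, so almost all indices are in
the same lexicographic case as the germ. -/
theorem val_carrierGerm (f : I → N.Carrier) :
    (N.ultrapower U).val (N.carrierGerm U f) = N.valueGerm U fun i => N.val (f i) := by
  by_cases h1 : N.pieceGerm U false (fun i => (f i).1) = 0
  · by_cases h2 : N.germC U (fun i => (f i).2.1) = 0
    · have e : (N.ultrapower U).val (N.carrierGerm U f)
          = (N.ultrapower U).v true (N.pieceGerm U true fun i => (f i).2.2) :=
        val_of_eq_of_eq h1 h2
      rw [e, v_pieceGerm, valueGerm_eq]
      filter_upwards [pieceGerm_eq_zero.1 h1, germC_eq_zero.1 h2] with i hi hi'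
      rw [val_of_eq_of_eq hi hi']
    · have e : (N.ultrapower U).val (N.carrierGerm U f) = N.valueGerm U fun _ => N.θ :=
        val_of_eq_of_ne h1 h2
      rw [e, valueGerm_eq]
      have h2' := Ultrafilter.eventually_not.2 (mt germC_eq_zero.2 h2)
      filter_upwards [pieceGerm_eq_zero.1 h1, h2'] with i hi hi'
      rw [val_of_eq_of_ne hi hi']
  · have e : (N.ultrapower U).val (N.carrierGerm U f)
        = (N.ultrapower U).v false (N.pieceGerm U false fun i => (f i).1) := val_of_ne h1
    rw [e, v_pieceGerm, valueGerm_eq]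
    have h1' := Ultrafilter.eventually_not.2 (mt pieceGerm_eq_zero.2 h1)
    filter_upwards [h1'] with i hi
    rw [val_of_ne hi]

/-- The value set of the ultrapower is the ultrapower of the value set. -/
def productEquiv (N : SplitModel.{u, w} φ h) (U : Ultrafilter I) :
    (U : Filter I).Product (fun _ => N.Δ) ≃[LV] (N.ultrapower U).Δ where
  toEquiv := Equiv.refl (Germ (U : Filter I) N.Δ)
  map_fun' := by
    rintro k f x
    choose y hy using fun i => Quot.exists_rep (x i)
    obtain rfl : x = fun i => (y i : (U : Filter I).Product (fun _ => N.Δ)) :=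
      funext fun i => (hy i).symm
    refine Eq.trans (Language.Ultraproduct.funMap_cast (M := fun _ => N.Δ) f y) ?_
    rcases f with _ | _ <;> rfl
  map_rel' := by
    rintro k r x
    choose y hy using fun i => Quot.exists_rep (x i)
    obtain rfl : x = fun i => (y i : (U : Filter I).Product (fun _ => N.Δ)) :=
      funext fun i => (hy i).symm
    rcases r with _ | n
    · exact valueGerm_lt
    · rfl

/-- Łoś's theorem for the value set. -/
theorem realize_valueGerm {α : Type*} (ψ : LV.Formula α) (x : α → I → N.Δ) :
    ψ.Realize (fun j => N.valueGerm U (x j)) ↔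
      ∀ᶠ i in (U : Filter I), ψ.Realize fun j => x j i := by
  rw [← Language.Ultraproduct.realize_formula_cast (M := fun _ => N.Δ) ψ x]
  exact (Language.StrongHomClass.realize_formula (N.productEquiv U) ψ)

theorem realize_carrierGerm {α : Type*} (s : (LMod (TwistedPolynomial φ)).Term α)
    (x : α → I → N.Carrier) :
    s.realize (fun j => N.carrierGerm U (x j)) =
      N.carrierGerm U fun i => s.realize fun j => x j i := by
  induction s with
  | var => rfl
  | func f ts ih =>
    simp only [Language.Term.realize, ih]
    rcases f with _ | _ | _ | r <;> rfl

theorem realizeTerm₂_germ {n m : ℕ} (t : TwoSorted.Term₂ (LMod (TwistedPolynomial φ)) LV n m)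
    (x : Fin n → I → N.Carrier) (y : Fin m → I → N.Δ) :
    TwoSorted.realizeTerm₂ (N.ultrapower U).val t (fun j => N.carrierGerm U (x j))
      (fun j => N.valueGerm U (y j)) =
        N.valueGerm U fun i => TwoSorted.realizeTerm₂ N.val t (fun j => x j i) fun j => y j i := by
  rw [TwoSorted.realizeTerm₂]
  induction t with
  | var s =>
    rcases s with j | s
    · rfl
    · simp only [Language.Term.realize_var, Sum.elim_inr, realize_carrierGerm, val_carrierGerm]
      rfl
  | func f ts ih =>
    simp only [Language.Term.realize, ih]
    rcases f with _ | _ <;> rfl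

/-- Łoś's theorem for split models. -/
theorem realize_germ {n m : ℕ} (ψ : TwoSorted.Formula (LMod (TwistedPolynomial φ)) LV n m)
    (x : Fin n → I → N.Carrier) (y : Fin m → I → N.Δ) :
    ψ.Realize (N.ultrapower U).val (fun j => N.carrierGerm U (x j)) (fun j => N.valueGerm U (y j)) ↔
      ∀ᶠ i in (U : Filter I), ψ.Realize N.val (fun j => x j i) fun j => y j i := by
  induction ψ with
  | falsum => simp [TwoSorted.Formula.Realize, U.neBot.ne]
  | eq₁ s t =>
    simp only [TwoSorted.Formula.Realize, realize_carrierGerm]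
    exact carrierGerm_eq
  | eq₂ s t =>
    simp only [TwoSorted.Formula.Realize, realizeTerm₂_germ]
    exact valueGerm_eq
  | rel₁ r ts => exact r.elim
  | rel₂ r ts =>
    simp only [TwoSorted.Formula.Realize, realizeTerm₂_germ]
    rcases r with _ | k
    · exact valueGerm_lt
    · exact Iff.rfl
  | imp f g ihf ihg =>
    simp only [TwoSorted.Formula.Realize, ihf, ihg, Ultrafilter.eventually_imp]
  | @all₁ n m f ih =>
    have e : ∀ a : I → N.Carrier, (fun j => N.carrierGerm U ((Fin.snoc x a :
        Fin (n + 1) → I → N.Carrier) j)) = Fin.snoc (fun j => N.carrierGerm U (x j))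
          (N.carrierGerm U a) := fun a => by
      ext1 j
      refine Fin.lastCases ?_ (fun j => ?_) j <;> simp
    have e' : ∀ (a : I → N.Carrier) (i : I), (fun j => (Fin.snoc x a :
        Fin (n + 1) → I → N.Carrier) j i) = Fin.snoc (fun j => x j i) (a i) := fun a i => by
      ext1 j
      refine Fin.lastCases ?_ (fun j => ?_) j <;> simp
    simp only [TwoSorted.Formula.Realize]
    rw [carrierGerm_surjective.forall]
    simp only [← e, ih, e']
    refine ⟨fun H => ?_, fun H a => H.mono fun i hi => hi (a i)⟩
    by_contra hn
    have hn' := Ultrafilter.eventually_not.2 hn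
    simp only [not_forall] at hn'
    -- A counterexample chosen at almost every index is a counterexample in the ultrapower.
    obtain ⟨a, ha⟩ := hn'.choice
    obtain ⟨i, h1, h2⟩ := (ha.and (H a)).exists
    exact h1 h2
  | @all₂ n m f ih =>
    have e : ∀ a : I → N.Δ, (fun j => N.valueGerm U ((Fin.snoc y a :
        Fin (m + 1) → I → N.Δ) j)) = Fin.snoc (fun j => N.valueGerm U (y j))
          (N.valueGerm U a) := fun a => by
      ext1 j
      refine Fin.lastCases ?_ (fun j => ?_) j <;> simp
    have e' : ∀ (a : I → N.Δ) (i : I), (fun j => (Fin.snoc y a :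
        Fin (m + 1) → I → N.Δ) j i) = Fin.snoc (fun j => y j i) (a i) := fun a i => by
      ext1 j
      refine Fin.lastCases ?_ (fun j => ?_) j <;> simp
    simp only [TwoSorted.Formula.Realize]
    rw [valueGerm_surjective.forall]
    simp only [← e, ih, e']
    refine ⟨fun H => ?_, fun H a => H.mono fun i hi => hi (a i)⟩
    by_contra hn
    have hn' := Ultrafilter.eventually_not.2 hn
    simp only [not_forall] at hn'
    obtain ⟨a, ha⟩ := hn'.choice
    obtain ⟨i, h1, h2⟩ := (ha.and (H a)).exists
    exact h1 h2

end SplitModel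

end Ultrapowers

/-! ### Partial isomorphisms, their composition with ultrapowers, and the adjunction of pairs. -/

section PartialIsomorphisms

open FirstOrder TwistedPolynomial Filter

universe u w

section DivisionClosure

variable {K : Type*} [Field K] {φ : K →+* K} {X : Type*} [AddCommGroup X]
  [Module (TwistedPolynomial φ)ᵐᵒᵖ X]

/-- The elements which have a nonzero multiple in the given submodule. -/
noncomputable def divClosure (S : Submodule (TwistedPolynomial φ)ᵐᵒᵖ X) :
    Submodule (TwistedPolynomial φ)ᵐᵒᵖ X :=
  (torsionSubmodule φ (X ⧸ S)).comap S.mkQ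

theorem mem_divClosure {S : Submodule (TwistedPolynomial φ)ᵐᵒᵖ X} {x : X} :
    x ∈ divClosure S ↔ ∃ r : TwistedPolynomial φ, r ≠ 0 ∧ x <• r ∈ S := by
  refine exists_congr fun r => and_congr_right fun _ => ?_
  rw [← map_smul, Submodule.mkQ_apply, Submodule.Quotient.mk_eq_zero]

theorem le_divClosure (S : Submodule (TwistedPolynomial φ)ᵐᵒᵖ X) : S ≤ divClosure S :=
  fun x hx => mem_divClosure.2 ⟨1, one_ne_zero, by rwa [act_one]⟩

theorem mem_divClosure_of_act_mem {S : Submodule (TwistedPolynomial φ)ᵐᵒᵖ X} {x : X}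
    {r : TwistedPolynomial φ} (hr : r ≠ 0) (hx : x <• r ∈ divClosure S) : x ∈ divClosure S := by
  obtain ⟨s, hs, h⟩ := mem_divClosure.1 hx
  exact mem_divClosure.2 ⟨r * s, mul_ne_zero hr hs, by rwa [act_mul]⟩

theorem mem_sup_span_iff {S : Submodule (TwistedPolynomial φ)ᵐᵒᵖ X} {x y : X} :
    y ∈ S ⊔ Submodule.span _ {x} ↔ ∃ s ∈ S, ∃ r : TwistedPolynomial φ, y = s + x <• r := by
  rw [Submodule.mem_sup]
  constructor
  · rintro ⟨s, hs, z, hz, rfl⟩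
    obtain ⟨a, rfl⟩ := Submodule.mem_span_singleton.1 hz
    exact ⟨s, hs, a.unop, rfl⟩
  · rintro ⟨s, hs, r, rfl⟩
    exact ⟨s, hs, _, Submodule.mem_span_singleton.2 ⟨MulOpposite.op r, rfl⟩, rfl⟩

end DivisionClosure

namespace SplitModel

variable {K : Type u} [Field K] {φ : K →+* K} {h : Bool → TwistedPolynomial φ → ℕ}

/-- There are at least `n` elements of `C` killed by `r`. -/
def AnnAtLeast (N : SplitModel.{u, w} φ h) (r : TwistedPolynomial φ) (n : ℕ) : Prop :=
  ∃ e : Fin n → N.C, Function.Injective e ∧ ∀ i, e i <• r = 0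

/-- A partial isomorphism between split models, elementary on the value sets. -/
structure PartialIso (M N : SplitModel.{u, w} φ h) where
  ρ : Set (M.Δ × N.Δ)
  elementary : ElementaryRel LV ρ
  τ_mem : ∀ a b, (M.τ a, N.τ b) ∈ ρ ↔ (a, b) ∈ ρ
  top_mem : (⊤, ⊤) ∈ ρ
  θ_mem : (M.θ, N.θ) ∈ ρ
  g : ∀ ε, Submodule (TwistedPolynomial φ)ᵐᵒᵖ (M.P ε × N.P ε)
  g_closed : ∀ ε p (r : TwistedPolynomial φ), r ≠ 0 → p <• r ∈ g ε → p ∈ g ε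
  g_val : ∀ ε, ∀ p ∈ g ε, (M.v ε p.1, N.v ε p.2) ∈ ρ
  -- No closure under division here: quotients in `C` are not unique. The relation has only to be
  -- the graph of an isomorphism between submodules.
  gC : Submodule (TwistedPolynomial φ)ᵐᵒᵖ (M.C × N.C)
  gC_zero : ∀ p ∈ gC, p.1 = 0 ↔ p.2 = 0
  -- This and `nontrivial_iff` are all that the back-and-forth needs to know about the modules `C`.
  ann_iff : ∀ r, r ≠ 0 → ∀ n, M.AnnAtLeast r n ↔ N.AnnAtLeast r n
  nontrivial_iff : Nontrivial M.C ↔ Nontrivial N.C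

namespace PartialIso

variable {M N N' N'' : SplitModel.{u, w} φ h}

/-- The inverse partial isomorphism. -/
noncomputable def symm (q : PartialIso M N) : PartialIso N M where
  ρ := Prod.swap ⁻¹' q.ρ
  elementary := fun k p hp ψ => (q.elementary k (fun i => (p i).swap) hp ψ).symm
  τ_mem := fun a b => q.τ_mem b a
  top_mem := q.top_mem
  θ_mem := q.θ_mem
  g ε := (q.g ε).comap (LinearEquiv.prodComm _ _ _).toLinearMap
  g_closed := fun ε p r hr hp => q.g_closed ε p.swap r hr hp
  g_val := fun ε p hp => q.g_val ε p.swap hp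
  gC := q.gC.comap (LinearEquiv.prodComm _ _ _).toLinearMap
  gC_zero := fun p hp => (q.gC_zero p.swap hp).symm
  ann_iff := fun r hr n => (q.ann_iff r hr n).symm
  nontrivial_iff := q.nontrivial_iff.symm

/-- The graph of a partial isomorphism. -/
def Mem (q : PartialIso M N) (x : M.Carrier) (y : N.Carrier) : Prop :=
  (x.1, y.1) ∈ q.g false ∧ (x.2.1, y.2.1) ∈ q.gC ∧ (x.2.2, y.2.2) ∈ q.g true

theorem Mem.symm {q : PartialIso M N} {x : M.Carrier} {y : N.Carrier} (h : q.Mem x y) :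
    q.symm.Mem y x := h

theorem Mem.zero (q : PartialIso M N) : q.Mem 0 0 :=
  ⟨(q.g false).zero_mem, q.gC.zero_mem, (q.g true).zero_mem⟩

theorem Mem.add {q : PartialIso M N} {x x' : M.Carrier} {y y' : N.Carrier} (h : q.Mem x y)
    (h' : q.Mem x' y') : q.Mem (x + x') (y + y') :=
  ⟨(q.g false).add_mem h.1 h'.1, q.gC.add_mem h.2.1 h'.2.1, (q.g true).add_mem h.2.2 h'.2.2⟩

theorem Mem.neg {q : PartialIso M N} {x : M.Carrier} {y : N.Carrier} (h : q.Mem x y) :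
    q.Mem (-x) (-y) :=
  ⟨(q.g false).neg_mem h.1, q.gC.neg_mem h.2.1, (q.g true).neg_mem h.2.2⟩

theorem Mem.act {q : PartialIso M N} {x : M.Carrier} {y : N.Carrier} (h : q.Mem x y)
    (r : TwistedPolynomial φ) : q.Mem (x <• r) (y <• r) :=
  ⟨(q.g false).smul_mem _ h.1, q.gC.smul_mem _ h.2.1, (q.g true).smul_mem _ h.2.2⟩

theorem g_zero_iff (q : PartialIso M N) {ε : Bool} {x : M.P ε} {y : N.P ε}
    (hxy : (x, y) ∈ q.g ε) : x = 0 ↔ y = 0 := by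
  rw [← M.v_eq_top ε, ← N.v_eq_top ε]
  exact eq_top_iff_of_mem q.elementary (q.g_val ε _ hxy)

theorem Mem.eq_zero_iff {q : PartialIso M N} {x : M.Carrier} {y : N.Carrier} (h : q.Mem x y) :
    x = 0 ↔ y = 0 := by
  simp only [Prod.ext_iff, Prod.fst_zero, Prod.snd_zero]
  exact and_congr (q.g_zero_iff h.1) (and_congr (q.gC_zero _ h.2.1) (q.g_zero_iff h.2.2))

theorem Mem.eq_iff {q : PartialIso M N} {x x' : M.Carrier} {y y' : N.Carrier} (h : q.Mem x y)
    (h' : q.Mem x' y') : x = x' ↔ y = y' := by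
  rw [← sub_eq_zero, ← sub_eq_zero (a := y), sub_eq_add_neg, sub_eq_add_neg]
  exact (h.add h'.neg).eq_zero_iff

theorem Mem.val {q : PartialIso M N} {x : M.Carrier} {y : N.Carrier} (h : q.Mem x y) :
    (M.val x, N.val y) ∈ q.ρ := by
  by_cases h1 : x.1 = 0
  · have h1' := (q.g_zero_iff h.1).1 h1
    by_cases h2 : x.2.1 = 0
    · rw [val_of_eq_of_eq h1 h2, val_of_eq_of_eq h1' ((q.gC_zero _ h.2.1).1 h2)]
      exact q.g_val true _ h.2.2
    · rw [val_of_eq_of_ne h1 h2, val_of_eq_of_ne h1' (mt (q.gC_zero _ h.2.1).2 h2)]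
      exact q.θ_mem
  · rw [val_of_ne h1, val_of_ne (mt (q.g_zero_iff h.1).2 h1)]
    exact q.g_val false _ h.1

/-- `q'` extends `q`, up to an elementary embedding on the right. -/
def Extends (q : PartialIso M N) (q' : PartialIso M N') : Prop :=
  ∃ (i : N.Carrier → N'.Carrier) (j : N.Δ → N'.Δ),
    (∀ {n m : ℕ} (ψ : TwoSorted.Formula (LMod (TwistedPolynomial φ)) LV n m) x y,
      ψ.Realize N'.val (fun k => i (x k)) (fun k => j (y k)) ↔ ψ.Realize N.val x y) ∧
    (∀ x y, q.Mem x y → q'.Mem x (i y)) ∧ ∀ a b, (a, b) ∈ q.ρ → (a, j b) ∈ q'.ρ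

theorem Extends.trans {q : PartialIso M N} {q' : PartialIso M N'} {q'' : PartialIso M N''}
    (h₁ : q.Extends q') (h₂ : q'.Extends q'') : q.Extends q'' := by
  obtain ⟨i, j, h1, h2, h3⟩ := h₁
  obtain ⟨i', j', h1', h2', h3'⟩ := h₂
  exact ⟨i' ∘ i, j' ∘ j, fun ψ x y => (h1' ψ _ _).trans (h1 ψ x y),
    fun x y hxy => h2' _ _ (h2 x y hxy), fun a b hab => h3' _ _ (h3 a b hab)⟩

theorem Extends.of_le {q q' : PartialIso M N} (hρ : q.ρ ⊆ q'.ρ) (hg : ∀ ε, q.g ε ≤ q'.g ε)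
    (hC : q.gC ≤ q'.gC) : q.Extends q' :=
  ⟨id, id, fun _ _ _ => Iff.rfl, fun _ _ hxy => ⟨hg _ hxy.1, hC hxy.2.1, hg _ hxy.2.2⟩,
    fun _ _ hab => hρ hab⟩

theorem Extends.refl (q : PartialIso M N) : q.Extends q :=
  .of_le subset_rfl (fun _ => le_rfl) le_rfl

/-- The domain of a partial isomorphism. -/
def dom (q : PartialIso M N) : Set M.Carrier := {x | ∃ y, q.Mem x y}

theorem Extends.dom_subset {q : PartialIso M N} {q' : PartialIso M N'} (h : q.Extends q') :
    q.dom ⊆ q'.dom := by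
  obtain ⟨i, -, -, h2, -⟩ := h
  rintro x ⟨y, hxy⟩
  exact ⟨i y, h2 x y hxy⟩

/-- The correspondence of values of a partial isomorphism, composed with the diagonal embedding
in an ultrapower. -/
def pushRel (q : PartialIso M N) {I : Type w} (U : Ultrafilter I) :
    Set (M.Δ × (N.ultrapower U).Δ) :=
  {p | ∃ b, (p.1, b) ∈ q.ρ ∧ p.2 = N.valueGerm U fun _ => b}

/-- The diagonal embedding of `P ε` in an ultrapower. -/
def diagP (N : SplitModel.{u, w} φ h) {I : Type w} (U : Ultrafilter I) (ε : Bool) :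
    N.P ε →ₗ[(TwistedPolynomial φ)ᵐᵒᵖ] (N.ultrapower U).P ε where
  toFun x := N.pieceGerm U ε fun _ => x
  map_add' _ _ := rfl
  map_smul' _ _ := rfl

/-- The diagonal embedding of `C` in an ultrapower. -/
def diagC (N : SplitModel.{u, w} φ h) {I : Type w} (U : Ultrafilter I) :
    N.C →ₗ[(TwistedPolynomial φ)ᵐᵒᵖ] (N.ultrapower U).C where
  toFun x := N.germC U fun _ => x
  map_add' _ _ := rfl
  map_smul' _ _ := rfl

theorem mem_map_prodMap_id {R X Y Y' : Type*} [Semiring R] [AddCommMonoid X] [AddCommMonoid Y]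
    [AddCommMonoid Y'] [Module R X] [Module R Y] [Module R Y'] {S : Submodule R (X × Y)}
    {f : Y →ₗ[R] Y'} {p : X × Y'} :
    p ∈ S.map (LinearMap.id.prodMap f) ↔ ∃ y, (p.1, y) ∈ S ∧ p.2 = f y := by
  constructor
  · rintro ⟨⟨x, y⟩, hxy, rfl⟩
    exact ⟨y, hxy, rfl⟩
  · rintro ⟨y, hy, hp⟩
    exact ⟨(p.1, y), hy, Prod.ext rfl hp.symm⟩

theorem annAtLeast_ultrapower {I : Type w} (U : Ultrafilter I) (r : TwistedPolynomial φ) (n : ℕ) :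
    (N.ultrapower U).AnnAtLeast r n ↔ N.AnnAtLeast r n := by
  constructor
  · rintro ⟨e, he, her⟩
    choose f hf using fun i => germC_surjective (e i)
    have h1 : ∀ᶠ k in (U : Filter I), ∀ i j, i ≠ j → f i k ≠ f j k := by
      refine eventually_all.2 fun i => eventually_all.2 fun j => ?_
      by_cases hij : i = j
      · exact .of_forall fun _ hne => absurd hij hne
      · refine (Ultrafilter.eventually_not.2 fun hk => hij (he ?_)).mono fun _ hk _ => hk
        rw [← hf, ← hf]
        exact germC_eq.2 hk
    have h2 : ∀ᶠ k in (U : Filter I), ∀ i, f i k <• r = 0 := by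
      refine eventually_all.2 fun i => ?_
      have := her i
      rw [← hf] at this
      exact germC_eq_zero.1 this
    obtain ⟨k, hk, hk'⟩ := (h1.and h2).exists
    exact ⟨fun i => f i k, fun i j hij => by_contra fun hne => hk i j hne hij, hk'⟩
  · rintro ⟨e, he, her⟩
    refine ⟨fun i => N.germC U fun _ => e i, fun i j hij => he ?_, fun i => ?_⟩
    · exact eventually_const.1 (germC_eq.1 hij)
    · exact germC_eq_zero.2 (.of_forall fun _ => her i)

theorem nontrivial_ultrapower {I : Type w} (U : Ultrafilter I) :
    Nontrivial (N.ultrapower U).C ↔ Nontrivial N.C := by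
  constructor
  · intro _
    obtain ⟨x, hx⟩ := exists_ne (0 : (N.ultrapower U).C)
    obtain ⟨f, rfl⟩ := germC_surjective x
    obtain ⟨k, hk⟩ := (Ultrafilter.eventually_not.2 (mt germC_eq_zero.2 hx)).exists
    exact ⟨f k, 0, hk⟩
  · intro _
    obtain ⟨x, hx⟩ := exists_ne (0 : N.C)
    exact ⟨N.germC U fun _ => x, 0, fun h0 => hx (eventually_const.1 (germC_eq_zero.1 h0))⟩

/-- The composite of a partial isomorphism with the diagonal embedding in an ultrapower. -/
noncomputable def push (q : PartialIso M N) {I : Type w} (U : Ultrafilter I) :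
    PartialIso M (N.ultrapower U) where
  ρ := q.pushRel U
  elementary := fun k p hp ψ => by
    choose b hb hb' using hp
    rw [q.elementary k (fun i => ((p i).1, b i)) hb ψ]
    have := realize_valueGerm (N := N) (U := U) ψ fun i _ => b i
    simp only [hb']
    rw [this, eventually_const]
  τ_mem := fun a b => by
    constructor
    · rintro ⟨c, hc, hb⟩
      obtain ⟨d, rfl⟩ := N.τ_surjective c
      refine ⟨d, (q.τ_mem _ _).1 hc, (N.ultrapower U).τ_strictMono.injective ?_⟩
      exact hb
    · rintro ⟨c, hc, hb⟩
      exact ⟨N.τ c, (q.τ_mem _ _).2 hc, congrArg (N.ultrapower U).τ hb⟩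
  top_mem := ⟨⊤, q.top_mem, rfl⟩
  θ_mem := ⟨N.θ, q.θ_mem, rfl⟩
  g ε := (q.g ε).map (LinearMap.id.prodMap (diagP N U ε))
  g_closed := fun ε p r hr hp => by
    rw [mem_map_prodMap_id] at hp ⊢
    obtain ⟨y, hy, hpy⟩ := hp
    obtain ⟨z, rfl⟩ := N.divisible ε r hr y
    refine ⟨z, q.g_closed ε _ r hr hy, ?_⟩
    -- Division by `r` is unique in the ultrapower of `P ε`, so the second component of `p` is the
    -- diagonal image of `z`.
    rw [← sub_eq_zero]
    refine act_eq_zero hr ?_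
    rw [smul_sub, sub_eq_zero]
    exact hpy
  g_val := fun ε p hp => by
    obtain ⟨y, hy, hpy⟩ := mem_map_prodMap_id.1 hp
    exact ⟨N.v ε y, q.g_val ε _ hy, by rw [hpy]; rfl⟩
  gC := q.gC.map (LinearMap.id.prodMap (diagC N U))
  gC_zero := fun p hp => by
    obtain ⟨y, hy, hpy⟩ := mem_map_prodMap_id.1 hp
    rw [hpy, q.gC_zero _ hy]
    exact ((germC_eq_zero).trans eventually_const).symm
  ann_iff := fun r hr n => by rw [annAtLeast_ultrapower, q.ann_iff r hr n]
  nontrivial_iff := by rw [nontrivial_ultrapower, q.nontrivial_iff]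

theorem mem_push_g {q : PartialIso M N} {I : Type w} {U : Ultrafilter I} {ε : Bool}
    {p : M.P ε × (N.ultrapower U).P ε} :
    p ∈ (q.push U).g ε ↔ ∃ y, (p.1, y) ∈ q.g ε ∧ p.2 = N.pieceGerm U ε fun _ => y :=
  mem_map_prodMap_id

theorem mem_push_gC {q : PartialIso M N} {I : Type w} {U : Ultrafilter I}
    {p : M.C × (N.ultrapower U).C} :
    p ∈ (q.push U).gC ↔ ∃ y, (p.1, y) ∈ q.gC ∧ p.2 = N.germC U fun _ => y :=
  mem_map_prodMap_id

theorem extends_push (q : PartialIso M N) {I : Type w} (U : Ultrafilter I) :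
    q.Extends (q.push U) := by
  refine ⟨fun x => N.carrierGerm U fun _ => x, fun b => N.valueGerm U fun _ => b, ?_, ?_, ?_⟩
  · intro n m ψ x y
    exact (realize_germ ψ (fun k _ => x k) (fun k _ => y k)).trans eventually_const
  · intro x y hxy
    exact ⟨mem_push_g.2 ⟨_, hxy.1, rfl⟩, mem_push_gC.2 ⟨_, hxy.2.1, rfl⟩,
      mem_push_g.2 ⟨_, hxy.2.2, rfl⟩⟩
  · exact fun a b hab => ⟨b, hab, rfl⟩

/-- Adding a pair of values of the same type. -/
noncomputable def addValue (q : PartialIso M N) (a : M.Δ) (b : N.Δ)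
    (hab : ∀ s s', DefPair LV q.ρ s s' → a ∈ s → b ∈ s') : PartialIso M N :=
  { q with
    ρ := tauClosure (insert (a, b) q.ρ)
    elementary := ElementaryRel.tauClosure (ElementaryRel.insert ⟨_, q.top_mem⟩ hab)
    τ_mem := tau_mem_tauClosure
    top_mem := subset_tauClosure (Set.mem_insert_of_mem _ q.top_mem)
    θ_mem := subset_tauClosure (Set.mem_insert_of_mem _ q.θ_mem)
    g_val := fun ε p hp => subset_tauClosure (Set.mem_insert_of_mem _ (q.g_val ε p hp)) }

theorem extends_addValue (q : PartialIso M N) (a : M.Δ) (b : N.Δ) (hab) :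
    q.Extends (q.addValue a b hab) :=
  .of_le ((Set.subset_insert _ _).trans subset_tauClosure) (fun _ => le_rfl) le_rfl

theorem mem_addValue (q : PartialIso M N) (a : M.Δ) (b : N.Δ) (hab) :
    (a, b) ∈ (q.addValue a b hab).ρ := subset_tauClosure (Set.mem_insert _ _)

theorem iterate_τ_mem (q : PartialIso M N) (n : ℕ) (a : M.Δ) (b : N.Δ) :
    (M.τ^[n] a, N.τ^[n] b) ∈ q.ρ ↔ (a, b) ∈ q.ρ := by
  induction n with
  | zero => rfl
  | succ n ih => rw [Function.iterate_succ_apply', Function.iterate_succ_apply', q.τ_mem, ih]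

/-- Adding a pair of elements of `P ε` with corresponding distances to the elements of the
graph. -/
noncomputable def addPiece (q : PartialIso M N) (ε : Bool) (z : M.P ε) (z' : N.P ε)
    (hz : ∀ p ∈ q.g ε, (M.v ε (p.1 + z), N.v ε (p.2 + z')) ∈ q.ρ) : PartialIso M N :=
  { q with
    g := Function.update q.g ε (divClosure (q.g ε ⊔ Submodule.span _ {(z, z')}))
    g_closed := fun δ p r hr hp => by
      by_cases hδ : δ = ε
      · subst hδ
        rw [Function.update_self] at hp ⊢
        exact mem_divClosure_of_act_mem hr hp
      · rw [Function.update_of_ne hδ] at hp ⊢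
        exact q.g_closed δ p r hr hp
    g_val := fun δ p hp => by
      by_cases hδ : δ = ε
      · subst hδ
        rw [Function.update_self] at hp
        obtain ⟨r, hr, hpr⟩ := mem_divClosure.1 hp
        obtain ⟨t, ht, s, hts⟩ := mem_sup_span_iff.1 hpr
        by_cases hs : s = 0
        · have h0 : p <• r ∈ q.g δ := by
            rw [hts, hs, MulOpposite.op_zero, zero_smul, add_zero]
            exact ht
          exact q.g_val δ p (q.g_closed δ p r hr h0)
        -- Here `t + z.s = (a + z).s`, and the pair of quotients lies in the graph, which is closed
        -- under division. The value is thus `τ^(h δ s)` of a distance covered by `hz`.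
        · obtain ⟨a, ha⟩ := M.divisible δ s hs t.1
          obtain ⟨b, hb⟩ := N.divisible δ s hs t.2
          have hab : (a, b) ∈ q.g δ := q.g_closed δ (a, b) s hs (by
            convert ht using 1
            exact Prod.ext ha hb)
          have key := (q.iterate_τ_mem (h δ s) _ _).2 (hz (a, b) hab)
          rw [← M.v_act δ _ s hs, ← N.v_act δ _ s hs, smul_add, smul_add, ha, hb] at key
          -- The values of the two components of `p` are recovered from those of `p.r`, since `ρ` is
          -- stable under the inverse of `τ`.
          rw [← q.iterate_τ_mem (h δ r), ← M.v_act δ _ r hr, ← N.v_act δ _ r hr]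
          have e1 : p.1 <• r = t.1 + z <• s := congrArg Prod.fst hts
          have e2 : p.2 <• r = t.2 + z' <• s := congrArg Prod.snd hts
          rw [e1, e2]
          exact key
      · rw [Function.update_of_ne hδ] at hp
        exact q.g_val δ p hp }

theorem extends_addPiece (q : PartialIso M N) (ε : Bool) (z : M.P ε) (z' : N.P ε) (hz) :
    q.Extends (q.addPiece ε z z' hz) := by
  refine .of_le subset_rfl (fun δ => ?_) le_rfl
  by_cases hδ : δ = ε
  · subst hδ
    simp only [addPiece, Function.update_self]
    exact le_sup_left.trans (le_divClosure _)
  · simp only [addPiece, Function.update_of_ne hδ]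
    exact le_rfl

theorem mem_addPiece (q : PartialIso M N) (ε : Bool) (z : M.P ε) (z' : N.P ε) (hz) :
    (z, z') ∈ (q.addPiece ε z z' hz).g ε := by
  simp only [addPiece, Function.update_self]
  exact le_divClosure _ (Submodule.mem_sup_right (Submodule.mem_span_singleton_self _))

/-- Adding a pair of elements of `C`. -/
noncomputable def addC (q : PartialIso M N) (z : M.C) (z' : N.C)
    (hz : ∀ p ∈ q.gC, ∀ r : TwistedPolynomial φ, p.1 + z <• r = 0 ↔ p.2 + z' <• r = 0) :
    PartialIso M N :=
  { q with
    gC := q.gC ⊔ Submodule.span _ {(z, z')}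
    gC_zero := fun p hp => by
      obtain ⟨s, hs, r, rfl⟩ := mem_sup_span_iff.1 hp
      exact hz s hs r }

theorem extends_addC (q : PartialIso M N) (z : M.C) (z' : N.C) (hz) :
    q.Extends (q.addC z z' hz) := .of_le subset_rfl (fun _ => le_rfl) le_sup_left

theorem mem_addC (q : PartialIso M N) (z : M.C) (z' : N.C) (hz) :
    (z, z') ∈ (q.addC z z' hz).gC :=
  Submodule.mem_sup_right (Submodule.mem_span_singleton_self _)

end PartialIso

end SplitModel

end PartialIsomorphisms

/-! ### Extending a partial isomorphism by one value or one element. -/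

section ExtensionSteps

open FirstOrder TwistedPolynomial Filter

universe u w

namespace SplitModel

variable {K : Type u} [Field K] {φ : K →+* K} {h : Bool → TwistedPolynomial φ → ℕ}
  {M N : SplitModel.{u, w} φ h}

/-- Finitely many corresponding pairs of values cut the value sets at the same places. -/
theorem exists_defPair_cut {ρ : Set (M.Δ × N.Δ)} (t : Finset (M.Δ × N.Δ)) (ht : ∀ p ∈ t, p ∈ ρ)
    (γ : M.Δ) : ∃ s s', DefPair LV ρ s s' ∧ γ ∈ s ∧
      ∀ γ' ∈ s', ∀ p ∈ t, (p.1 < γ ↔ p.2 < γ') ∧ (γ < p.1 ↔ γ' < p.2) := by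
  classical
  have key : ∀ p ∈ ρ, ∃ s s', DefPair LV ρ s s' ∧ γ ∈ s ∧
      ∀ γ' ∈ s', (p.1 < γ ↔ p.2 < γ') ∧ (γ < p.1 ↔ γ' < p.2) := by
    rintro ⟨a, b⟩ hab
    rcases lt_trichotomy a γ with h1 | h1 | h1
    · exact ⟨_, _, defPair_gt hab, h1, fun γ' (hγ' : b < γ') =>
        ⟨iff_of_true h1 hγ', iff_of_false h1.not_gt hγ'.not_gt⟩⟩
    · exact ⟨_, _, defPair_eq hab, h1.symm, fun γ' (hγ' : γ' = b) =>
        ⟨iff_of_false h1.not_lt hγ'.symm.not_lt, iff_of_false h1.symm.not_lt hγ'.not_lt⟩⟩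
    · exact ⟨_, _, defPair_lt hab, h1, fun γ' (hγ' : γ' < b) =>
        ⟨iff_of_false h1.not_gt hγ'.not_gt, iff_of_true h1 hγ'⟩⟩
  have key' : ∀ p, ∃ s s', p ∈ t → DefPair LV ρ s s' ∧ γ ∈ s ∧
      ∀ γ' ∈ s', (p.1 < γ ↔ p.2 < γ') ∧ (γ < p.1 ↔ γ' < p.2) := by
    intro p
    by_cases hp : p ∈ t
    · obtain ⟨s, s', H⟩ := key p (ht p hp)
      exact ⟨s, s', fun _ => H⟩
    · exact ⟨∅, ∅, fun h => absurd h hp⟩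
  choose s s' H using key'
  refine ⟨⋂ p ∈ t, s p, ⋂ p ∈ t, s' p, .iInter t fun p hp => (H p hp).1,
    Set.mem_iInter₂.2 fun p hp => (H p hp).2.1, fun γ' hγ' p hp => ?_⟩
  exact (H p hp).2.2 γ' (Set.mem_iInter₂.1 hγ' p hp)

namespace PartialIso

/-- The parameters on the side of the ultrapower are diagonal germs. By Łoś's theorem, `t` is
governed by the set defined by the same formula in `N` from the original parameters. -/
theorem exists_defPair_of_push {q : PartialIso M N} {I : Type w} {U : Ultrafilter I}
    {s : Set M.Δ} {t : Set (N.ultrapower U).Δ} (hst : DefPair LV (q.push U).ρ s t) :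
    ∃ s', DefPair LV q.ρ s s' ∧
      ∀ f : I → N.Δ, (∀ᶠ i in (U : Filter I), f i ∈ s') → N.valueGerm U f ∈ t := by
  obtain ⟨k, p, hp, ψ, h1, h2⟩ := hst
  choose b hb hb' using hp
  refine ⟨{x | ψ.Realize (Sum.elim b fun _ => x)}, ⟨k, fun i => ((p i).1, b i), hb, ψ, h1,
    fun _ => Iff.rfl⟩, fun f hf => ?_⟩
  rw [h2]
  have := (realize_valueGerm (N := N) (U := U) ψ (Sum.elim (fun i _ => b i) fun _ => f)).2
    (hf.mono fun i hi => by
      convert! Set.mem_ofPred_eq ▸ hi using 1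
      ext j; rcases j with j | j <;> rfl)
  convert! this using 1
  ext j; rcases j with j | j
  · exact hb' j
  · rfl

/-- A value may be added to the domain of a partial isomorphism. -/
theorem exists_extends_value (q : PartialIso M N) (a : M.Δ) :
    ∃ (N' : SplitModel.{u, w} φ h) (q' : PartialIso M N'), q.Extends q' ∧ ∃ b, (a, b) ∈ q'.ρ := by
  classical
  obtain ⟨I, U, hU⟩ := exists_ultrafilter_realizing N.Δ
  -- The transported type of `a`: finite parts are satisfiable because `ρ` is elementary, and the
  -- ultrapower realizes the whole.
  obtain ⟨f, hf⟩ := hU {s' | ∃ s, DefPair LV q.ρ s s' ∧ a ∈ s} (by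
    intro t ht
    have : ∀ s', ∃ s, s' ∈ t → DefPair LV q.ρ s s' ∧ a ∈ s := fun s' => by
      by_cases hs : s' ∈ t
      · obtain ⟨s, H⟩ := ht hs
        exact ⟨s, fun _ => H⟩
      · exact ⟨∅, fun h => absurd h hs⟩
    choose s hs using this
    obtain ⟨x, hx⟩ := (DefPair.iInter t fun s' hs' => (hs s' hs').1).nonempty q.elementary
      ⟨a, Set.mem_iInter₂.2 fun s' hs' => (hs s' hs').2⟩
    exact ⟨x, fun s' hs' => Set.mem_iInter₂.1 hx s' hs'⟩)
  refine ⟨_, (q.push U).addValue a (N.valueGerm U f) ?_,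
    (q.extends_push U).trans (extends_addValue _ _ _ _), _, mem_addValue _ _ _ _⟩
  intro s t hst ha
  obtain ⟨s', hs', H⟩ := exists_defPair_of_push hst
  exact H f (hf s' ⟨s, hs', ha⟩)

theorem v_sub_mem (q : PartialIso M N) {ε : Bool} {p p' : M.P ε × N.P ε} (hp : p ∈ q.g ε)
    (hp' : p' ∈ q.g ε) : (M.v ε (p.1 - p'.1), N.v ε (p.2 - p'.2)) ∈ q.ρ :=
  q.g_val ε _ ((q.g ε).sub_mem hp hp')

/-- When `0` is a best approximation of `z`, this computes all distances to the domain from `v z`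
and the values of the domain. -/
theorem v_add_eq_min {ε : Bool} {x z : M.P ε} (hle : M.v ε (x + z) ≤ M.v ε z) :
    M.v ε (x + z) = min (M.v ε x) (M.v ε z) := by
  rcases lt_or_ge (M.v ε x) (M.v ε z) with hlt | hge
  · rw [v_add_eq_of_lt hlt, min_eq_left hlt.le]
  · rw [min_eq_right hge]
    refine le_antisymm hle ?_
    simpa [min_eq_right hge] using min_le_v_add x z

theorem lt_v_sub {ε : Bool} {x y : M.P ε} {γ : M.Δ} (hx : γ < M.v ε x) (hy : γ < M.v ε y) :
    γ < M.v ε (x - y) := (lt_min hx hy).trans_le (M.min_le_v_sub ε x y)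

/-- The counting argument for adding an element `z` of `P ε` which cannot be approximated better
than by `0`: finitely many conditions on its image can be met. -/
theorem exists_image_of_maximal (q : PartialIso M N) {ε : Bool} {z : M.P ε} (hz0 : z ≠ 0)
    (hz : ∀ p ∈ q.g ε, M.v ε (p.1 + z) ≤ M.v ε z) {s : Set M.Δ} {s' : Set N.Δ}
    (hs : DefPair LV q.ρ s s') (hzs : M.v ε z ∈ s) (T : Finset (M.P ε × N.P ε))
    (hT : ∀ p ∈ T, p ∈ q.g ε) :
    ∃ z', N.v ε z' ∈ s' ∧ ∀ p ∈ T, N.v ε (p.2 + z') ≤ N.v ε z' := by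
  classical
  -- With `0` in `T`, the values of the elements of `T` are among the distances between elements of
  -- `T`.
  wlog h0T : (0 : M.P ε × N.P ε) ∈ T generalizing T
  · obtain ⟨z', h1, h2⟩ := this (insert 0 T) (fun p hp => by
      rcases Finset.mem_insert.1 hp with rfl | hp
      · exact (q.g ε).zero_mem
      · exact hT p hp) (Finset.mem_insert_self _ _)
    exact ⟨z', h1, fun p hp => h2 p (Finset.mem_insert_of_mem hp)⟩
  set γ := M.v ε z with hγ
  -- `Q S` says that the elements of `S` have value at least `γ` and lie in distinct classes modulo
  -- elements of value `> γ`. `S` is taken of greatest cardinality in `T`.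
  set Q : Finset (M.P ε × N.P ε) → Prop := fun S =>
    (∀ p ∈ S, γ ≤ M.v ε p.1) ∧ ∀ p ∈ S, ∀ p' ∈ S, p ≠ p' → M.v ε (p.1 - p'.1) ≤ γ with hQ
  obtain ⟨S, hS, hSmax⟩ := (T.powerset.filter Q).exists_max_image Finset.card
    ⟨∅, Finset.mem_filter.2 ⟨Finset.empty_mem_powerset T, by simp [hQ]⟩⟩
  obtain ⟨hST, hS1, hS2⟩ := Finset.mem_filter.1 hS
  rw [Finset.mem_powerset] at hST
  -- By `hz`, the class of `-z` is different from all classes of elements of `S`.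
  have hRn : M.Rn (S.card + 1) γ := by
    refine (M.Rn_iff ε _ γ (M.v_dom ε z hz0)).2
      ⟨Fin.cons (-z) fun i => (S.equivFin.symm i).1.1, ?_, ?_⟩
    · refine Fin.cases ?_ fun i => ?_
      · simp [v_neg, hγ]
      · simpa using hS1 _ (S.equivFin.symm i).2
    · refine Fin.cases ?_ fun i => ?_
      · refine Fin.cases (by simp) fun j _ => ?_
        rw [v_sub_comm]
        simpa using hz _ (hT _ (hST (S.equivFin.symm j).2))
      · refine Fin.cases (fun _ => ?_) fun j hij => ?_
        · simpa using hz _ (hT _ (hST (S.equivFin.symm i).2))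
        · simp only [Fin.cons_succ]
          refine hS2 _ (S.equivFin.symm i).2 _ (S.equivFin.symm j).2 fun he => hij ?_
          rw [S.equivFin.symm.injective (Subtype.ext he)]
  obtain ⟨c, c', hc, hγc, hc'⟩ := exists_defPair_cut
    (ρ := q.ρ) ((T ×ˢ T).image fun x => (M.v ε (x.1.1 - x.2.1), N.v ε (x.1.2 - x.2.2))) (by
      intro p hp
      obtain ⟨x, hx, rfl⟩ := Finset.mem_image.1 hp
      rw [Finset.mem_product] at hx
      exact q.v_sub_mem (hT _ hx.1) (hT _ hx.2)) γ
  -- `γ'` lies in `s'`, has at least `S.card + 1` residue classes, is on the same side of `θ` as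
  -- `γ`, and is placed like `γ` among the distances in `T`.
  obtain ⟨γ', ⟨⟨h1, h2⟩, h3⟩, h4⟩ :=
    (((hs.inter (defPair_Rn (S.card + 1))).inter (defPair_dom ε)).inter hc).nonempty
      q.elementary ⟨γ, ⟨⟨hzs, hRn⟩, M.v_dom ε z hz0⟩, hγc⟩
  have hcut : ∀ p ∈ T, ∀ p' ∈ T, (M.v ε (p.1 - p'.1) < γ ↔ N.v ε (p.2 - p'.2) < γ') ∧
      (γ < M.v ε (p.1 - p'.1) ↔ γ' < N.v ε (p.2 - p'.2)) := fun p hp p' hp' =>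
    hc' γ' h4 _ (Finset.mem_image.2 ⟨(p, p'), Finset.mem_product.2 ⟨hp, hp'⟩, rfl⟩)
  have hcut0 : ∀ p ∈ T, (M.v ε p.1 < γ ↔ N.v ε p.2 < γ') := fun p hp => by
    simpa using (hcut p hp 0 h0T).1
  obtain ⟨e, he1, he2⟩ := (N.Rn_iff ε _ γ' h3).1 h2
  -- Pigeonhole: among `S.card + 1` distinct classes, one contains no image of an element of `S`.
  obtain ⟨l, hl⟩ : ∃ l, ∀ p ∈ S, N.v ε (p.2 - e l) ≤ γ' := by
    by_contra! hcon
    choose p hpS hp using hcon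
    obtain ⟨l, l', hne, hll⟩ := Fintype.exists_ne_map_eq_of_card_lt
      (fun l => (⟨p l, hpS l⟩ : S)) (by simp)
    have hll' : p l = p l' := congrArg Subtype.val hll
    have := lt_v_sub (hp l') (hll' ▸ hp l)
    rw [sub_sub_sub_cancel_left] at this
    exact absurd this (not_lt.2 (he2 l l' hne))
  -- By maximality of `S`, an element of `T` of value at least `γ` shares its class with some `p'`
  -- in `S`. The images then share a class too, and it is not that of `e l`.
  have hge : ∀ p ∈ T, γ ≤ M.v ε p.1 → N.v ε (p.2 + -e l) ≤ γ' := by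
    intro p hp hγp
    rw [← sub_eq_add_neg]
    by_cases hpS : p ∈ S
    · exact hl p hpS
    · obtain ⟨p', hp', hlt⟩ : ∃ p' ∈ S, γ < M.v ε (p.1 - p'.1) := by
        by_contra! hcon
        have := hSmax (insert p S) (Finset.mem_filter.2
          ⟨Finset.mem_powerset.2 (Finset.insert_subset hp hST), ?_, ?_⟩)
        · rw [Finset.card_insert_of_notMem hpS] at this
          omega
        · intro x hx
          rcases Finset.mem_insert.1 hx with rfl | hx
          · exact hγp
          · exact hS1 x hx
        · intro x hx y hy hxy
          rcases Finset.mem_insert.1 hx with rfl | hxS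
          · rcases Finset.mem_insert.1 hy with rfl | hyS
            · exact absurd rfl hxy
            · exact hcon y hyS
          · rcases Finset.mem_insert.1 hy with rfl | hyS
            · rw [v_sub_comm]; exact hcon x hxS
            · exact hS2 x hxS y hyS hxy
      rw [(hcut p hp p' (hST hp')).2] at hlt
      by_contra! hlt'
      have := lt_v_sub hlt' hlt
      rw [sub_sub_sub_cancel_left] at this
      exact absurd this (not_lt.2 (hl p' hp'))
  have hvz : N.v ε (-e l) = γ' := by
    refine le_antisymm ?_ ?_
    · simpa using hge 0 h0T (by simp [v_zero])
    · rw [v_neg]; exact he1 l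
  refine ⟨-e l, by rwa [hvz], fun p hp => ?_⟩
  rw [hvz]
  by_cases hγp : γ ≤ M.v ε p.1
  · exact hge p hp hγp
  · have := (hcut0 p hp).1 (not_le.1 hγp)
    rw [v_add_eq_of_lt (by rwa [hvz])]
    exact this.le

/-- The inclusion of `P ε`. -/
def incl (M : SplitModel.{u, w} φ h) : (ε : Bool) → M.P ε → M.Carrier
  | false => fun x => (x, 0, 0)
  | true => fun x => (0, 0, x)

/-- The inclusion of `C`. -/
def inclC (M : SplitModel.{u, w} φ h) (x : M.C) : M.Carrier := (0, x, 0)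

theorem incl_mem_dom {q : PartialIso M N} {ε : Bool} {x : M.P ε} :
    incl M ε x ∈ q.dom ↔ ∃ y, (x, y) ∈ q.g ε := by
  cases ε
  · exact ⟨fun ⟨y, hy⟩ => ⟨_, hy.1⟩, fun ⟨y, hy⟩ =>
      ⟨(y, 0, 0), hy, q.gC.zero_mem, (q.g true).zero_mem⟩⟩
  · exact ⟨fun ⟨y, hy⟩ => ⟨_, hy.2.2⟩, fun ⟨y, hy⟩ =>
      ⟨(0, 0, y), (q.g false).zero_mem, q.gC.zero_mem, hy⟩⟩

theorem inclC_mem_dom {q : PartialIso M N} {x : M.C} :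
    inclC M x ∈ q.dom ↔ ∃ y, (x, y) ∈ q.gC :=
  ⟨fun ⟨_, hy⟩ => ⟨_, hy.2.1⟩, fun ⟨y, hy⟩ =>
    ⟨(0, y, 0), (q.g false).zero_mem, hy, (q.g true).zero_mem⟩⟩

/-- Here `v (p + z) = min (v p) (v z)` throughout. It suffices that the image `z'` has a value of
the type of `v z` and that `0` is again a best approximation; finitely many of these conditions are
met by counting residue classes. -/
theorem exists_extends_of_maximal (q : PartialIso M N) {ε : Bool} {z : M.P ε} (hz0 : z ≠ 0)
    (hz : ∀ p ∈ q.g ε, M.v ε (p.1 + z) ≤ M.v ε z) :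
    ∃ (N' : SplitModel.{u, w} φ h) (q' : PartialIso M N'), q.Extends q' ∧ incl M ε z ∈ q'.dom := by
  classical
  obtain ⟨I, U, hU⟩ := exists_ultrafilter_realizing (N.P ε)
  obtain ⟨f, hf⟩ := hU ({t | ∃ s s', DefPair LV q.ρ s s' ∧ M.v ε z ∈ s ∧ t = {y | N.v ε y ∈ s'}} ∪
      {t | ∃ p ∈ q.g ε, t = {y | N.v ε (p.2 + y) ≤ N.v ε y}}) (by
    intro t ht
    have key : ∀ x, ∃ s s' p, x ∈ t → DefPair LV q.ρ s s' ∧ M.v ε z ∈ s ∧ p ∈ q.g ε ∧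
        ∀ y, N.v ε y ∈ s' → N.v ε (p.2 + y) ≤ N.v ε y → y ∈ x := by
      intro x
      by_cases hx : x ∈ t
      · rcases ht hx with ⟨s, s', h1, h2, rfl⟩ | ⟨p, hp, rfl⟩
        · exact ⟨s, s', 0, fun _ => ⟨h1, h2, (q.g ε).zero_mem, fun y hy _ => hy⟩⟩
        · exact ⟨_, _, p, fun _ => ⟨.univ, Set.mem_univ _, hp, fun y _ hy => hy⟩⟩
      · exact ⟨∅, ∅, 0, fun h => absurd h hx⟩
    choose s s' p H using key
    obtain ⟨y, hy, hy'⟩ := q.exists_image_of_maximal hz0 hz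
      (DefPair.iInter t fun x hx => (H x hx).1)
      (Set.mem_iInter₂.2 fun x hx => (H x hx).2.1) (t.image p) (by
        intro x hx
        obtain ⟨y, hy, rfl⟩ := Finset.mem_image.1 hx
        exact (H y hy).2.2.1)
    exact ⟨y, fun x hx => (H x hx).2.2.2 y (Set.mem_iInter₂.1 hy x hx)
      (hy' _ (Finset.mem_image_of_mem p hx))⟩)
  set z' := N.pieceGerm U ε f with hz'
  set b := N.valueGerm U fun i => N.v ε (f i) with hb
  have htype : ∀ s t, DefPair LV (q.push U).ρ s t → M.v ε z ∈ s → b ∈ t := by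
    intro s t hst ha
    obtain ⟨s', hs', H⟩ := exists_defPair_of_push hst
    exact H _ (hf _ (Or.inl ⟨s, s', hs', ha, rfl⟩))
  set q₁ := (q.push U).addValue (M.v ε z) b htype with hq₁
  have hq₁e : (q.push U).Extends q₁ := extends_addValue _ _ _ _
  have hmem : (M.v ε z, b) ∈ q₁.ρ := mem_addValue _ _ _ _
  refine ⟨_, q₁.addPiece ε z z' ?_, ((q.extends_push U).trans hq₁e).trans (extends_addPiece _ _ _ _ _),
    incl_mem_dom.2 ⟨z', mem_addPiece _ _ _ _ _⟩⟩
  intro p hp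
  have hp' : p ∈ (q.push U).g ε := hp
  obtain ⟨y, hy, hpy⟩ := mem_push_g.1 hp'
  have hv1 : M.v ε (p.1 + z) = min (M.v ε p.1) (M.v ε z) := v_add_eq_min (hz _ hy)
  have hv2 : (N.ultrapower U).v ε (p.2 + z') = min ((N.ultrapower U).v ε p.2) b := by
    refine v_add_eq_min ?_
    rw [hpy]
    exact valueGerm_le.2 (hf _ (Or.inr ⟨_, hy, rfl⟩))
  rw [hv1, hv2]
  have hpv := q₁.g_val ε p hp
  rcases lt_or_ge (M.v ε p.1) (M.v ε z) with hlt | hge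
  · rw [min_eq_left hlt.le, min_eq_left ((lt_iff_of_mem q₁.elementary hpv hmem).1 hlt).le]
    exact hpv
  · rw [min_eq_right hge, min_eq_right
      (not_lt.1 (mt (lt_iff_of_mem q₁.elementary hpv hmem).2 (not_lt.2 hge)))]
    exact hmem

/-- Here `-z` behaves as a limit of a pseudo-Cauchy family without best approximation. If `p'`
approximates it better than `p`, then `v (p + z) = v (p - p')`. The conditions on the image thus
involve only values already in `ρ`, and no value has to be added. -/
theorem exists_extends_of_not_maximal (q : PartialIso M N) {ε : Bool} {z : M.P ε}
    (hz : ∀ p ∈ q.g ε, ∃ p' ∈ q.g ε, M.v ε (p.1 + z) < M.v ε (p'.1 + z)) :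
    ∃ (N' : SplitModel.{u, w} φ h) (q' : PartialIso M N'), q.Extends q' ∧ incl M ε z ∈ q'.dom := by
  classical
  have hdiff : ∀ p p' : M.P ε × N.P ε, M.v ε (p.1 + z) < M.v ε (p'.1 + z) →
      M.v ε (p.1 - p'.1) = M.v ε (p.1 + z) := fun p p' hlt => by
    rw [← v_sub_eq_left hlt, add_sub_add_right_eq_sub]
  obtain ⟨I, U, hU⟩ := exists_ultrafilter_realizing (N.P ε)
  obtain ⟨f, hf⟩ := hU {t | ∃ p ∈ q.g ε, ∃ p' ∈ q.g ε, M.v ε (p.1 + z) < M.v ε (p'.1 + z) ∧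
      t = {y | N.v ε (p.2 + y) = N.v ε (p.2 - p'.2)}} (by
    intro t ht
    rcases t.eq_empty_or_nonempty with rfl | hne
    · exact ⟨0, by simp⟩
    have key : ∀ x, ∃ p p', x ∈ t → p ∈ q.g ε ∧ p' ∈ q.g ε ∧
        M.v ε (p.1 + z) < M.v ε (p'.1 + z) ∧ x = {y | N.v ε (p.2 + y) = N.v ε (p.2 - p'.2)} := by
      intro x
      by_cases hx : x ∈ t
      · obtain ⟨p, hp, p', hp', H⟩ := ht hx
        exact ⟨p, p', fun _ => ⟨hp, hp', H⟩⟩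
      · exact ⟨0, 0, fun h => absurd h hx⟩
    choose p p' H using key
    obtain ⟨m, hm, hmax⟩ := t.exists_max_image (fun x => M.v ε ((p' x).1 + z)) hne
    -- The best of the finitely many approximations `p'` satisfies all the finitely many conditions.
    refine ⟨-(p' m).2, fun x hx => ?_⟩
    obtain ⟨h1, h2, h3, h4⟩ := H x hx
    rw [h4]
    change N.v ε ((p x).2 + -(p' m).2) = N.v ε ((p x).2 - (p' x).2)
    rw [← sub_eq_add_neg]
    refine (eq_iff_of_mem q.elementary (q.v_sub_mem h1 (H m hm).2.1) (q.v_sub_mem h1 h2)).1 ?_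
    rw [hdiff _ _ h3, hdiff _ _ (h3.trans_le (hmax x hx))])
  refine ⟨_, (q.push U).addPiece ε z (N.pieceGerm U ε f) ?_,
    (q.extends_push U).trans (extends_addPiece _ _ _ _ _),
    incl_mem_dom.2 ⟨_, mem_addPiece _ _ _ _ _⟩⟩
  intro p hp
  obtain ⟨y, hy, hpy⟩ := mem_push_g.1 hp
  obtain ⟨p', hp', hlt⟩ := hz _ hy
  refine ⟨N.v ε (y - p'.2), ?_, ?_⟩
  · have := q.v_sub_mem hy hp'
    rwa [hdiff _ _ hlt] at this
  · change (N.ultrapower U).v ε (p.2 + N.pieceGerm U ε f) = _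
    rw [hpy]
    exact valueGerm_eq.2 (hf _ ⟨_, hy, _, hp', hlt, rfl⟩)

theorem add_mem_dom {q : PartialIso M N} {x y : M.Carrier} (hx : x ∈ q.dom) (hy : y ∈ q.dom) :
    x + y ∈ q.dom := by
  obtain ⟨x', hx⟩ := hx
  obtain ⟨y', hy⟩ := hy
  exact ⟨_, hx.add hy⟩

/-- An element of `P ε` may be added to the domain of a partial isomorphism. -/
theorem exists_extends_piece (q : PartialIso M N) (ε : Bool) (z : M.P ε) :
    ∃ (N' : SplitModel.{u, w} φ h) (q' : PartialIso M N'), q.Extends q' ∧ incl M ε z ∈ q'.dom := by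
  -- If a best approximation `p` exists, translating `z` by it makes `0` best, and it is enough to
  -- adjoin `p.1 + z`.
  by_cases hmax : ∃ p ∈ q.g ε, ∀ p' ∈ q.g ε, M.v ε (p'.1 + z) ≤ M.v ε (p.1 + z)
  · obtain ⟨p, hp, hmax⟩ := hmax
    by_cases h0 : p.1 + z = 0
    · refine ⟨N, q, .refl q, incl_mem_dom.2 ⟨-p.2, ?_⟩⟩
      rw [← neg_eq_of_add_eq_zero_right h0]
      exact (q.g ε).neg_mem hp
    · obtain ⟨N', q', hq', hdom⟩ := q.exists_extends_of_maximal h0 (fun p' hp' => by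
        rw [← add_assoc]
        exact hmax _ ((q.g ε).add_mem hp' hp))
      refine ⟨N', q', hq', ?_⟩
      obtain ⟨y, hy⟩ := incl_mem_dom.1 hdom
      obtain ⟨y', hy'⟩ := incl_mem_dom.1 (hq'.dom_subset (incl_mem_dom.2 ⟨p.2, hp⟩))
      refine incl_mem_dom.2 ⟨y - y', ?_⟩
      have := (q'.g ε).sub_mem hy hy'
      rwa [Prod.mk_sub_mk, add_sub_cancel_left] at this
  · push Not at hmax
    exact q.exists_extends_of_not_maximal hmax

theorem gC_eq {q : PartialIso M N} {x x' : M.C} {y y' : N.C} (hp : (x, y) ∈ q.gC)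
    (hp' : (x', y') ∈ q.gC) : x = x' ↔ y = y' := by
  rw [← sub_eq_zero, ← sub_eq_zero (a := y)]
  exact q.gC_zero _ (q.gC.sub_mem hp hp')

theorem gC_act {q : PartialIso M N} {x : M.C} {y : N.C} (hp : (x, y) ∈ q.gC)
    (r : TwistedPolynomial φ) : (x <• r, y <• r) ∈ q.gC := q.gC.smul_mem _ hp

/-- The step for an element of `C` which is annihilated, modulo the domain, by a maximal right
ideal. -/
theorem exists_extends_of_simple (q : PartialIso M N) {z : M.C} {r₀ : TwistedPolynomial φ}
    (hr₀ : r₀ ≠ 0) {x₀ : N.C} (hx₀ : (z <• r₀, x₀) ∈ q.gC) (hz : ∀ y, (z, y) ∉ q.gC)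
    (hJ : ∀ s y, (z <• s, y) ∈ q.gC → ∃ c, s = r₀ * c)
    (hmax : ∀ s, (¬ ∃ c, s = r₀ * c) → ∃ c d, 1 = r₀ * c + s * d) :
    ∃ (N' : SplitModel.{u, w} φ h) (q' : PartialIso M N'), q.Extends q' ∧ inclC M z ∈ q'.dom := by
  classical
  obtain ⟨I, U, hU⟩ := exists_ultrafilter_realizing N.C
  obtain ⟨f, hf⟩ := hU (insert {y | y <• r₀ = x₀} {t | ∃ p ∈ q.gC, t = {y | y ≠ p.2}}) (by
    intro t ht
    by_contra! hcon
    set sol : Set N.C := {y | y <• r₀ = x₀} with hsol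
    -- If finitely many conditions cannot be met, every solution of `y.r₀ = x₀` is excluded by one
    -- of them. So the solutions are finite in number and all lie in the range of the graph.
    have hrange : ∀ y ∈ sol, ∃ x, (x, y) ∈ q.gC ∧ {y' | y' ≠ y} ∈ t := by
      intro y hy
      obtain ⟨s, hst, hys⟩ := hcon y
      rcases ht hst with rfl | ⟨p, hp, rfl⟩
      · exact absurd hy hys
      · obtain rfl : y = p.2 := not_not.1 hys
        exact ⟨p.1, hp, hst⟩
    have hfin : sol.Finite := by
      refine Set.Finite.of_finite_image (f := fun y => {y' : N.C | y' ≠ y})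
        (t.finite_toSet.subset ?_) ?_
      · rintro _ ⟨y, hy, rfl⟩
        obtain ⟨x, -, h⟩ := hrange y hy
        exact h
      · intro y _ y' _ hyy
        by_contra hne
        have h1 : y ∈ {a : N.C | a ≠ y'} := hne
        rw [← show {a : N.C | a ≠ y} = {a : N.C | a ≠ y'} from hyy] at h1
        exact h1 rfl
    have := hfin.fintype
    choose g hg _ using hrange
    -- The differences between `z` and the preimages of the solutions, together with `0`, are `card
    -- sol + 1` elements killed by `r₀`. Then `N.C` has as many, and adding them to one solution
    -- gives too many solutions.
    obtain ⟨e', he', her'⟩ := (q.ann_iff r₀ hr₀ (Fintype.card sol + 1)).1 (by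
      have e := Fintype.equivFin sol
      refine ⟨Fin.cons 0 fun i => g _ (e.symm i).2 - z, ?_, ?_⟩
      · rw [Fin.cons_injective_iff]
        constructor
        · rintro ⟨i, hi⟩
          have h1 := hg _ (e.symm i).2
          rw [sub_eq_zero.1 hi] at h1
          exact hz _ h1
        · intro i j hij
          have h1 := hg _ (e.symm i).2
          rw [sub_left_injective hij] at h1
          exact e.symm.injective (Subtype.ext ((gC_eq h1 (hg _ (e.symm j).2)).1 rfl))
      · refine Fin.cases (by simp) fun i => ?_
        have h1 := gC_act (hg _ (e.symm i).2) r₀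
        rw [show (e.symm i).1 <• r₀ = x₀ from (e.symm i).2] at h1
        simp only [Fin.cons_succ, smul_sub, sub_eq_zero]
        exact (gC_eq h1 hx₀).2 rfl)
    obtain ⟨y₀, hy₀⟩ := N.divisibleC r₀ hr₀ x₀
    have hinj : Function.Injective fun i => (⟨y₀ + e' i, by
        change (y₀ + e' i) <• r₀ = x₀
        rw [smul_add, her', add_zero, hy₀]⟩ : sol) := fun i j hij =>
      he' (add_left_cancel (congrArg Subtype.val hij))
    have := Fintype.card_le_of_injective _ hinj
    simp at this)
  set z' := N.germC U f with hz'
  have h1 : (z <• r₀, z' <• r₀) ∈ (q.push U).gC :=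
    mem_push_gC.2 ⟨x₀, hx₀, germC_eq.2 (hf _ (Set.mem_insert _ _))⟩
  have h2 : ∀ x, (x, z') ∉ (q.push U).gC := by
    intro x hx
    obtain ⟨y, hy, hzy⟩ := mem_push_gC.1 hx
    obtain ⟨i, hi, hi'⟩ := ((germC_eq.1 hzy).and (hf _ (Or.inr ⟨_, hy, rfl⟩))).exists
    exact hi' hi
  refine ⟨_, (q.push U).addC z z' ?_, (q.extends_push U).trans (extends_addC _ _ _ _),
    inclC_mem_dom.2 ⟨_, mem_addC _ _ _ _⟩⟩
  intro p hp r
  by_cases hr : ∃ c, r = r₀ * c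
  · obtain ⟨c, rfl⟩ := hr
    rw [act_mul, act_mul]
    exact (q.push U).gC_zero _ ((q.push U).gC.add_mem hp (gC_act h1 c))
  -- For `r` outside `r₀ R` neither side can vanish: on the left by `hJ`; on the right because `1 ∈
  -- r₀ R + r R` would put `z'` in the range.
  · refine iff_of_false (fun h0 => ?_) (fun h0 => ?_)
    · obtain ⟨y, hy, -⟩ := mem_push_gC.1 hp
      refine hr (hJ r (-y) ?_)
      rw [← neg_eq_of_add_eq_zero_right h0]
      exact q.gC.neg_mem hy
    · obtain ⟨c, d, hcd⟩ := hmax r hr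
      refine h2 ((z <• r₀) <• c - p.1 <• d) ?_
      have h3 := (q.push U).gC.sub_mem (gC_act h1 c) (gC_act hp d)
      convert h3 using 1
      refine Prod.ext rfl ?_
      change z' = (z' <• r₀) <• c - p.2 <• d
      rw [← act_mul, eq_sub_iff_add_eq, ← neg_eq_of_add_eq_zero_left h0]
      nth_rewrite 1 [← act_one (φ := φ) z', hcd]
      rw [act_add, act_mul z' r d, smul_neg, add_neg_cancel_right]

/-- The step for an element of `C` which is free modulo the domain. -/
theorem exists_extends_of_free (q : PartialIso M N) {z : M.C}
    (hz : ∀ r : TwistedPolynomial φ, r ≠ 0 → ∀ y, (z <• r, y) ∉ q.gC) :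
    ∃ (N' : SplitModel.{u, w} φ h) (q' : PartialIso M N'), q.Extends q' ∧ inclC M z ∈ q'.dom := by
  classical
  have hz0 : z ≠ 0 := by
    rintro rfl
    refine hz 1 one_ne_zero 0 ?_
    rw [act_one]
    exact q.gC.zero_mem
  have : Nontrivial N.C := q.nontrivial_iff.1 ⟨z, 0, hz0⟩
  have : Infinite N.C := N.divisibleC.infinite
  obtain ⟨I, U, hU⟩ := exists_ultrafilter_realizing N.C
  obtain ⟨f, hf⟩ := hU {t | ∃ r : TwistedPolynomial φ, r ≠ 0 ∧ ∃ x : N.C, t = {y | y <• r ≠ x}} (by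
    intro t ht
    have key : ∀ s, ∃ (r : TwistedPolynomial φ) (x : N.C),
        s ∈ t → r ≠ 0 ∧ s = {y | y <• r ≠ x} := by
      intro s
      by_cases hs : s ∈ t
      · obtain ⟨r, hr, x, hx⟩ := ht hs
        exact ⟨r, x, fun _ => ⟨hr, hx⟩⟩
      · exact ⟨0, 0, fun h => absurd h hs⟩
    choose r x H using key
    -- If `m = r s * c s`, then `y.(r s) = x s` implies `y.m = (x s).(c s)`. It is enough that `y.m`
    -- avoids finitely many elements.
    obtain ⟨m, hm, hc⟩ := exists_common_multiple_finset t r fun s hs => (H s hs).1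
    have hc' : ∀ s, ∃ c, s ∈ t → m = r s * c := fun s => by
      by_cases hs : s ∈ t
      · obtain ⟨c, h⟩ := hc s hs
        exact ⟨c, fun _ => h⟩
      · exact ⟨0, fun h => absurd h hs⟩
    choose c hc using hc'
    obtain ⟨e, he⟩ := Infinite.exists_notMem_finset (t.image fun s => x s <• c s)
    obtain ⟨y, hy⟩ := N.divisibleC m hm e
    refine ⟨y, fun s hs => ?_⟩
    rw [(H s hs).2]
    intro h0
    refine he (Finset.mem_image.2 ⟨s, hs, ?_⟩)
    rw [← hy, hc s hs, act_mul]
    exact congrArg (· <• c s) (Eq.symm h0))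
  set z' := N.germC U f with hz'
  refine ⟨_, (q.push U).addC z z' ?_, (q.extends_push U).trans (extends_addC _ _ _ _),
    inclC_mem_dom.2 ⟨_, mem_addC _ _ _ _⟩⟩
  intro p hp r
  by_cases hr : r = 0
  · rw [hr, MulOpposite.op_zero, zero_smul, zero_smul, add_zero, add_zero]
    exact (q.push U).gC_zero _ hp
  obtain ⟨y, hy, hpy⟩ := mem_push_gC.1 hp
  refine iff_of_false (fun h0 => ?_) (fun h0 => ?_)
  · refine hz r hr (-y) ?_
    rw [← neg_eq_of_add_eq_zero_right h0]
    exact q.gC.neg_mem hy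
  · have h1 : N.germC U (fun i => f i <• r) = N.germC U fun _ => -y := by
      rw [hpy] at h0
      exact (neg_eq_of_add_eq_zero_right h0).symm
    obtain ⟨i, hi, hi'⟩ := ((germC_eq.1 h1).and (hf _ ⟨r, hr, -y, rfl⟩)).exists
    exact hi' hi

/-- Induction on the degree. The annihilator of `z` modulo the domain is `r₀ R`. If `r₀` is a
product of factors of smaller degree than the bound, two shorter extensions suffice; otherwise `r₀
R` is maximal and `exists_extends_of_simple` applies. The target is generalized since it changes in
between. -/
theorem exists_extends_of_algebraic (d : ℕ) : ∀ {N : SplitModel.{u, w} φ h} (q : PartialIso M N)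
    {z : M.C} {r : TwistedPolynomial φ}, r ≠ 0 → r.natDegree ≤ d → inclC M (z <• r) ∈ q.dom →
    ∃ (N' : SplitModel.{u, w} φ h) (q' : PartialIso M N'), q.Extends q' ∧ inclC M z ∈ q'.dom := by
  induction d using Nat.strong_induction_on with
  | _ d ih =>
    intro N q z r hr hrd hdom
    by_cases hzdom : inclC M z ∈ q.dom
    · exact ⟨N, q, .refl q, hzdom⟩
    have hgen : ∀ (J : AddSubgroup (TwistedPolynomial φ)), (∀ x ∈ J, ∀ r, x * r ∈ J) →
        r ∈ J → ∃ q ∈ J, q ≠ 0 ∧ ∀ x ∈ J, ∃ c, x = q * c :=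
      fun J hJ hrJ => exists_generator J hJ ⟨r, hrJ, hr⟩
    obtain ⟨r₀, hr₀J, hr₀, hJ⟩ := hgen
      { carrier := {s | inclC M (z <• s) ∈ q.dom}
        zero_mem' := ⟨0, by
          change q.Mem (0, z <• 0, 0) 0
          rw [MulOpposite.op_zero, zero_smul]
          exact .zero q⟩
        add_mem' := fun {a b} ha hb => by
          obtain ⟨x, hx⟩ := inclC_mem_dom.1 ha
          obtain ⟨y, hy⟩ := inclC_mem_dom.1 hb
          refine inclC_mem_dom.2 ⟨x + y, ?_⟩
          rw [act_add]
          exact q.gC.add_mem hx hy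
        neg_mem' := fun {a} ha => by
          obtain ⟨x, hx⟩ := inclC_mem_dom.1 ha
          refine inclC_mem_dom.2 ⟨-x, ?_⟩
          rw [MulOpposite.op_neg, neg_smul]
          exact q.gC.neg_mem hx }
      (fun s hs c => by
        obtain ⟨x, hx⟩ := inclC_mem_dom.1 hs
        refine inclC_mem_dom.2 ⟨x <• c, ?_⟩
        rw [act_mul]
        exact gC_act hx c) hdom
    have hJ' : ∀ s, inclC M (z <• s) ∈ q.dom → ∃ c, s = r₀ * c := hJ
    have hr₀J' : inclC M (z <• r₀) ∈ q.dom := hr₀J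
    have hdeg : r₀.natDegree ≤ d := by
      obtain ⟨c, rfl⟩ := hJ' r hdom
      rw [natDegree_mul hr₀ (right_ne_zero_of_mul hr)] at hrd
      omega
    by_cases hsplit : ∃ a b, r₀ = a * b ∧ a.natDegree < d ∧ b.natDegree < d
    · obtain ⟨a, b, rfl, ha, hb⟩ := hsplit
      rw [act_mul] at hr₀J'
      -- Since `z.(a * b) = (z.a).b`, the element `z.a` is adjoined with the help of `b`, then `z`
      -- with the help of `a`.
      obtain ⟨N₁, q₁, hq₁, h₁⟩ := ih _ hb q (right_ne_zero_of_mul hr₀) le_rfl hr₀J'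
      obtain ⟨N₂, q₂, hq₂, h₂⟩ := ih _ ha q₁ (left_ne_zero_of_mul hr₀) le_rfl h₁
      exact ⟨N₂, q₂, hq₁.trans hq₂, h₂⟩
    · push Not at hsplit
      obtain ⟨x₀, hx₀⟩ := inclC_mem_dom.1 hr₀J'
      refine q.exists_extends_of_simple hr₀ hx₀ (fun y hy => hzdom (inclC_mem_dom.2 ⟨y, hy⟩))
        (fun s y hy => hJ' s (inclC_mem_dom.2 ⟨y, hy⟩)) fun s hs => ?_
      -- `g` generates `r₀ R + s R`, and `r₀ = g * b`. One of the factors is a unit: if `g` is, the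
      -- Bézout identity follows; if `b` is, then `s` lies in `r₀ R`.
      obtain ⟨g, ⟨c, e, hce⟩, hg0, hg⟩ := exists_generator
        { carrier := {x | ∃ c e, x = r₀ * c + s * e}
          zero_mem' := ⟨0, 0, by simp⟩
          add_mem' := by
            rintro _ _ ⟨c, e, rfl⟩ ⟨c', e', rfl⟩
            exact ⟨c + c', e + e', by rw [mul_add, mul_add]; abel⟩
          neg_mem' := by
            rintro _ ⟨c, e, rfl⟩
            exact ⟨-c, -e, by rw [mul_neg, mul_neg]; abel⟩ }
        (by
          rintro _ ⟨c, e, rfl⟩ r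
          exact ⟨c * r, e * r, by rw [add_mul, mul_assoc, mul_assoc]⟩)
        ⟨r₀, ⟨1, 0, by simp⟩, hr₀⟩
      obtain ⟨b, hb⟩ := hg r₀ ⟨1, 0, by simp⟩
      obtain ⟨b', hb'⟩ := hg s ⟨0, 1, by simp⟩
      have hb0 : b ≠ 0 := by rintro rfl; exact hr₀ (by rw [hb, mul_zero])
      have hdeg' := natDegree_mul hg0 hb0
      rw [← hb] at hdeg'
      rcases Nat.eq_zero_or_pos g.natDegree with h0 | h0
      · obtain ⟨u, hu, -⟩ := exists_inv_of_natDegree_eq_zero hg0 h0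
        exact ⟨c * u, e * u, by rw [← hu, hce, add_mul, mul_assoc, mul_assoc]⟩
      · have hb1 : b.natDegree = 0 := by
          by_contra hne
          have := hsplit g b hb (by omega)
          omega
        obtain ⟨u, hu, -⟩ := exists_inv_of_natDegree_eq_zero hb0 hb1
        refine absurd ⟨u * b', ?_⟩ hs
        rw [← mul_assoc, hb, mul_assoc g, hu, mul_one]
        exact hb'

/-- An element of `C` may be added to the domain of a partial isomorphism. -/
theorem exists_extends_C (q : PartialIso M N) (z : M.C) :
    ∃ (N' : SplitModel.{u, w} φ h) (q' : PartialIso M N'), q.Extends q' ∧ inclC M z ∈ q'.dom := by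
  by_cases halg : ∃ r : TwistedPolynomial φ, r ≠ 0 ∧ inclC M (z <• r) ∈ q.dom
  · obtain ⟨r, hr, hdom⟩ := halg
    exact exists_extends_of_algebraic r.natDegree q hr le_rfl hdom
  · push Not at halg
    exact q.exists_extends_of_free fun r hr y hy => halg r hr (inclC_mem_dom.2 ⟨y, hy⟩)

/-- An element may be added to the domain of a partial isomorphism. -/
theorem exists_extends (q : PartialIso M N) (z : M.Carrier) :
    ∃ (N' : SplitModel.{u, w} φ h) (q' : PartialIso M N'), q.Extends q' ∧ z ∈ q'.dom := by
  obtain ⟨N₁, q₁, h₁, hd₁⟩ := q.exists_extends_piece false z.1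
  obtain ⟨N₂, q₂, h₂, hd₂⟩ := q₁.exists_extends_C z.2.1
  obtain ⟨N₃, q₃, h₃, hd₃⟩ := q₂.exists_extends_piece true z.2.2
  refine ⟨N₃, q₃, (h₁.trans h₂).trans h₃, ?_⟩
  have := add_mem_dom (add_mem_dom ((h₂.trans h₃).dom_subset hd₁) (h₃.dom_subset hd₂)) hd₃
  convert this using 1
  simp [incl, inclC]

end PartialIso

end SplitModel

end ExtensionSteps

/-! ### Partial isomorphisms preserve formulas. -/

section BackAndForth

open FirstOrder TwistedPolynomial Filter

universe u w

namespace TwoSorted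

variable {L₁ L₂ : Language} {M Δ M' Δ' : Type*} [L₁.Structure M] [L₂.Structure Δ]
  [L₁.Structure M'] [L₂.Structure Δ'] {v : M → Δ} {v' : M' → Δ'}

theorem realizeTerm₂_equiv (i : M ≃[L₁] M') (j : Δ ≃[L₂] Δ') (hv : ∀ x, v' (i x) = j (v x))
    {n m : ℕ} (t : Term₂ L₁ L₂ n m) (x : Fin n → M) (y : Fin m → Δ) :
    realizeTerm₂ v' t (i ∘ x) (j ∘ y) = j (realizeTerm₂ v t x y) := by
  rw [realizeTerm₂, realizeTerm₂, ← Language.HomClass.realize_term]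
  congr 1
  ext k
  rcases k with k | s
  · rfl
  · simp only [Sum.elim_inr, Function.comp_apply, Language.HomClass.realize_term, hv]

/-- Isomorphic two-sorted structures satisfy the same formulas. -/
theorem Formula.realize_equiv (i : M ≃[L₁] M') (j : Δ ≃[L₂] Δ')
    (hv : ∀ x, v' (i x) = j (v x)) {n m : ℕ} (ψ : Formula L₁ L₂ n m) (x : Fin n → M)
    (y : Fin m → Δ) : ψ.Realize v' (i ∘ x) (j ∘ y) ↔ ψ.Realize v x y := by
  induction ψ with
  | falsum => exact Iff.rfl
  | eq₁ s t =>
    simp only [Formula.Realize, Language.HomClass.realize_term]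
    exact i.injective.eq_iff
  | eq₂ s t =>
    simp only [Formula.Realize, realizeTerm₂_equiv i j hv]
    exact j.injective.eq_iff
  | rel₁ r ts =>
    simp only [Formula.Realize, Language.HomClass.realize_term]
    exact i.map_rel r _
  | rel₂ r ts =>
    simp only [Formula.Realize, realizeTerm₂_equiv i j hv]
    exact j.map_rel r _
  | imp f g ihf ihg => simp only [Formula.Realize, ihf, ihg]
  | all₁ f ih =>
    simp only [Formula.Realize]
    rw [i.surjective.forall]
    refine forall_congr' fun a => ?_
    rw [← ih, Fin.comp_snoc]
  | all₂ f ih =>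
    simp only [Formula.Realize]
    rw [j.surjective.forall]
    refine forall_congr' fun a => ?_
    rw [← ih, Fin.comp_snoc]

end TwoSorted

namespace SplitModel

variable {K : Type u} [Field K] {φ : K →+* K} {h : Bool → TwistedPolynomial φ → ℕ}

namespace PartialIso

variable {M N : SplitModel.{u, w} φ h}

theorem Mem.realize {q : PartialIso M N} {n : ℕ} {x : Fin n → M.Carrier} {x' : Fin n → N.Carrier}
    (hx : ∀ i, q.Mem (x i) (x' i)) (s : (LMod (TwistedPolynomial φ)).Term (Fin n)) :
    q.Mem (s.realize x) (s.realize x') := by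
  induction s with
  | var i => exact hx i
  | func f ts ih =>
    rcases f with _ | _ | _ | r
    · exact .zero q
    · exact (ih 0).neg
    · exact (ih 0).add (ih 1)
    · exact (ih 0).act r

theorem realizeTerm₂_mem {q : PartialIso M N} {n m : ℕ} {x : Fin n → M.Carrier}
    {x' : Fin n → N.Carrier} {y : Fin m → M.Δ} {y' : Fin m → N.Δ}
    (hx : ∀ i, q.Mem (x i) (x' i)) (hy : ∀ i, (y i, y' i) ∈ q.ρ)
    (t : TwoSorted.Term₂ (LMod (TwistedPolynomial φ)) LV n m) :
    (TwoSorted.realizeTerm₂ M.val t x y, TwoSorted.realizeTerm₂ N.val t x' y') ∈ q.ρ := by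
  rw [TwoSorted.realizeTerm₂, TwoSorted.realizeTerm₂]
  induction t with
  | var k =>
    rcases k with k | s
    · exact hy k
    · exact (Mem.realize hx s).val
  | func f ts ih =>
    rcases f with _ | _
    · exact q.top_mem
    · exact (q.τ_mem _ _).2 (ih 0)

/-- Partial isomorphisms preserve the truth of all formulas. -/
theorem realize_iff {n m : ℕ} (ψ : TwoSorted.Formula (LMod (TwistedPolynomial φ)) LV n m) :
    ∀ {M N : SplitModel.{u, w} φ h} (q : PartialIso M N) {x : Fin n → M.Carrier}
      {x' : Fin n → N.Carrier} {y : Fin m → M.Δ} {y' : Fin m → N.Δ},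
      (∀ i, q.Mem (x i) (x' i)) → (∀ i, (y i, y' i) ∈ q.ρ) →
        (ψ.Realize M.val x y ↔ ψ.Realize N.val x' y') := by
  induction ψ with
  | falsum => exact fun _ _ _ _ _ _ _ => Iff.rfl
  | eq₁ s t => exact fun q _ _ _ _ hx hy => (Mem.realize hx s).eq_iff (Mem.realize hx t)
  | eq₂ s t =>
    exact fun q _ _ _ _ hx hy =>
      eq_iff_of_mem q.elementary (realizeTerm₂_mem hx hy s) (realizeTerm₂_mem hx hy t)
  | rel₁ r ts => exact r.elim
  | rel₂ r ts =>
    intro M N q x x' y y' hx hy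
    have := q.elementary _ _ (fun i => realizeTerm₂_mem hx hy (ts i))
      (Language.Relations.formula r Language.Term.var)
    rwa [Language.Formula.realize_rel, Language.Formula.realize_rel] at this
  | imp f g ihf ihg =>
    exact fun q _ _ _ _ hx hy => imp_congr (ihf q hx hy) (ihg q hx hy)
  | all₁ f ih =>
    have key : ∀ {M N : SplitModel.{u, w} φ h} (q : PartialIso M N) {x : Fin _ → M.Carrier}
        {x' : Fin _ → N.Carrier} {y : Fin _ → M.Δ} {y' : Fin _ → N.Δ},
        (∀ i, q.Mem (x i) (x' i)) → (∀ i, (y i, y' i) ∈ q.ρ) →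
          (TwoSorted.Formula.all₁ f).Realize N.val x' y' →
            (TwoSorted.Formula.all₁ f).Realize M.val x y := by
      intro M N q x x' y y' hx hy H a
      -- The universal formula passes from `N` to its elementary extension `N'`, where it is applied
      -- to the partner `b` of `a`. The induction hypothesis has to cover all pairs of models
      -- because the target changes.
      obtain ⟨N', q', ⟨i, j, h1, h2, h3⟩, b, hab⟩ := q.exists_extends a
      refine (ih q' (fun k => ?_) fun k => h3 _ _ (hy k)).2 ((h1 _ x' y').2 H b)
      refine Fin.lastCases ?_ (fun k => ?_) k
      · simpa using hab
      · simpa using h2 _ _ (hx k)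
    intro M N q x x' y y' hx hy
    exact ⟨key q.symm (fun k => (hx k).symm) hy, key q hx hy⟩
  | all₂ f ih =>
    have key : ∀ {M N : SplitModel.{u, w} φ h} (q : PartialIso M N) {x : Fin _ → M.Carrier}
        {x' : Fin _ → N.Carrier} {y : Fin _ → M.Δ} {y' : Fin _ → N.Δ},
        (∀ i, q.Mem (x i) (x' i)) → (∀ i, (y i, y' i) ∈ q.ρ) →
          (TwoSorted.Formula.all₂ f).Realize N.val x' y' →
            (TwoSorted.Formula.all₂ f).Realize M.val x y := by
      intro M N q x x' y y' hx hy H a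
      obtain ⟨N', q', ⟨i, j, h1, h2, h3⟩, b, hab⟩ := q.exists_extends_value a
      refine (ih q' (fun k => h2 _ _ (hx k)) fun k => ?_).2 ((h1 _ x' y').2 H b)
      refine Fin.lastCases ?_ (fun k => ?_) k
      · simpa using hab
      · simpa using h3 _ _ (hy k)
    intro M N q x x' y y' hx hy
    exact ⟨key q.symm (fun k => (hx k).symm) hy, key q hx hy⟩

end PartialIso

/-- The element `θ` is definable: it is the fixed point of `τ` other than `∞` if there is one,
and `∞` otherwise. -/
def IsTheta (N : SplitModel.{u, w} φ h) : Prop :=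
  (N.τ N.θ = N.θ) ∧ ∀ γ, N.τ γ = γ → γ ≠ ⊤ → γ = N.θ

theorem defPair_τ_eq {M N : SplitModel.{u, w} φ h} {ρ : Set (M.Δ × N.Δ)} :
    DefPair LV ρ {x | M.τ x = x} {x | N.τ x = x} :=
  ⟨0, Fin.elim0, fun i => i.elim0,
    (iterateTauTerm (Language.Term.var (Sum.inr ())) 1).equal (Language.Term.var (Sum.inr ())),
    fun d => by rw [Language.Formula.realize_equal]; rfl,
    fun d => by rw [Language.Formula.realize_equal]; rfl⟩

/-- Adding a pair of elements defined by the same formula. -/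
theorem _root_.ElementaryRel.insert_of_defPair {L : Language} {D D' : Type*} [L.Structure D]
    [L.Structure D'] {ρ : Set (D × D')} (hρ : ElementaryRel L ρ) (hne : ρ.Nonempty) {d : D} {d' : D'}
    {s : Set D} {s' : Set D'} (hs : DefPair L ρ s s') (hd : d ∈ s) (hd' : ∀ x ∈ s', x = d') :
    ElementaryRel L (insert (d, d') ρ) := by
  refine .insert hne fun t t' ht hdt => ?_
  obtain ⟨x, hx, hx'⟩ := (ht.inter hs).nonempty hρ ⟨d, hdt, hd⟩
  rwa [← hd' x hx']

end SplitModel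

end BackAndForth

/-! ### Values above and below `θ`, and the splitting of henselian divisible modules. -/

section ValuationTheory

open FirstOrder TwistedPolynomial

namespace TwistedPolynomial

variable {K : Type*} [Field K] {φ : K →+* K}

/-- The order of a twisted polynomial: the least index of a nonzero coefficient. -/
noncomputable def order (r : TwistedPolynomial φ) : ℕ := sInf {i | coeff r i ≠ 0}

theorem coeff_order_ne_zero {r : TwistedPolynomial φ} (hr : r ≠ 0) : coeff r r.order ≠ 0 :=
  Nat.sInf_mem (s := {i | coeff r i ≠ 0}) ⟨_, coeff_natDegree_ne_zero hr⟩

theorem order_le {r : TwistedPolynomial φ} {i : ℕ} (h : coeff r i ≠ 0) : r.order ≤ i :=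
  Nat.sInf_le h

theorem le_natDegree {r : TwistedPolynomial φ} {i : ℕ} (h : coeff r i ≠ 0) : i ≤ r.natDegree := by
  by_contra! hlt
  exact h (coeff_eq_zero_of_natDegree_lt hlt)

theorem sum_monomial (r : TwistedPolynomial φ) :
    ∑ i ∈ r.toFinsupp.support, monomial φ i (coeff r i) = r :=
  Finsupp.sum_single (r : ℕ →₀ K)

theorem T_pow (n : ℕ) : T φ ^ n = monomial φ n 1 := by
  induction n with
  | zero => rfl
  | succ n ih => rw [pow_succ, ih, T, monomial_mul_monomial]; simp

theorem monomial_eq (n : ℕ) (a : K) : monomial φ n a = T φ ^ n * C φ a := by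
  rw [T_pow, C, monomial_mul_monomial]; simp

theorem T_ne_zero : T φ ≠ 0 := monomial_ne_zero 1 one_ne_zero

/-- Separates what henselianity solves, the factor `s`, from the power of `t`, which acts on values
through `τ`. -/
theorem exists_eq_pow_mul_separable {r : TwistedPolynomial φ} (hr : r ≠ 0) :
    ∃ (n : ℕ) (s : TwistedPolynomial φ), s ≠ 0 ∧ s.IsSeparable ∧ r = T φ ^ n * s := by
  induction hd : r.natDegree using Nat.strong_induction_on generalizing r with
  | _ d ih =>
    by_cases hsep : r.IsSeparable
    · exact ⟨0, r, hr, hsep, by simp⟩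
    · obtain ⟨s, rfl⟩ := not_not.1 hsep
      have hs : s ≠ 0 := right_ne_zero_of_mul hr
      have hT : (T φ).natDegree = 1 := natDegree_eq (by simp [T, coeff_monomial]) fun i hi => by
        rw [T, coeff_monomial, if_neg (by omega)]
      rw [natDegree_mul T_ne_zero hs, hT] at hd
      obtain ⟨n, s', h0, hs', rfl⟩ := ih s.natDegree (by omega) hs rfl
      exact ⟨n + 1, s', h0, hs', by rw [pow_succ', mul_assoc]⟩

end TwistedPolynomial

/-- The power of `τ` by which a nonzero twisted polynomial acts above (`true`) and below (`false`)
the fixed point `θ`. -/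
noncomputable def height {K : Type*} [Field K] {φ : K →+* K} (ε : Bool)
    (r : TwistedPolynomial φ) : ℕ := bif ε then r.order else r.natDegree

namespace GroupValuation

variable {M Δ : Type*} [AddCommGroup M] [LinearOrder Δ] [OrderTop Δ] (v : GroupValuation M Δ)

theorem add_eq_of_lt {x y : M} (h : v.v x < v.v y) : v.v (x + y) = v.v x := by
  refine le_antisymm ?_ (by simpa [min_eq_left h.le] using v.min_le_add x y)
  by_contra! hlt
  have h1 := v.min_le_sub (x + y) y
  rw [add_sub_cancel_right] at h1
  exact absurd h1 (not_le.2 (lt_min hlt h))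

theorem lt_add {x y : M} {γ : Δ} (hx : γ < v.v x) (hy : γ < v.v y) : γ < v.v (x + y) :=
  (lt_min hx hy).trans_le (v.min_le_add x y)

theorem lt_sub {x y : M} {γ : Δ} (hx : γ < v.v x) (hy : γ < v.v y) : γ < v.v (x - y) :=
  (lt_min hx hy).trans_le (v.min_le_sub x y)

theorem lt_sum {ι : Type*} (s : Finset ι) {f : ι → M} {γ : Δ} (hγ : γ ≠ ⊤)
    (h : ∀ i ∈ s, γ < v.v (f i)) : γ < v.v (∑ i ∈ s, f i) :=
  (v.openBall γ hγ).sum_mem h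

theorem le_sum {ι : Type*} (s : Finset ι) {f : ι → M} {γ : Δ}
    (h : ∀ i ∈ s, γ ≤ v.v (f i)) : γ ≤ v.v (∑ i ∈ s, f i) :=
  (v.closedBall γ).sum_mem h

theorem sum_eq {ι : Type*} {s : Finset ι} {f : ι → M} {i₀ : ι} (hi₀ : i₀ ∈ s)
    (h0 : v.v (f i₀) ≠ ⊤) (h : ∀ i ∈ s, i ≠ i₀ → v.v (f i₀) < v.v (f i)) :
    v.v (∑ i ∈ s, f i) = v.v (f i₀) := by
  classical
  rw [← Finset.add_sum_erase s f hi₀]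
  exact v.add_eq_of_lt (v.lt_sum _ h0 fun i hi =>
    h i (Finset.mem_of_mem_erase hi) (Finset.ne_of_mem_erase hi))

/-- `R_n` in terms of elements of the group. -/
theorem hasAtLeast_iff {n : ℕ} {γ : Δ} (hγ : γ ≠ ⊤) :
    v.HasAtLeast n γ ↔ ∃ e : Fin n → M, (∀ i, γ ≤ v.v (e i)) ∧
      ∀ i j, i ≠ j → v.v (e i - e j) ≤ γ := by
  set S := (v.openBall γ hγ).addSubgroupOf (v.closedBall γ) with hS
  have hmk : ∀ x y : v.closedBall γ, (x : v.closedBall γ ⧸ S) = y ↔ γ < v.v (y.1 - x.1) := by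
    intro x y
    rw [QuotientAddGroup.eq, hS, AddSubgroup.mem_addSubgroupOf, neg_add_eq_sub]
    rfl
  have hcard : v.HasAtLeast n γ ↔ ∃ e : Fin n → v.closedBall γ ⧸ S, Function.Injective e := by
    rw [HasAtLeast, exists_prop_of_true hγ]
    have h1 : (n : ℕ∞) = ENat.card (Fin n) := by simp
    rw [h1]
    constructor
    · intro hle
      by_cases hfin : Finite (v.closedBall γ ⧸ S)
      · have := Fintype.ofFinite (v.closedBall γ ⧸ S)
        rw [ENat.card_eq_coe_fintype_card, ENat.card_eq_coe_fintype_card, Nat.cast_le] at hle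
        exact ⟨_, (Function.Embedding.nonempty_of_card_le hle).some.injective⟩
      · rw [not_finite_iff_infinite] at hfin
        exact ⟨_, ((Infinite.natEmbedding _).injective.comp Fin.val_injective)⟩
    · rintro ⟨e, he⟩
      exact ENat.card_le_card_of_injective he
  rw [hcard]
  constructor
  · rintro ⟨e, he⟩
    choose f hf using fun i => QuotientAddGroup.mk_surjective (e i)
    refine ⟨fun i => (f i).1, fun i => (f i).2, fun i j hij => ?_⟩
    by_contra! hlt
    refine hij (he ?_).symm
    rw [← hf, ← hf]
    exact (hmk _ _).2 hlt
  · rintro ⟨e, h1, h2⟩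
    refine ⟨fun i => QuotientAddGroup.mk ⟨e i, h1 i⟩, fun i j hij => ?_⟩
    by_contra hne
    exact absurd (h2 j i (Ne.symm hne)) (not_le.2 ((hmk _ _).1 hij))

end GroupValuation

namespace ValuedModule

variable {K : Type*} [Field K] {φ : K →+* K} {F Δ : Type*} [AddCommGroup F]
  [Module (TwistedPolynomial φ)ᵐᵒᵖ F] [LinearOrder Δ] [OrderTop Δ] (V : ValuedModule φ F Δ)

theorem iterate_τ_ne_top {γ : Δ} (hγ : γ ≠ ⊤) (n : ℕ) : V.τ^[n] γ ≠ ⊤ := by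
  rw [← Function.iterate_fixed V.isTauChain.map_top n]
  exact (V.isTauChain.strictMono.iterate n).injective.ne hγ

theorem v_act_T_pow (x : F) (n : ℕ) : V.v (x <• T φ ^ n) = V.τ^[n] (V.v x) := by
  induction n with
  | zero => rw [pow_zero, act_one]; rfl
  | succ n ih => rw [pow_succ, act_mul, V.map_act_T, ih, Function.iterate_succ_apply']

theorem v_act_monomial (x : F) (n : ℕ) {a : K} (ha : a ≠ 0) :
    V.v (x <• monomial φ n a) = V.τ^[n] (V.v x) := by
  rw [monomial_eq, act_mul, V.map_act_C _ a ha, v_act_T_pow]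

theorem act_sum {ι : Type*} (x : F) (s : Finset ι) (f : ι → TwistedPolynomial φ) :
    x <• ∑ i ∈ s, f i = ∑ i ∈ s, x <• f i := by
  classical
  induction s using Finset.induction_on with
  | empty => simp
  | insert i s hi ih => rw [Finset.sum_insert hi, Finset.sum_insert hi, act_add, ih]

theorem act_eq_sum (x : F) (r : TwistedPolynomial φ) :
    x <• r = ∑ i ∈ r.toFinsupp.support, x <• monomial φ i (coeff r i) := by
  nth_rewrite 1 [← sum_monomial r]
  rw [act_sum]

/-- Above `θ` the iterates `τ^i (v x)` strictly increase with `i`, so the monomial of lowest index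
alone has the least value. -/
theorem v_act_of_lt {x : F} (hx : V.v x < V.τ (V.v x)) {r : TwistedPolynomial φ} (hr : r ≠ 0) :
    V.v (x <• r) = V.τ^[r.order] (V.v x) := by
  have htop : V.v x ≠ ⊤ := hx.ne_top
  rw [act_eq_sum, ← V.v_act_monomial x _ (coeff_order_ne_zero hr)]
  refine V.sum_eq (Finsupp.mem_support_iff.2 (coeff_order_ne_zero hr)) ?_ fun i hi hne => ?_
  · rw [V.v_act_monomial x _ (coeff_order_ne_zero hr)]
    exact V.iterate_τ_ne_top htop _
  · have hi' : coeff r i ≠ 0 := Finsupp.mem_support_iff.1 hi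
    rw [V.v_act_monomial x _ (coeff_order_ne_zero hr), V.v_act_monomial x _ hi']
    exact V.isTauChain.strictMono.strictMono_iterate_of_lt_map hx
      (lt_of_le_of_ne (order_le hi') (Ne.symm hne))

/-- Below `θ` the iterates strictly decrease, so the leading monomial dominates. -/
theorem v_act_of_gt {x : F} (hx : V.τ (V.v x) < V.v x) {r : TwistedPolynomial φ} (hr : r ≠ 0) :
    V.v (x <• r) = V.τ^[r.natDegree] (V.v x) := by
  have htop : V.v x ≠ ⊤ := fun h => by
    rw [h, V.isTauChain.map_top] at hx
    exact lt_irrefl _ hx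
  rw [act_eq_sum, ← V.v_act_monomial x _ (coeff_natDegree_ne_zero hr)]
  refine V.sum_eq (Finsupp.mem_support_iff.2 (coeff_natDegree_ne_zero hr)) ?_ fun i hi hne => ?_
  · rw [V.v_act_monomial x _ (coeff_natDegree_ne_zero hr)]
    exact V.iterate_τ_ne_top htop _
  · have hi' : coeff r i ≠ 0 := Finsupp.mem_support_iff.1 hi
    rw [V.v_act_monomial x _ (coeff_natDegree_ne_zero hr), V.v_act_monomial x _ hi']
    exact V.isTauChain.strictMono.strictAnti_iterate_of_map_lt hx
      (lt_of_le_of_ne (le_natDegree hi') hne)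

/-- The contrapositive of the axiom of `τ`-chains: being `≥ θ` is inherited by larger values. -/
theorem le_τ_of_le {a b : Δ} (ha : a ≤ V.τ a) (hab : a ≤ b) : b ≤ V.τ b := by
  rcases eq_or_ne b ⊤ with rfl | hb
  · rw [V.isTauChain.map_top]
  rcases hab.eq_or_lt with rfl | hab
  · exact ha
  by_contra! hlt
  exact absurd (V.isTauChain.lt_of_le b hb a hlt.le hab) (not_lt.2 ha)

theorem GtTheta.mono {V : ValuedModule φ F Δ} {a b : Δ} (ha : V.GtTheta a) (hab : a ≤ b) :
    V.GtTheta b := by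
  rcases eq_or_ne b ⊤ with rfl | hb
  · exact Or.inr rfl
  rcases ha with ha | rfl
  · rcases hab.eq_or_lt with rfl | hab
    · exact Or.inl ha
    · refine Or.inl ?_
      by_contra! hle
      exact absurd (V.isTauChain.lt_of_le b hb a hle hab) (not_lt.2 ha.le)
  · exact absurd (top_le_iff.1 hab) hb

theorem fixed_unique {a b : Δ} (ha : V.τ a = a) (hb : V.τ b = b) (ha' : a ≠ ⊤) (hb' : b ≠ ⊤) :
    a = b := by
  rcases lt_trichotomy a b with h | h | h
  · exact absurd (V.isTauChain.lt_of_le b hb' a hb.le h) (by rw [ha]; exact lt_irrefl a)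
  · exact h
  · exact absurd (V.isTauChain.lt_of_le a ha' b ha.le h) (by rw [hb]; exact lt_irrefl b)

theorem le_τ_v_act {x : F} (hx : V.v x ≤ V.τ (V.v x)) (r : TwistedPolynomial φ) :
    V.v (x <• r) ≤ V.τ (V.v (x <• r)) := by
  refine V.le_τ_of_le hx ?_
  rw [act_eq_sum]
  refine V.le_sum _ fun i hi => ?_
  have hi' : coeff r i ≠ 0 := Finsupp.mem_support_iff.1 hi
  rw [V.v_act_monomial x _ hi']
  exact V.isTauChain.strictMono.monotone.monotone_iterate_of_le_map hx (Nat.zero_le i)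

/-- The elements of value `≥ θ`. -/
noncomputable def geTheta : Submodule (TwistedPolynomial φ)ᵐᵒᵖ F where
  carrier := {x | V.v x ≤ V.τ (V.v x)}
  zero_mem' := by simp [V.map_zero, V.isTauChain.map_top]
  add_mem' := fun {x y} hx hy => by
    refine V.le_τ_of_le ?_ (V.min_le_add x y)
    rcases min_choice (V.v x) (V.v y) with h | h <;> rw [h]
    · exact hx
    · exact hy
  smul_mem' := fun a x hx => V.le_τ_v_act hx a.unop

/-- The elements of value `> θ`. -/
noncomputable def gtTheta : Submodule (TwistedPolynomial φ)ᵐᵒᵖ F where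
  carrier := {x | V.GtTheta (V.v x)}
  zero_mem' := Or.inr V.map_zero
  add_mem' := fun {x y} hx hy => by
    refine GtTheta.mono ?_ (V.min_le_add x y)
    rcases min_choice (V.v x) (V.v y) with h | h <;> rw [h]
    · exact hx
    · exact hy
  smul_mem' := fun a x hx => by
    have key : ∀ r : TwistedPolynomial φ, V.GtTheta (V.v (x <• r)) := by
      intro r
      rcases hx with hx | hx
      · by_cases hr : r = 0
        · rw [hr, MulOpposite.op_zero, zero_smul]
          exact Or.inr V.map_zero
        · rw [V.v_act_of_lt hx hr]
          exact Or.inl ((Function.Commute.refl V.τ).iterate_left _ _ ▸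
            V.isTauChain.strictMono.iterate _ hx)
      · rw [(V.eq_top_iff x).1 hx, smul_zero]
        exact Or.inr V.map_zero
    exact key a.unop

variable {V}

theorem mem_geTheta {x : F} : x ∈ V.geTheta ↔ V.v x ≤ V.τ (V.v x) := Iff.rfl

theorem gtTheta_le_geTheta : V.gtTheta ≤ V.geTheta := by
  rintro x (hx | hx)
  · exact le_of_lt hx
  · change V.v x ≤ V.τ (V.v x)
    rw [hx, V.isTauChain.map_top]

theorem lt_v_of_mem_geTheta {x : F} (hx : x ∈ V.geTheta) {γ : Δ} (hγ : V.τ γ < γ) :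
    γ < V.v x := by
  by_contra! hle
  exact absurd (V.le_τ_of_le hx hle) (not_le.2 hγ)

/-- Below `θ` a nonzero `r` acts on values through a power of `τ`, so `y.r` stays below `θ` when `y`
is. A quotient of an element of value `≥ θ` is thus again one. -/
theorem isDivisibleModule_geTheta (hdiv : IsDivisibleModule φ F) :
    IsDivisibleModule φ V.geTheta := by
  rintro r hr ⟨x, hx⟩
  obtain ⟨y, rfl⟩ := hdiv r hr x
  refine ⟨⟨y, ?_⟩, rfl⟩
  by_contra hy
  have hy' : V.τ (V.v y) < V.v y := not_le.1 hy
  refine absurd (mem_geTheta.1 hx) (not_le.2 ?_)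
  rw [V.v_act_of_gt hy' hr, ← Function.iterate_succ_apply' V.τ, Function.iterate_succ_apply]
  exact V.isTauChain.strictMono.iterate _ hy'

/-- Write `r = t^n s` with `s` separable. Henselianity divides by `s` inside the submodule; dividing
the result by `t^n` in `F` stays there, because `τ^n` preserves and reflects being `> θ`. -/
theorem isDivisibleModule_gtTheta (hdiv : IsDivisibleModule φ F) (hhens : V.IsHenselian) :
    IsDivisibleModule φ V.gtTheta := by
  rintro r hr ⟨x, hx⟩
  obtain ⟨n, s, hs0, hs, rfl⟩ := exists_eq_pow_mul_separable hr
  obtain ⟨y, rfl, hy⟩ := hhens s hs x hx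
  obtain ⟨z, rfl⟩ := hdiv (T φ ^ n) (pow_ne_zero n T_ne_zero) y
  refine ⟨⟨z, ?_⟩, Subtype.ext (act_mul z _ _)⟩
  rw [v_act_T_pow] at hy
  rcases hy with hy | hy
  · refine Or.inl ((V.isTauChain.strictMono.iterate n).lt_iff_lt.1 ?_)
    rwa [(Function.Commute.refl V.τ).iterate_left]
  · by_contra hz
    exact V.iterate_τ_ne_top (fun h => hz (Or.inr h)) n hy

/-- A divisible submodule is injective by `IsDivisibleModule.baer`, hence a direct summand. -/
theorem exists_retraction {S : Submodule (TwistedPolynomial φ)ᵐᵒᵖ F} (h : IsDivisibleModule φ S) :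
    ∃ p : F →ₗ[(TwistedPolynomial φ)ᵐᵒᵖ] S, ∀ x : S, p x = x := by
  obtain ⟨p, hp⟩ := h.baer.extension_property S.subtype S.injective_subtype LinearMap.id
  exact ⟨p, fun x => LinearMap.congr_fun hp x⟩

/-- A decomposition of a valued module according to the position of values with respect to `θ`. -/
structure IsSplitting (V : ValuedModule φ F Δ) (B C A : Submodule (TwistedPolynomial φ)ᵐᵒᵖ F) :
    Prop where
  lt_of_mem : ∀ b ∈ B, b ≠ 0 → V.τ (V.v b) < V.v b
  eq_of_mem : ∀ c ∈ C, c ≠ 0 → V.τ (V.v c) = V.v c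
  gt_of_mem : ∀ a ∈ A, a ≠ 0 → V.v a < V.τ (V.v a)
  exists_eq : ∀ x, ∃ b ∈ B, ∃ c ∈ C, ∃ a ∈ A, b + c + a = x

/-- Henselian divisible valued modules split. -/
theorem exists_isSplitting (hdiv : IsDivisibleModule φ F) (hhens : V.IsHenselian) :
    ∃ B C A, V.IsSplitting B C A := by
  obtain ⟨p, hp⟩ := exists_retraction (isDivisibleModule_geTheta (V := V) hdiv)
  obtain ⟨p', hp'⟩ := exists_retraction (isDivisibleModule_gtTheta hdiv hhens)
  -- `B` is a complement of the elements `≥ θ`, and `C` a complement in these of the elements `> θ`.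
  -- A nonzero element of `B` or `C` with too large a value would be fixed by a retraction that
  -- kills it.
  refine ⟨LinearMap.ker p, V.geTheta ⊓ LinearMap.ker p', V.gtTheta, ?_, ?_, ?_, ?_⟩
  · intro b hb hb0
    by_contra hle
    have := hp ⟨b, not_lt.1 hle⟩
    rw [LinearMap.mem_ker.1 hb] at this
    exact hb0 (congrArg Subtype.val this).symm
  · rintro c ⟨hc, hc'⟩ hc0
    refine le_antisymm ?_ hc
    by_contra hlt
    have := hp' ⟨c, Or.inl (not_le.1 hlt)⟩
    rw [LinearMap.mem_ker.1 hc'] at this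
    exact hc0 (congrArg Subtype.val this).symm
  · rintro a (ha | ha) ha0
    · exact ha
    · exact absurd ((V.eq_top_iff a).1 ha) ha0
  · intro x
    refine ⟨x - p x, ?_, p x - p' (p x), ⟨?_, ?_⟩, p' (p x), (p' (p x)).2, by abel⟩
    · rw [LinearMap.mem_ker, map_sub, hp, sub_self]
    · exact V.geTheta.sub_mem (p x).2 (gtTheta_le_geTheta (p' (p x)).2)
    · change p' (p x - p' (p x)) = 0
      rw [map_sub, hp', sub_self]

namespace IsSplitting

variable {B C A : Submodule (TwistedPolynomial φ)ᵐᵒᵖ F}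

theorem le_geTheta_of_mem_C (hS : V.IsSplitting B C A) : C ≤ V.geTheta := fun c hc => by
  by_cases h0 : c = 0
  · rw [h0]; exact V.geTheta.zero_mem
  · exact (hS.eq_of_mem c hc h0).ge

theorem le_gtTheta_of_mem_A (hS : V.IsSplitting B C A) : A ≤ V.gtTheta := fun a ha => by
  by_cases h0 : a = 0
  · rw [h0]; exact V.gtTheta.zero_mem
  · exact Or.inl (hS.gt_of_mem a ha h0)

theorem v_add_of_ne (hS : V.IsSplitting B C A) {b x : F} (hb : b ∈ B) (hb0 : b ≠ 0)
    (hx : x ∈ V.geTheta) : V.v (b + x) = V.v b :=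
  V.add_eq_of_lt (lt_v_of_mem_geTheta hx (hS.lt_of_mem b hb hb0))

theorem v_add_of_ne' (hS : V.IsSplitting B C A) {c a : F} (hc : c ∈ C) (hc0 : c ≠ 0)
    (ha : a ∈ A) : V.v (c + a) = V.v c := by
  refine V.add_eq_of_lt ?_
  by_contra! hle
  have h1 := GtTheta.mono (hS.le_gtTheta_of_mem_A ha) hle
  rcases h1 with h1 | h1
  · exact h1.ne (hS.eq_of_mem c hc hc0).symm
  · exact hc0 ((V.eq_top_iff c).1 h1)

/-- A sum takes the value of its first nonzero component, so it vanishes only if all components do.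
-/
theorem eq_zero (hS : V.IsSplitting B C A) {b c a : F} (hb : b ∈ B) (hc : c ∈ C) (ha : a ∈ A)
    (h : b + c + a = 0) : b = 0 ∧ c = 0 ∧ a = 0 := by
  have hE := V.geTheta.add_mem (hS.le_geTheta_of_mem_C hc)
    (gtTheta_le_geTheta (hS.le_gtTheta_of_mem_A ha))
  have hb0 : b = 0 := by
    by_contra hb0
    have h1 := hS.v_add_of_ne hb hb0 hE
    rw [← add_assoc, h, V.map_zero] at h1
    exact hb0 ((V.eq_top_iff b).1 h1.symm)
  rw [hb0, zero_add] at h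
  have hc0 : c = 0 := by
    by_contra hc0
    have h1 := hS.v_add_of_ne' hc hc0 ha
    rw [h, V.map_zero] at h1
    exact hc0 ((V.eq_top_iff c).1 h1.symm)
  rw [hc0, zero_add] at h
  exact ⟨hb0, hc0, h⟩

/-- Divide the sum in `F` and compare components, which are unique. -/
theorem exists_act_eq (hS : V.IsSplitting B C A) (hdiv : IsDivisibleModule φ F)
    {r : TwistedPolynomial φ} (hr : r ≠ 0) {b c a : F} (hb : b ∈ B) (hc : c ∈ C) (ha : a ∈ A) :
    ∃ b' ∈ B, ∃ c' ∈ C, ∃ a' ∈ A, b' <• r = b ∧ c' <• r = c ∧ a' <• r = a := by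
  obtain ⟨y, hy⟩ := hdiv r hr (b + c + a)
  obtain ⟨b', hb', c', hc', a', ha', rfl⟩ := hS.exists_eq y
  obtain ⟨h1, h2, h3⟩ := hS.eq_zero (B.sub_mem (B.smul_mem (MulOpposite.op r) hb') hb)
    (C.sub_mem (C.smul_mem (MulOpposite.op r) hc') hc)
    (A.sub_mem (A.smul_mem (MulOpposite.op r) ha') ha) (by
      rw [smul_add, smul_add] at hy
      rw [← sub_eq_zero] at hy
      rw [← hy]
      abel)
  exact ⟨b', hb', c', hc', a', ha', sub_eq_zero.1 h1, sub_eq_zero.1 h2, sub_eq_zero.1 h3⟩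

theorem mem_A_of_le (hS : V.IsSplitting B C A) {x : F} {γ : Δ} (hγ : γ < V.τ γ)
    (hx : γ ≤ V.v x) : x ∈ A := by
  obtain ⟨b, hb, c, hc, a, ha, rfl⟩ := hS.exists_eq x
  have hgt := GtTheta.mono (V := V) (Or.inl hγ) hx
  have hE := V.geTheta.add_mem (hS.le_geTheta_of_mem_C hc)
    (gtTheta_le_geTheta (hS.le_gtTheta_of_mem_A ha))
  have hb0 : b = 0 := by
    by_contra hb0
    rw [add_assoc, hS.v_add_of_ne hb hb0 hE] at hgt
    rcases hgt with h1 | h1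
    · exact absurd h1 (hS.lt_of_mem b hb hb0).not_gt
    · exact hb0 ((V.eq_top_iff b).1 h1)
  have hc0 : c = 0 := by
    by_contra hc0
    rw [hb0, zero_add, hS.v_add_of_ne' hc hc0 ha] at hgt
    rcases hgt with h1 | h1
    · exact h1.ne (hS.eq_of_mem c hc hc0).symm
    · exact hc0 ((V.eq_top_iff c).1 h1)
  rw [hb0, hc0, zero_add, zero_add]
  exact ha

/-- A ball around `0` of radius above `θ` is contained in `A`. -/
theorem hasAtLeast_iff_true (hS : V.IsSplitting B C A) {n : ℕ} {γ : Δ} (hγ : γ < V.τ γ) :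
    V.HasAtLeast n γ ↔ ∃ e : Fin n → A, (∀ i, γ ≤ V.v (e i)) ∧
      ∀ i j, i ≠ j → V.v (e i - e j : F) ≤ γ := by
  rw [V.hasAtLeast_iff hγ.ne_top]
  constructor
  · rintro ⟨e, h1, h2⟩
    exact ⟨fun i => ⟨e i, hS.mem_A_of_le hγ (h1 i)⟩, h1, h2⟩
  · rintro ⟨e, h1, h2⟩
    exact ⟨fun i => e i, h1, h2⟩

/-- For `γ` below `θ` the components in `C` and `A` have value `> γ`, so an element and its
component in `B` are in the same class. -/
theorem hasAtLeast_iff_false (hS : V.IsSplitting B C A) {n : ℕ} {γ : Δ} (hγ : V.τ γ < γ) :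
    V.HasAtLeast n γ ↔ ∃ e : Fin n → B, (∀ i, γ ≤ V.v (e i)) ∧
      ∀ i j, i ≠ j → V.v (e i - e j : F) ≤ γ := by
  have htop : γ ≠ ⊤ := fun h => by
    rw [h, V.isTauChain.map_top] at hγ
    exact lt_irrefl _ hγ
  rw [V.hasAtLeast_iff htop]
  constructor
  · rintro ⟨e, h1, h2⟩
    have hdec : ∀ x, ∃ b : B, γ < V.v (x - b) := fun x => by
      obtain ⟨b, hb, c, hc, a, ha, rfl⟩ := hS.exists_eq x
      refine ⟨⟨b, hb⟩, lt_v_of_mem_geTheta ?_ hγ⟩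
      rw [add_assoc, add_sub_cancel_left]
      exact V.geTheta.add_mem (hS.le_geTheta_of_mem_C hc)
        (gtTheta_le_geTheta (hS.le_gtTheta_of_mem_A ha))
    choose b hb using fun i => hdec (e i)
    refine ⟨b, fun i => ?_, fun i j hij => ?_⟩
    · have := (le_min (h1 i) (hb i).le).trans (V.min_le_sub _ _)
      rwa [sub_sub_cancel] at this
    · by_contra! hlt
      have := V.lt_add hlt (V.lt_sub (hb i) (hb j))
      rw [show (b i - b j : F) + (e i - b i - (e j - b j)) = e i - e j by abel] at this
      exact absurd this (not_lt.2 (h2 i j hij))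
  · rintro ⟨e, h1, h2⟩
    exact ⟨fun i => e i, h1, h2⟩

end IsSplitting

theorem τ_surjective (hdiv : IsDivisibleModule φ F) : Function.Surjective V.τ := fun γ => by
  obtain ⟨x, rfl⟩ := V.surjective γ
  obtain ⟨y, rfl⟩ := hdiv (T φ) T_ne_zero x
  exact ⟨V.v y, (V.map_act_T y).symm⟩

theorem hasAtLeast_τ (hdiv : IsDivisibleModule φ F) (n : ℕ) (γ : Δ) :
    V.HasAtLeast n (V.τ γ) ↔ V.HasAtLeast n γ := by
  by_cases hγ : γ = ⊤
  · rw [hγ, V.isTauChain.map_top]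
  have hγ' : V.τ γ ≠ ⊤ := V.iterate_τ_ne_top hγ 1
  rw [V.hasAtLeast_iff hγ, V.hasAtLeast_iff hγ']
  constructor
  · rintro ⟨e, h1, h2⟩
    choose f hf using fun i => hdiv (T φ) T_ne_zero (e i)
    refine ⟨f, fun i => ?_, fun i j hij => ?_⟩
    · have := h1 i
      rwa [← hf, V.map_act_T, V.isTauChain.strictMono.le_iff_le] at this
    · have := h2 i j hij
      rwa [← hf, ← hf, ← smul_sub, V.map_act_T, V.isTauChain.strictMono.le_iff_le] at this
  · rintro ⟨e, h1, h2⟩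
    refine ⟨fun i => e i <• T φ, fun i => ?_, fun i j hij => ?_⟩
    · rw [V.map_act_T, V.isTauChain.strictMono.le_iff_le]
      exact h1 i
    · rw [← smul_sub, V.map_act_T, V.isTauChain.strictMono.le_iff_le]
      exact h2 i j hij

end ValuedModule

end ValuationTheory

/-! ### The split model of a splitting. -/

section Splittings

open FirstOrder TwistedPolynomial

universe u a b w

namespace ValuedModule

variable {K : Type u} [Field K] {φ : K →+* K} {F : Type a} {Δ : Type b} [AddCommGroup F]
  [Module (TwistedPolynomial φ)ᵐᵒᵖ F] [LinearOrder Δ] [OrderTop Δ] {V : ValuedModule φ F Δ}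
  {B C A : Submodule (TwistedPolynomial φ)ᵐᵒᵖ F}

open scoped Classical in
/-- The fixed point of `τ` other than `∞`, or `∞` if there is none. -/
noncomputable def theta (V : ValuedModule φ F Δ) : Δ :=
  if h : ∃ γ, γ ≠ ⊤ ∧ V.τ γ = γ then h.choose else ⊤

theorem τ_theta : V.τ V.theta = V.theta := by
  by_cases h : ∃ γ, γ ≠ ⊤ ∧ V.τ γ = γ
  · rw [theta, dif_pos h]; exact h.choose_spec.2
  · rw [theta, dif_neg h]; exact V.isTauChain.map_top

theorem eq_theta {γ : Δ} (h1 : V.τ γ = γ) (h2 : γ ≠ ⊤) : γ = V.theta := by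
  have h : ∃ γ, γ ≠ ⊤ ∧ V.τ γ = γ := ⟨γ, h2, h1⟩
  rw [theta, dif_pos h]
  exact V.fixed_unique h1 h.choose_spec.2 h2 h.choose_spec.1

namespace IsSplitting

theorem divisible_piece (hS : V.IsSplitting B C A) (hdiv : IsDivisibleModule φ F) (ε : Bool)
    {r : TwistedPolynomial φ} (hr : r ≠ 0) (x : (bif ε then A else B : Submodule _ F)) :
    ∃ y : (bif ε then A else B : Submodule _ F), y <• r = x := by
  cases ε
  · obtain ⟨y, hy, -, -, -, -, h, -, -⟩ :=
      hS.exists_act_eq hdiv hr x.2 C.zero_mem A.zero_mem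
    exact ⟨⟨y, hy⟩, Subtype.ext h⟩
  · obtain ⟨-, -, -, -, y, hy, -, -, h⟩ :=
      hS.exists_act_eq hdiv hr B.zero_mem C.zero_mem x.2
    exact ⟨⟨y, hy⟩, Subtype.ext h⟩

theorem v_dom_piece (hS : V.IsSplitting B C A) (ε : Bool)
    {x : F} (hx : x ∈ (bif ε then A else B : Submodule _ F)) (hx0 : x ≠ 0) :
    bif ε then V.v x < V.τ (V.v x) else V.τ (V.v x) < V.v x := by
  cases ε
  · exact hS.lt_of_mem x hx hx0
  · exact hS.gt_of_mem x hx hx0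

theorem v_act_piece (hS : V.IsSplitting B C A) (ε : Bool)
    {x : F} (hx : x ∈ (bif ε then A else B : Submodule _ F)) {r : TwistedPolynomial φ}
    (hr : r ≠ 0) : V.v (x <• r) = V.τ^[height ε r] (V.v x) := by
  by_cases hx0 : x = 0
  · rw [hx0, smul_zero, V.map_zero, Function.iterate_fixed V.isTauChain.map_top]
  · have := hS.v_dom_piece ε hx hx0
    cases ε
    · exact V.v_act_of_gt this hr
    · exact V.v_act_of_lt this hr

/-- The split model attached to a splitting, in a larger universe. -/
noncomputable def toSplitModel (hS : V.IsSplitting B C A) (hdiv : IsDivisibleModule φ F) :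
    SplitModel.{u, max a b w} φ height where
  P ε := ULift.{max b w} (bif ε then A else B : Submodule _ F)
  C := ULift.{max b w} C
  Δ := ULift.{max a w} Δ
  τ γ := ⟨V.τ γ.down⟩
  Rn n γ := V.HasAtLeast n γ.down
  -- When `τ` has no fixed point besides `∞`, the component `C` is zero and this value is never
  -- taken by a nonzero element.
  θ := ⟨V.theta⟩
  v ε x := ⟨V.v x.down⟩
  τ_strictMono := fun γ δ h => V.isTauChain.strictMono (show γ.down < δ.down from h)
  τ_surjective := fun γ => by
    obtain ⟨δ, hδ⟩ := τ_surjective (V := V) hdiv γ.down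
    exact ⟨⟨δ⟩, ULift.ext _ _ hδ⟩
  Rn_τ := fun n γ => hasAtLeast_τ hdiv n γ.down
  v_eq_top := fun ε x => by
    rw [ULift.ext_iff, ULift.ext_iff, Subtype.ext_iff]
    exact V.eq_top_iff x.down
  min_le_v_sub := fun ε x y => by
    have h := V.min_le_sub x.down.1 y.down.1
    rcases min_le_iff.1 h with h | h
    · exact (min_le_left _ _).trans h
    · exact (min_le_right _ _).trans h
  v_act := fun ε x r hr => by
    have key : ∀ (n : ℕ) (γ : Δ),
        (fun γ : ULift.{max a w} Δ => (⟨V.τ γ.down⟩ : ULift.{max a w} Δ))^[n] ⟨γ⟩ =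
          ⟨V.τ^[n] γ⟩ := by
      intro n
      induction n with
      | zero => exact fun γ => rfl
      | succ n ih => exact fun γ => ih _
    rw [key]
    exact ULift.ext _ _ (hS.v_act_piece ε x.down.2 hr)
  divisible := fun ε r hr x => by
    obtain ⟨y, hy⟩ := hS.divisible_piece hdiv ε hr x.down
    exact ⟨⟨y⟩, ULift.ext _ _ hy⟩
  divisibleC := fun r hr x => by
    obtain ⟨-, -, y, hy, -, -, -, h, -⟩ :=
      hS.exists_act_eq hdiv hr B.zero_mem x.down.2 A.zero_mem
    exact ⟨⟨⟨y, hy⟩⟩, ULift.ext _ _ (Subtype.ext h)⟩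
  v_dom := fun ε x hx => by
    have := hS.v_dom_piece ε x.down.2 fun h => hx (ULift.ext _ _ (Subtype.ext h))
    cases ε
    · exact this
    · exact this
  Rn_iff := fun ε n γ hγ => by
    cases ε
    · refine (hS.hasAtLeast_iff_false (γ := γ.down) hγ).trans ⟨?_, ?_⟩
      · rintro ⟨e, h1, h2⟩
        exact ⟨fun i => ⟨e i⟩, h1, h2⟩
      · rintro ⟨e, h1, h2⟩
        exact ⟨fun i => (e i).down, h1, h2⟩
    · refine (hS.hasAtLeast_iff_true (γ := γ.down) hγ).trans ⟨?_, ?_⟩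
      · rintro ⟨e, h1, h2⟩
        exact ⟨fun i => ⟨e i⟩, h1, h2⟩
      · rintro ⟨e, h1, h2⟩
        exact ⟨fun i => (e i).down, h1, h2⟩

variable (hS : V.IsSplitting B C A) (hdiv : IsDivisibleModule φ F)

/-- The value set of the split model. -/
def valueEquiv : (toSplitModel.{u, a, b, w} hS hdiv).Δ ≃[LV] V.ValueSet where
  toFun := ULift.down
  invFun := ULift.up
  left_inv _ := rfl
  right_inv _ := rfl
  map_fun' := by
    rintro n (_ | _) x <;> rfl
  map_rel' := by
    rintro n (_ | _) x <;> exact Iff.rfl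

/-- The sum of the components. -/
def carrierSum (x : (toSplitModel.{u, a, b, w} hS hdiv).Carrier) : F :=
  x.1.down.1 + x.2.1.down.1 + x.2.2.down.1

theorem carrierSum_bijective : Function.Bijective (carrierSum.{u, a, b, w} hS hdiv) := by
  constructor
  · intro x y hxy
    obtain ⟨h1, h2, h3⟩ := hS.eq_zero (B.sub_mem x.1.down.2 y.1.down.2)
      (C.sub_mem x.2.1.down.2 y.2.1.down.2) (A.sub_mem x.2.2.down.2 y.2.2.down.2) (by
        have : carrierSum hS hdiv x - carrierSum hS hdiv y = 0 := sub_eq_zero.2 hxy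
        rw [← this, carrierSum, carrierSum]
        abel)
    exact Prod.ext (ULift.ext _ _ (Subtype.ext (sub_eq_zero.1 h1)))
      (Prod.ext (ULift.ext _ _ (Subtype.ext (sub_eq_zero.1 h2)))
        (ULift.ext _ _ (Subtype.ext (sub_eq_zero.1 h3))))
  · intro x
    obtain ⟨b, hb, c, hc, a, ha, h⟩ := hS.exists_eq x
    exact ⟨(⟨⟨b, hb⟩⟩, ⟨⟨c, hc⟩⟩, ⟨⟨a, ha⟩⟩), h⟩

/-- The underlying module of the split model. -/
noncomputable def carrierEquiv :
    (toSplitModel.{u, a, b, w} hS hdiv).Carrier ≃[LMod (TwistedPolynomial φ)] F where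
  toEquiv := Equiv.ofBijective _ (carrierSum_bijective.{u, a, b, w} hS hdiv)
  map_fun' := by
    rintro n (_ | _ | _ | r) x
    · change (0 : F) + 0 + 0 = 0
      simp
    · change -(x 0).1.down.1 + -(x 0).2.1.down.1 + -(x 0).2.2.down.1 =
        -((x 0).1.down.1 + (x 0).2.1.down.1 + (x 0).2.2.down.1)
      abel
    · change ((x 0).1.down.1 + (x 1).1.down.1) + ((x 0).2.1.down.1 + (x 1).2.1.down.1) +
        ((x 0).2.2.down.1 + (x 1).2.2.down.1) =
        ((x 0).1.down.1 + (x 0).2.1.down.1 + (x 0).2.2.down.1) +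
          ((x 1).1.down.1 + (x 1).2.1.down.1 + (x 1).2.2.down.1)
      abel
    · change (x 0).1.down.1 <• r + (x 0).2.1.down.1 <• r + (x 0).2.2.down.1 <• r =
        ((x 0).1.down.1 + (x 0).2.1.down.1 + (x 0).2.2.down.1) <• r
      rw [smul_add, smul_add]
  map_rel' := fun r => r.elim

theorem v_carrierEquiv (x : (toSplitModel.{u, a, b, w} hS hdiv).Carrier) :
    V.toValueSet (carrierEquiv.{u, a, b, w} hS hdiv x) =
      valueEquiv.{u, a, b, w} hS hdiv ((toSplitModel.{u, a, b, w} hS hdiv).val x) := by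
  change V.v (x.1.down.1 + x.2.1.down.1 + x.2.2.down.1) =
    ((toSplitModel.{u, a, b, w} hS hdiv).val x).down
  have hE := V.geTheta.add_mem (hS.le_geTheta_of_mem_C x.2.1.down.2)
    (gtTheta_le_geTheta (hS.le_gtTheta_of_mem_A x.2.2.down.2))
  by_cases h1 : x.1 = 0
  · have h1' : x.1.down.1 = 0 := by rw [h1]; rfl
    rw [h1', zero_add]
    by_cases h2 : x.2.1 = 0
    · have h2' : x.2.1.down.1 = 0 := by rw [h2]; rfl
      rw [h2', zero_add, SplitModel.val_of_eq_of_eq h1 h2]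
      rfl
    · have h2' : x.2.1.down.1 ≠ 0 := fun h => h2 (ULift.ext _ _ (Subtype.ext h))
      rw [SplitModel.val_of_eq_of_ne h1 h2, hS.v_add_of_ne' x.2.1.down.2 h2' x.2.2.down.2]
      exact eq_theta (hS.eq_of_mem _ x.2.1.down.2 h2') fun h => h2' ((V.eq_top_iff _).1 h)
  · have h1' : x.1.down.1 ≠ 0 := fun h => h1 (ULift.ext _ _ (Subtype.ext h))
    rw [SplitModel.val_of_ne h1, add_assoc, hS.v_add_of_ne x.1.down.2 h1' hE]
    rfl

/-- On `A` and `B` nonzero ring elements act on values through powers of `τ`, so the components of a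
torsion element there vanish. -/
theorem mem_C_of_act_eq_zero (hS : V.IsSplitting B C A) {x : F} {r : TwistedPolynomial φ}
    (hr : r ≠ 0) (hx : x <• r = 0) : x ∈ C := by
  obtain ⟨b, hb, c, hc, a, ha, rfl⟩ := hS.exists_eq x
  rw [smul_add, smul_add] at hx
  obtain ⟨h1, -, h3⟩ := hS.eq_zero (B.smul_mem _ hb) (C.smul_mem _ hc) (A.smul_mem _ ha) hx
  have hb0 : b = 0 := by
    have := hS.v_act_piece false (x := b) hb hr
    rw [h1, V.map_zero] at this
    by_contra hne
    exact V.iterate_τ_ne_top (fun h => hne ((V.eq_top_iff b).1 h)) _ this.symm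
  have ha0 : a = 0 := by
    have := hS.v_act_piece true (x := a) ha hr
    rw [h3, V.map_zero] at this
    by_contra hne
    exact V.iterate_τ_ne_top (fun h => hne ((V.eq_top_iff a).1 h)) _ this.symm
  rw [hb0, ha0, zero_add, add_zero]
  exact hc

theorem annAtLeast_iff {r : TwistedPolynomial φ} (hr : r ≠ 0) (n : ℕ) :
    (toSplitModel.{u, a, b, w} hS hdiv).AnnAtLeast r n ↔
      ∃ e : Fin n → torsionSubmodule φ F, Function.Injective e ∧ ∀ i, e i <• r = 0 := by
  constructor
  · rintro ⟨e, he, her⟩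
    have h0 : ∀ i, (e i).down.1 <• r = 0 := fun i =>
      congrArg (fun x : ULift.{max b w} C => x.down.1) (her i)
    refine ⟨fun i => ⟨(e i).down.1, r, hr, h0 i⟩, fun i j hij => ?_,
      fun i => Subtype.ext (h0 i)⟩
    have h1 : (e i).down.1 = (e j).down.1 := congrArg (fun x : torsionSubmodule φ F => x.1) hij
    exact he (ULift.ext _ _ (Subtype.ext h1))
  · rintro ⟨e, he, her⟩
    have h0 : ∀ i, (e i).1 <• r = 0 := fun i => congrArg Subtype.val (her i)
    refine ⟨fun i => ⟨⟨(e i).1, hS.mem_C_of_act_eq_zero hr (h0 i)⟩⟩, fun i j hij => ?_,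
      fun i => ULift.ext _ _ (Subtype.ext (h0 i))⟩
    have h2 := congrArg ULift.down hij
    have h1 := congrArg Subtype.val h2
    exact he (Subtype.ext h1)

/-- Since `v` is surjective, a fixed point of `τ` other than `∞` is the value of some element. Its
component in `C` cannot be zero, as elements of `B + A` do not have such a value. -/
theorem nontrivial_C_iff :
    Nontrivial (toSplitModel.{u, a, b, w} hS hdiv).C ↔ ∃ γ, V.τ γ = γ ∧ γ ≠ ⊤ := by
  constructor
  · intro _
    obtain ⟨c, hc⟩ := exists_ne (0 : (toSplitModel.{u, a, b, w} hS hdiv).C)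
    have hc0 : c.down.1 ≠ 0 := fun h => hc (ULift.ext _ _ (Subtype.ext h))
    exact ⟨_, hS.eq_of_mem _ c.down.2 hc0, fun h => hc0 ((V.eq_top_iff _).1 h)⟩
  · rintro ⟨γ, h1, h2⟩
    by_contra htriv
    rw [not_nontrivial_iff_subsingleton] at htriv
    obtain ⟨x, rfl⟩ := V.surjective γ
    obtain ⟨b, hb, c, hc, a, ha, rfl⟩ := hS.exists_eq x
    have hc0 : c = 0 := congrArg (fun x : ULift.{max b w} C => x.down.1)
      (Subsingleton.elim (α := (toSplitModel.{u, a, b, w} hS hdiv).C) ⟨⟨c, hc⟩⟩ 0)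
    rw [hc0, add_zero] at h1 h2
    by_cases hb0 : b = 0
    · rw [hb0, zero_add] at h1 h2
      exact (hS.gt_of_mem a ha fun h => h2 ((V.eq_top_iff a).2 h)).ne h1.symm
    · rw [hS.v_add_of_ne hb hb0 (gtTheta_le_geTheta (hS.le_gtTheta_of_mem_A ha))] at h1
      exact (hS.lt_of_mem b hb hb0).ne h1

end IsSplitting

end ValuedModule

end Splittings

/-! ### Transfer of the hypotheses to split models and conclusion. -/

section Transfer

open FirstOrder TwistedPolynomial

universe u a b w

/-- The function symbol `.r` of `LMod`. -/
def actSymbol {R : Type*} (r : R) : (LMod R).Functions 1 := ModuleFunc.act r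

/-- The function symbol `0` of `LMod`. -/
def zeroSymbol (R : Type*) : (LMod R).Functions 0 := ModuleFunc.zero

/-- The sentence expressing that at least `n` elements are killed by `r`. -/
noncomputable def annSentence {R : Type*} (r : R) (n : ℕ) : (LMod R).Sentence :=
  Language.Formula.iExs (Fin n)
    ((Language.Formula.iInf fun i : Fin n =>
      ((actSymbol r).apply₁ (Language.Term.var (Sum.inr i))).equal
        (Language.Constants.term (zeroSymbol R))) ⊓
      Language.Formula.iInf fun p : {p : Fin n × Fin n // p.1 ≠ p.2} =>
        Language.Formula.not
          ((Language.Term.var (Sum.inr p.1.1)).equal (Language.Term.var (Sum.inr p.1.2))))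

theorem realize_annSentence {R M : Type*} [Ring R] [AddCommGroup M] [Module Rᵐᵒᵖ M] (r : R)
    (n : ℕ) : M ⊨ annSentence r n ↔
      ∃ e : Fin n → M, Function.Injective e ∧ ∀ i, e i <• r = 0 := by
  rw [Language.Sentence.Realize, annSentence, Language.Formula.realize_iExs]
  refine exists_congr fun e => ?_
  rw [Language.Formula.realize_inf, Language.Formula.realize_iInf, Language.Formula.realize_iInf,
    and_comm]
  refine and_congr ⟨fun h i j hij => ?_, fun h p hp => ?_⟩ (forall_congr' fun i => ?_)
  · by_contra hne
    exact h ⟨(i, j), hne⟩ (Language.Formula.realize_equal.2 hij)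
  · exact p.2 (h (Language.Formula.realize_equal.1 hp))
  · rw [Language.Formula.realize_equal, Language.Term.realize_functions_apply₁]
    rfl

namespace SplitModel

variable {K : Type u} [Field K] {φ : K →+* K} {h : Bool → TwistedPolynomial φ → ℕ}
  {M N : SplitModel.{u, w} φ h}

/-- `∞` is a constant of the language; substituting it for all variables turns a formula into a
sentence. -/
theorem elementaryRel_top (hval : LV.ElementarilyEquivalent M.Δ N.Δ) :
    ElementaryRel LV ({(⊤, ⊤)} : Set (M.Δ × N.Δ)) := by
  intro k p hp ψ
  have key := Language.elementarilyEquivalent_iff.1 hval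
    (Language.BoundedFormula.subst ψ fun _ => Language.Term.func inftySymbol Fin.elim0)
  simp only [Language.Sentence.Realize, Language.Formula.Realize,
    Language.BoundedFormula.realize_subst] at key
  have e1 : (fun i => (p i).1) = fun _ => (⊤ : M.Δ) := funext fun i => by rw [hp i]
  have e2 : (fun i => (p i).2) = fun _ => (⊤ : N.Δ) := funext fun i => by rw [hp i]
  rw [e1, e2]
  exact key

theorem exists_fixed_of_elementarilyEquivalent (hval : LV.ElementarilyEquivalent M.Δ N.Δ)
    (hex : ∃ γ, M.τ γ = γ ∧ γ ≠ ⊤) : ∃ γ, N.τ γ = γ ∧ γ ≠ ⊤ :=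
  (defPair_τ_eq.inter defPair_eq_top.compl).nonempty (elementaryRel_top hval) hex

/-- `θ` is definable: either it is the only fixed point of `τ` other than `∞`, or there is none on
either side and both `θ` are `∞`. -/
theorem elementaryRel_theta (hval : LV.ElementarilyEquivalent M.Δ N.Δ) (hM : M.IsTheta)
    (hN : N.IsTheta) : ElementaryRel LV (insert (M.θ, N.θ) ({(⊤, ⊤)} : Set (M.Δ × N.Δ))) := by
  by_cases hθ : M.θ = ⊤
  · have hθ' : N.θ = ⊤ := by
      by_contra hne
      obtain ⟨γ, h1, h2⟩ := exists_fixed_of_elementarilyEquivalent hval.symm ⟨N.θ, hN.1, hne⟩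
      exact h2 ((hM.2 γ h1 h2).trans hθ)
    rw [hθ, hθ', Set.insert_eq_of_mem (Set.mem_singleton _)]
    exact elementaryRel_top hval
  · exact (elementaryRel_top hval).insert_of_defPair ⟨_, rfl⟩
      (defPair_τ_eq.inter defPair_eq_top.compl) ⟨hM.1, hθ⟩ fun γ hγ => hN.2 γ hγ.1 hγ.2

/-- The partial isomorphism between split models with elementarily equivalent value sets which is
defined at `0` only. -/
noncomputable def PartialIso.ofElementarilyEquivalent (hval : LV.ElementarilyEquivalent M.Δ N.Δ)
    (hM : M.IsTheta) (hN : N.IsTheta)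
    (hann : ∀ r, r ≠ 0 → ∀ n, M.AnnAtLeast r n ↔ N.AnnAtLeast r n)
    (hC : Nontrivial M.C ↔ Nontrivial N.C) : PartialIso M N where
  ρ := tauClosure (insert (M.θ, N.θ) {(⊤, ⊤)})
  elementary := ElementaryRel.tauClosure (elementaryRel_theta hval hM hN)
  τ_mem := tau_mem_tauClosure
  top_mem := subset_tauClosure (Or.inr rfl)
  θ_mem := subset_tauClosure (Or.inl rfl)
  g _ := ⊥
  g_closed := fun ε p r hr hp => by
    rw [Submodule.mem_bot] at hp ⊢
    exact Prod.ext (act_eq_zero hr (congrArg Prod.fst hp)) (act_eq_zero hr (congrArg Prod.snd hp))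
  g_val := fun ε p hp => by
    rw [(Submodule.mem_bot _).1 hp, Prod.fst_zero, Prod.snd_zero, v_zero, v_zero]
    exact subset_tauClosure (Or.inr rfl)
  gC := ⊥
  gC_zero := fun p hp => by
    rw [(Submodule.mem_bot _).1 hp, Prod.fst_zero, Prod.snd_zero]
    exact iff_of_true rfl rfl
  ann_iff := hann
  nontrivial_iff := hC

end SplitModel

namespace ValuedModule.IsSplitting

variable {K : Type u} [Field K] {φ : K →+* K} {F : Type a} {Δ : Type b} [AddCommGroup F]
  [Module (TwistedPolynomial φ)ᵐᵒᵖ F] [LinearOrder Δ] [OrderTop Δ] {V : ValuedModule φ F Δ}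
  {B C A : Submodule (TwistedPolynomial φ)ᵐᵒᵖ F} (hS : V.IsSplitting B C A)
  (hdiv : IsDivisibleModule φ F)

theorem isTheta_toSplitModel : (toSplitModel.{u, a, b, w} hS hdiv).IsTheta :=
  ⟨ULift.ext _ _ τ_theta, fun _ h1 h2 => ULift.ext _ _
    (eq_theta (congrArg ULift.down h1) fun h => h2 (ULift.ext _ _ h))⟩

theorem nontrivial_C_iff_exists_fixed : Nontrivial (toSplitModel.{u, a, b, w} hS hdiv).C ↔
    ∃ γ, (toSplitModel.{u, a, b, w} hS hdiv).τ γ = γ ∧ γ ≠ ⊤ := by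
  rw [nontrivial_C_iff]
  constructor
  · rintro ⟨γ, h1, h2⟩
    exact ⟨⟨γ⟩, ULift.ext _ _ h1, fun h => h2 (congrArg ULift.down h)⟩
  · rintro ⟨γ, h1, h2⟩
    exact ⟨γ.down, congrArg ULift.down h1, fun h => h2 (ULift.ext _ _ h)⟩

theorem realize_toSplitModel
    (σ : TwoSorted.Formula (LMod (TwistedPolynomial φ)) LV 0 0) :
    σ.Realize V.toValueSet Fin.elim0 Fin.elim0 ↔
      σ.Realize (toSplitModel.{u, a, b, w} hS hdiv).val Fin.elim0 Fin.elim0 := by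
  rw [← σ.realize_equiv (carrierEquiv.{u, a, b, w} hS hdiv) (valueEquiv.{u, a, b, w} hS hdiv)
    (v_carrierEquiv.{u, a, b, w} hS hdiv)]
  rw [Subsingleton.elim (_ ∘ Fin.elim0) Fin.elim0, Subsingleton.elim (_ ∘ Fin.elim0) Fin.elim0]

end ValuedModule.IsSplitting

theorem elementarilyEquivalent_of_isSplitting {K : Type*} [Field K] {φ : K →+* K}
    {F : Type a} {ΔF : Type b} [AddCommGroup F] [Module (TwistedPolynomial φ)ᵐᵒᵖ F]
    [LinearOrder ΔF] [OrderTop ΔF]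
    {G : Type u} {ΔG : Type w} [AddCommGroup G] [Module (TwistedPolynomial φ)ᵐᵒᵖ G]
    [LinearOrder ΔG] [OrderTop ΔG] {v : ValuedModule φ F ΔF} {w' : ValuedModule φ G ΔG}
    {B C A : Submodule (TwistedPolynomial φ)ᵐᵒᵖ F} (hF : v.IsSplitting B C A)
    {B' C' A' : Submodule (TwistedPolynomial φ)ᵐᵒᵖ G} (hG : w'.IsSplitting B' C' A')
    (hFdiv : IsDivisibleModule φ F) (hGdiv : IsDivisibleModule φ G)
    (htor : (LMod (TwistedPolynomial φ)).ElementarilyEquivalent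
      (torsionSubmodule φ F) (torsionSubmodule φ G))
    (hval : LV.ElementarilyEquivalent v.ValueSet w'.ValueSet) :
    TwoSorted.ElementarilyEquivalent (LMod (TwistedPolynomial φ)) LV
      v.toValueSet w'.toValueSet := by
  intro σ
  -- Each model is lifted by the universes of the other, so that a partial isomorphism between the
  -- two makes sense.
  rw [ValuedModule.IsSplitting.realize_toSplitModel.{_, a, b, max u w} hF hFdiv,
    ValuedModule.IsSplitting.realize_toSplitModel.{_, u, w, max a b} hG hGdiv]
  have hval' : LV.ElementarilyEquivalent
      (ValuedModule.IsSplitting.toSplitModel.{_, a, b, max u w} hF hFdiv).Δ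
      (ValuedModule.IsSplitting.toSplitModel.{_, u, w, max a b} hG hGdiv).Δ :=
    ((Language.StrongHomClass.elementarilyEquivalent (hF.valueEquiv hFdiv)).trans hval).trans
      (Language.StrongHomClass.elementarilyEquivalent (hG.valueEquiv hGdiv)).symm
  refine SplitModel.PartialIso.realize_iff σ
    (SplitModel.PartialIso.ofElementarilyEquivalent hval' (hF.isTheta_toSplitModel hFdiv)
      (hG.isTheta_toSplitModel hGdiv) (fun r hr n => ?_) ?_) (fun i => i.elim0) fun i => i.elim0
  · rw [hF.annAtLeast_iff hFdiv hr, hG.annAtLeast_iff hGdiv hr]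
    exact (realize_annSentence r n).symm.trans
      ((Language.elementarilyEquivalent_iff.1 htor _).trans (realize_annSentence r n))
  · rw [hF.nontrivial_C_iff_exists_fixed, hG.nontrivial_C_iff_exists_fixed]
    exact ⟨SplitModel.exists_fixed_of_elementarilyEquivalent hval',
      SplitModel.exists_fixed_of_elementarilyEquivalent hval'.symm⟩

end Transfer

theorem theorem1p2 {K : Type*} [Field K] (φ : K →+* K)
    {F ΔF : Type*} [AddCommGroup F] [Module (TwistedPolynomial φ)ᵐᵒᵖ F]
    [LinearOrder ΔF] [OrderTop ΔF]
    {G ΔG : Type*} [AddCommGroup G] [Module (TwistedPolynomial φ)ᵐᵒᵖ G]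
    [LinearOrder ΔG] [OrderTop ΔG]
    (v : ValuedModule φ F ΔF) (w : ValuedModule φ G ΔG)
    (hF : Nontrivial F) (hG : Nontrivial G)
    (hvHens : v.IsHenselian) (hwHens : w.IsHenselian)
    (hFdiv : IsDivisibleModule φ F) (hGdiv : IsDivisibleModule φ G)
    (htor : (LMod (TwistedPolynomial φ)).ElementarilyEquivalent
      (torsionSubmodule φ F) (torsionSubmodule φ G))
    (hval : LV.ElementarilyEquivalent v.ValueSet w.ValueSet) :
    TwoSorted.ElementarilyEquivalent (LMod (TwistedPolynomial φ)) LV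
      v.toValueSet w.toValueSet := by
  obtain ⟨B, C, A, hv⟩ := ValuedModule.exists_isSplitting hFdiv hvHens
  obtain ⟨B', C', A', hw⟩ := ValuedModule.exists_isSplitting hGdiv hwHens
  exact elementarilyEquivalent_of_isSplitting hv hw hFdiv hGdiv htor hval
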